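/- **Setting.** Let $X_1,X_2,\dots$ be i.i.d. with values in a countable set $\mathcal X$ and probability mass function $f(\cdot\mid\theta)$, $\theta\in\Theta\subseteq\mathbb R^p$; put $p_n(\mathbf x\mid\theta)=\prod_{i\le n}f(x_i\mid\theta)$ for $\mathbf x\in\mathcal X^n$. For a prior density $\pi$ on $\Theta$ let $r_n(\mathbf x)=\int_\Theta p_n(\mathbf x\mid\theta)\pi(\theta)\,d\theta$. A two-part code consists of a partition of $\mathcal X^n$ into finitely many cells $P_1,\dots,P_k$ and codepoints $\theta_1,\dots,\theta_k\in\Theta$; with $q_j=\sum_{\mathbf x\in P_j}r_n(\mathbf x)$ its expected codelength is $$-\sum_j q_j\log q_j-\sum_j\sum_{\mathbf x\in P_j}r_n(\mathbf x)\log p_n(\mathbf x\mid\theta_j).$$ An optimal SMML partition $\{P^*_{j,n}\}_{j\le k_n}$ with codepoints $\theta^*_{j,n}$ is a code with all $q^*_{j,n}>0$ whose expected codelength is finite and minimal among all such codes. Let $$\Lambda_{j,n}(\mathbf x)=-\log q^*_{j,n}-\log p_n(\mathbf x\mid\theta^*_{j,n})$$ be the length of the message that encodes $\mathbf x$ through cell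 $j$. Let $J_1(\theta)=\mathbb E_\theta[\nabla\log f(X_1\mid\theta)\,\nabla\log f(X_1\mid\theta)']$, and let $d_F$ be the Riemannian distance on $\Theta$ of the metric $J_1$ (infimum of lengths of $C^1$ paths in $\Theta$; $\infty$ if there are none). Let $\hat\theta(\mathbf x)$ be a maximum likelihood estimate (MLE) in $\Theta$, where one exists. The weighted Fisher–Voronoi cells are $$V_{j,n}=\{\theta\in\Theta: d_F^2(\theta,\theta^*_{j,n})+\omega_{j,n}\le d_F^2(\theta,\theta^*_{\ell,n})+\omega_{\ell,n}\ \ \forall\ell\},\qquad \omega_{j,n}=-\tfrac2n\log q^*_{j,n}.$$ **Assumptions.** 1. $\Theta$ is open and $\theta_0\in\Theta$ is the true parameter. 2. The support of $f(\cdot\mid\theta)$ does not depend on $\theta\in\Theta$; $\pi$ is a proper density on $\Theta$, continuous and strictly positive near $\theta_0$. 3. $\theta\mapsto\log f(x\mid\theta)$ is $C^3$ on $\Theta$ for every $x$ in the support. For every compact $K\subset\Theta$ and all large $n$, every $\mathbf x$ with $r_n(\mathbf x)>0$ in a cell with $\theta^*_{j,n}\in K$ has an MLE. 4. $J_1$ exists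 on $\Theta$, and for every compact $K\subset\Theta$ there are $0<c_1\le c_2<\infty$ with $c_1I\preceq J_1(\theta)\preceq c_2I$ for $\theta\in K$. 5. (Domination, justifying differentiation under the sum.) Every point of $\Theta$ has a neighbourhood $U$ and functions $F,M$ on $\mathcal X$ such that $f(x\mid\theta)\le F(x)$ and the derivatives of $\log f(x\mid\cdot)$ at $\theta$ of orders $1,2,3$ are bounded in norm by $M(x)$ for all $x\in\mathcal X$ and $\theta\in U\cap\Theta$, and $\sum_xF(x)(1+M(x))^3<\infty$. 6. (Identifiability.) For every neighbourhood $U$ of $\theta_0$, $\inf_{\theta\in\Theta\setminus U}\sum_x|f(x\mid\theta)-f(x\mid\theta_0)|>0$. Moreover $f(\cdot\mid\theta_0)$ has finite entropy. 7. (Mesh condition.) For all large $n$ an optimal SMML partition exists, and such a partition with its codepoints is fixed. Let $Q_{j,n}$ consist of $\theta^*_{j,n}$ and of the MLEs $\hat\theta(\mathbf x)$ of those $\mathbf x\in P^*_{j,n}$ with $r_n(\mathbf x)>0$ that have one, and let $\delta_n(\theta)$ be the largest $d_F$-diameter of a set $Q_{j,n}$ containing $\theta$ ($0$ if there is none). For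 every compact $K\subset\Theta$, $\sup_{\theta\in K}\delta_n(\theta)=O(n^{-1/2})$. **Conclusion.** With data $\mathbf X_n=(X_1,\dots,X_n)$ drawn under $\theta_0$, as $n\to\infty$: (a) The MLE exists and, for all $j\le k_n$ simultaneously, $\mathbf X_n\in P^*_{j,n}\iff\hat\theta(\mathbf X_n)\in V_{j,n}$, with probability tending to $1$. (b) Say that the local quadratic approximation is valid on sets $D_n\subseteq\mathcal X^n$ over a compact $K\subset\Theta$ if for every $R>0$ $$\log p_n(\mathbf x\mid\hat\theta)-\log p_n(\mathbf x\mid\theta)=\tfrac n2(\theta-\hat\theta)'J_1(\hat\theta)(\theta-\hat\theta)+o(1)$$ uniformly over $\mathbf x\in D_n$ with $\hat\theta=\hat\theta(\mathbf x)\in K$ and $\theta\in\Theta$ with $d_F(\hat\theta,\theta)\le Rn^{-1/2}$. In that case, for every $R>0$, $$\tfrac n2\{d_F^2(\hat\theta,\theta^*_{j,n})-d_F^2(\hat\theta,\theta^*_{\ell,n})\}=\log\frac{q^*_{j,n}}{q^*_{\ell,n}}+\Lambda_{j,n}(\mathbf x)-\Lambda_{\ell,n}(\mathbf x)+o(1)$$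 uniformly over $\mathbf x\in D_n$ with $\hat\theta=\hat\theta(\mathbf x)\in K$ and over locally competing cells $j,\ell$, i.e. those with $d_F(\hat\theta,\theta^*_{j,n}),d_F(\hat\theta,\theta^*_{\ell,n})\le Rn^{-1/2}$. In particular, on the boundary between the two cells, where $\Lambda_{j,n}=\Lambda_{\ell,n}$, the point $\theta=\hat\theta(\mathbf x)$ satisfies $\tfrac n2\{d_F^2(\theta,\theta^*_{j,n})-d_F^2(\theta,\theta^*_{\ell,n})\}=\log(q^*_{j,n}/q^*_{\ell,n})+o(1)$. (c) For every $R,\varepsilon>0$, with probability tending to $1$, the MLE of $\mathbf X_n$ exists, the first display of (b) holds at $\mathbf x=\mathbf X_n$ for all $\theta\in\Theta$ with $d_F(\hat\theta,\theta)\le Rn^{-1/2}$ with error at most $\varepsilon$, and the second holds at $\mathbf x=\mathbf X_n$ for all pairs of locally competing cells with error at most $\varepsilon$. -/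

import Mathlib

open Set Filter Topology MeasureTheory
open scoped ENNReal

noncomputable section

namespace SMML

/-- Euclidean parameter space `ℝᵖ`. -/
abbrev Param (p : ℕ) : Type := EuclideanSpace ℝ (Fin p)

variable {p : ℕ} {𝒳 : Type*} {n : ℕ}

/-! ### The i.i.d. model on a countable sample space

`f x θ` is the probability of the single observation `x` under the parameter `θ`. -/

/-- The joint likelihood `p_n(x | θ)` of a data set of size `n`. -/
def lik (f : 𝒳 → Param p → ℝ) (x : Fin n → 𝒳) (θ : Param p) : ℝ :=
  ∏ i, f (x i) θ

/-- The probability of the event `A` when the data set of size `n` is drawn i.i.d. from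
`f · θ`. -/
def prob (f : 𝒳 → Param p → ℝ) (θ : Param p) (A : Set (Fin n → 𝒳)) : ℝ :=
  ∑' x : Fin n → 𝒳, A.indicator (fun x => lik f x θ) x

/-- The marginal probability `r_n(x)` of a data set under the prior density `π` on `Θ`. -/
def marginal (f : 𝒳 → Param p → ℝ) (Θ : Set (Param p)) (π : Param p → ℝ)
    (x : Fin n → 𝒳) : ℝ :=
  ∫ θ in Θ, lik f x θ * π θ

/-- `t` is a maximum likelihood estimate in `Θ` for the data set `x`. -/
def IsMLE (f : 𝒳 → Param p → ℝ) (Θ : Set (Param p)) (x : Fin n → 𝒳) (t : Param p) : Prop :=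
  t ∈ Θ ∧ ∀ θ ∈ Θ, lik f x θ ≤ lik f x t

/-- `f` is a family of probability mass functions on `Θ` whose support does not depend on the
parameter. -/
structure IsModel (f : 𝒳 → Param p → ℝ) (Θ : Set (Param p)) : Prop where
  nonneg : ∀ x, ∀ θ ∈ Θ, 0 ≤ f x θ
  hasSum_one : ∀ θ ∈ Θ, HasSum (fun x => f x θ) 1
  support : ∀ x, ∀ θ ∈ Θ, ∀ θ' ∈ Θ, f x θ = 0 → f x θ' = 0

/-- `π` is a proper prior density on `Θ`, continuous and strictly positive near `θ₀`. -/
structure IsPrior (π : Param p → ℝ) (Θ : Set (Param p)) (θ₀ : Param p) : Prop where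
  nonneg : ∀ θ ∈ Θ, 0 ≤ π θ
  integrable : IntegrableOn π Θ
  integral_one : ∫ θ in Θ, π θ = 1
  regular : ∃ U ∈ 𝓝 θ₀, ContinuousOn π U ∧ ∀ θ ∈ U, 0 < π θ

/-- Locally uniform domination of the log-density derivatives up to order three, which makes
termwise differentiation under the sum over the sample space legitimate up to order three:
a derivative of order at most three of `f x` is bounded by a constant times
`F x * (1 + M x) ^ 3`. -/
def LocallyDominated (f : 𝒳 → Param p → ℝ) (Θ : Set (Param p)) : Prop :=
  ∀ θ₁ ∈ Θ, ∃ U ∈ 𝓝 θ₁, ∃ F M : 𝒳 → ℝ,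
    Summable (fun x => F x * (1 + M x) ^ 3) ∧
    ∀ x, ∀ θ ∈ U ∩ Θ, f x θ ≤ F x ∧
      ∀ k ∈ Finset.Icc 1 3, ‖iteratedFDeriv ℝ k (fun η => Real.log (f x η)) θ‖ ≤ M x

/-- `θ₀` is identifiable within `Θ`: outside every neighbourhood of `θ₀` the distributions
`f · θ` stay away from `f · θ₀` in total variation. -/
def IdentifiableAt (f : 𝒳 → Param p → ℝ) (Θ : Set (Param p)) (θ₀ : Param p) : Prop :=
  ∀ U ∈ 𝓝 θ₀, ∃ ε > 0, ∀ θ ∈ Θ, θ ∉ U → ε ≤ ∑' x, |f x θ - f x θ₀|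

/-! ### Fisher information and the Fisher–Rao distance -/

/-- The gradient of the log-density of one observation. -/
def score (f : 𝒳 → Param p → ℝ) (x : 𝒳) (θ : Param p) : Param p :=
  gradient (fun η => Real.log (f x η)) θ

/-- The per-observation Fisher information matrix `J₁(θ)`. -/
def fisherInfo (f : 𝒳 → Param p → ℝ) (θ : Param p) : Matrix (Fin p) (Fin p) ℝ :=
  fun a b => ∑' x, f x θ * (score f x θ a * score f x θ b)

/-- The Fisher information exists on `Θ` and is locally uniformly positive definite and
bounded, in the Loewner order. -/
structure FisherRegular (f : 𝒳 → Param p → ℝ) (Θ : Set (Param p)) : Prop where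
  exists_info : ∀ θ ∈ Θ, Summable (fun x => f x θ * ‖score f x θ‖ ^ 2)
  bounds : ∀ K ⊆ Θ, IsCompact K → ∃ c₁ c₂ : ℝ, 0 < c₁ ∧ c₁ ≤ c₂ ∧ ∀ θ ∈ K,
    (fisherInfo f θ - c₁ • (1 : Matrix (Fin p) (Fin p) ℝ)).PosSemidef ∧
    (c₂ • (1 : Matrix (Fin p) (Fin p) ℝ) - fisherInfo f θ).PosSemidef

/-- The quadratic form `v' J₁(θ) v`. -/
def fisherForm (f : 𝒳 → Param p → ℝ) (θ v : Param p) : ℝ :=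
  ∑ a, ∑ b, v a * fisherInfo f θ a b * v b

/-- Length of a path `γ`, parametrised by `[0, 1]`, in the Riemannian metric `J₁`. -/
def fisherLength (f : 𝒳 → Param p → ℝ) (γ : ℝ → Param p) : ℝ≥0∞ :=
  ∫⁻ t in Icc (0 : ℝ) 1,
    ENNReal.ofReal (Real.sqrt (fisherForm f (γ t) (derivWithin γ (Icc 0 1) t)))

/-- The per-observation Fisher–Rao distance `d_F` on `Θ`: the infimum of the lengths of the
`C¹` paths in `Θ` (it is `∞` between different connected components of `Θ`). -/
def fisherRao (f : 𝒳 → Param p → ℝ) (Θ : Set (Param p)) (a b : Param p) : ℝ≥0∞ :=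
  ⨅ (γ : ℝ → Param p) (_ : ContDiffOn ℝ 1 γ (Icc 0 1)) (_ : MapsTo γ (Icc 0 1) Θ)
    (_ : γ 0 = a) (_ : γ 1 = b), fisherLength f γ

/-! ### Two-part codes -/

/-- The data of a two-part code for data sets of size `n`: a partition into finitely many cells,
given by the map sending a data set to the index of its cell, and a codepoint for each cell. -/
structure TwoPartCode (p : ℕ) (𝒳 : Type*) (n : ℕ) where
  /-- number of cells -/
  k : ℕ
  /-- the index of the cell that contains a data set -/
  cell : (Fin n → 𝒳) → Fin k
  /-- the codepoints -/
  code : Fin k → Param p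

namespace TwoPartCode

variable (f : 𝒳 → Param p → ℝ) (Θ : Set (Param p)) (π : Param p → ℝ) (C : TwoPartCode p 𝒳 n)

/-- The cell `P_j`. -/
def part (j : Fin C.k) : Set (Fin n → 𝒳) := {x | C.cell x = j}

/-- The assertion probability `q_j`. -/
def assertion (j : Fin C.k) : ℝ :=
  ∑' x : Fin n → 𝒳, (C.part j).indicator (marginal f Θ π) x

/-- The length `-log q_j - log p_n(x | θ_j)` of the message that encodes `x` through cell `j`. -/
def messageLength (j : Fin C.k) (x : Fin n → 𝒳) : ℝ :=
  -Real.log (C.assertion f Θ π j) - Real.log (lik f x (C.code j))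

/-- The expected two-part codelength
`-∑ⱼ q_j log q_j - ∑ⱼ ∑_{x ∈ P_j} r(x) log p_n(x | θ_j)`, as a sum over the data sets of
nonnegative extended reals; a data set with `r(x) = 0` contributes nothing. -/
def codelength : ℝ≥0∞ :=
  ∑' x : Fin n → 𝒳, ENNReal.ofReal (marginal f Θ π x) *
    (ENNReal.ofReal (-Real.log (C.assertion f Θ π (C.cell x))) +
      ENNReal.ofReal (-Real.log (lik f x (C.code (C.cell x)))))

/-- `C` consists of an optimal SMML partition (with cells of positive marginal probability) and
its codepoints: the expected codelength is finite and minimal, jointly over all finite partitions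
and all choices of codepoints in `Θ`. In particular each codepoint minimises the expected detail
length in its cell. (Competing cells of probability zero have no influence on the codelength.) -/
structure IsOptimal : Prop where
  code_mem : ∀ j, C.code j ∈ Θ
  assertion_pos : ∀ j, 0 < C.assertion f Θ π j
  finite : C.codelength f Θ π ≠ ∞
  minimal : ∀ C' : TwoPartCode p 𝒳 n, (∀ j, C'.code j ∈ Θ) →
    C.codelength f Θ π ≤ C'.codelength f Θ π

/-- The quantisation region of cell `j` in parameter space: its codepoint together with the
maximum likelihood estimates (selected by `mle`) of the data sets of positive marginal probability
in the cell. -/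
def region (mle : (Fin n → 𝒳) → Param p) (j : Fin C.k) : Set (Param p) :=
  {C.code j} ∪
    {t | ∃ x ∈ C.part j, 0 < marginal f Θ π x ∧ IsMLE f Θ x (mle x) ∧ t = mle x}

/-- The local mesh size `δ_n(θ)` at `θ`: the largest Fisher–Rao diameter of a quantisation region
that contains `θ`. -/
def meshSize (mle : (Fin n → 𝒳) → Param p) (θ : Param p) : ℝ≥0∞ :=
  ⨆ (j : Fin C.k) (_ : θ ∈ C.region f Θ π mle j)
    (a ∈ C.region f Θ π mle j) (b ∈ C.region f Θ π mle j), fisherRao f Θ a b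

/-- The weight `ω_j = -(2/n) log q_j`, a nonnegative real. -/
def weight (j : Fin C.k) : ℝ≥0∞ :=
  ENNReal.ofReal (-(2 / n) * Real.log (C.assertion f Θ π j))

/-- The weighted Fisher–Voronoi cell `V_j`. -/
def voronoi (j : Fin C.k) : Set (Param p) :=
  {θ | θ ∈ Θ ∧ ∀ l : Fin C.k,
    fisherRao f Θ θ (C.code j) ^ 2 + C.weight f Θ π j ≤
      fisherRao f Θ θ (C.code l) ^ 2 + C.weight f Θ π l}

/-- At `t`, the cells `j` and `l` compete locally at scale `R / √n`. -/
def Compete (R : ℝ) (t : Param p) (j l : Fin C.k) : Prop :=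
  fisherRao f Θ t (C.code j) ≤ ENNReal.ofReal (R / √n) ∧
  fisherRao f Θ t (C.code l) ≤ ENNReal.ofReal (R / √n)

/-- The quantity `(n/2) (d_F²(t, θ_j) - d_F²(t, θ_l)) - log (q_j / q_l)`, whose vanishing is the
equation of the boundary between the cells `j` and `l` in parameter space. -/
def boundaryDefect (t : Param p) (j l : Fin C.k) : ℝ :=
  (n / 2 : ℝ) * ((fisherRao f Θ t (C.code j)).toReal ^ 2 -
      (fisherRao f Θ t (C.code l)).toReal ^ 2) -
    Real.log (C.assertion f Θ π j / C.assertion f Θ π l)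

end TwoPartCode

/-- The local quadratic approximation of the log-likelihood of `x` at `t` holds with error at most
`ε` at Fisher–Rao scale `R / √n`. -/
def LocallyQuadratic (f : 𝒳 → Param p → ℝ) (Θ : Set (Param p)) (x : Fin n → 𝒳) (t : Param p)
    (R ε : ℝ) : Prop :=
  ∀ θ ∈ Θ, fisherRao f Θ t θ ≤ ENNReal.ofReal (R / √n) →
    |Real.log (lik f x t) - Real.log (lik f x θ) - (n / 2 : ℝ) * fisherForm f t (θ - t)| ≤ ε

end SMML

end

/-!
The theorem rests on three facts.

*Optimality.* Comparing an optimal code with a competitor that has one cell more, or that moves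
some data sets to another of its cells, and bounding the change of the codelength by Gibbs'
inequality, gives two estimates that need no regularity. Data sets whose message is longer than
`B` plus their likelihood codelength under a fixed parameter have marginal probability at most
`exp (1 - B)` (`IsOptimal.sum_marginal_le_exp`). Data sets outside the cell `j` for which the
message through `j` is at most `ε` longer than the one through their own cell have marginal
probability at most `4 ε q_j` (`IsOptimal.sum_marginal_le_of_nearTie`).

*Asymptotics of the likelihood.* By Chebyshev's inequality the data are regular (`IsRegular`) with
probability close to one: score, Hessian and the sum of the dominating functions have their
typical size. On regular data a maximum likelihood estimate near `θ₀` is within `O(1 / √n)` of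
`θ₀`, the log-likelihood is quadratic around it, and the law under `θ₀` is at most of the order
`n ^ (p / 2)` times the marginal law (`exists_marginal_ge`), so that the estimates of marginal
probabilities above transfer to the law under `θ₀`.

*Geometry.* Near each point the squared Fisher–Rao distance agrees with the Fisher form up to third
order (`exists_local_comparison`). Together with the quadratic approximation of the log-likelihood
this gives the boundary equation.

For the Voronoi description, the codepoint of the data is consistent: exponentially small
likelihoods away from `θ₀` on typical data would make the message too long
(`eventually_prob_code_notMem_le`). The mesh condition then brings the estimate and the codepoint
within `O(1 / √n)` of `θ₀`. The first estimate also shows that the assertion probability of the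
observed cell is polynomially bounded below, so only cells within `O(log n / √n)` compete. On this
scale the quadratic approximation has error `O(log ^ 3 n / √n)`. The cells in question have total
marginal probability `O((log n / √n) ^ p)`, by a Hellinger bound over a fine grid of parameters
(`exists_sum_marginal_le`). Hence the second estimate, with `ε = log ^ 4 n / √n`, shows that
near-ties have probability tending to zero. The minimal message length and the minimal weighted
squared distance are therefore attained, strictly, at the same cell.
-/

noncomputable section

namespace SMML

variable {p : ℕ} {𝒳 : Type*} {n : ℕ}

/-! ### Local domination and Taylor estimates for a single observation -/

/-- The `k`-th derivative of the log-density of one observation at `θ`, evaluated on the diagonal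
`(v, …, v)`. -/
def dlog (f : 𝒳 → Param p → ℝ) (k : ℕ) (x : 𝒳) (θ v : Param p) : ℝ :=
  iteratedFDeriv ℝ k (fun η => Real.log (f x η)) θ (fun _ => v)

/-- The domination hypothesis on the ball `ball θ₁ δ`, together with the smoothness of the
log-densities there. -/
structure DomBall (f : 𝒳 → Param p → ℝ) (Θ : Set (Param p)) (θ₁ : Param p) (δ : ℝ)
    (F M : 𝒳 → ℝ) : Prop where
  pos : 0 < δ
  subset : Metric.ball θ₁ δ ⊆ Θ
  F_nonneg : ∀ x, 0 ≤ F x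
  M_nonneg : ∀ x, 0 ≤ M x
  summable : Summable (fun x => F x * (1 + M x) ^ 3)
  le : ∀ x, ∀ θ ∈ Metric.ball θ₁ δ, f x θ ≤ F x
  norm_le : ∀ x, ∀ θ ∈ Metric.ball θ₁ δ, ∀ k, 1 ≤ k → k ≤ 3 →
    ‖iteratedFDeriv ℝ k (fun η => Real.log (f x η)) θ‖ ≤ M x
  smooth : ∀ x, ∀ θ ∈ Metric.ball θ₁ δ, ContDiffAt ℝ 3 (fun η => Real.log (f x η)) θ

section

variable {f : 𝒳 → Param p → ℝ} {Θ : Set (Param p)} {θ₁ : Param p} {δ : ℝ} {F M : 𝒳 → ℝ}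

theorem exists_domBall (hΘ : IsOpen Θ) (hf : IsModel f Θ)
    (hsmooth : ∀ x, ContDiffOn ℝ 3 (fun θ => Real.log (f x θ)) Θ)
    (hdom : LocallyDominated f Θ) (h₁ : θ₁ ∈ Θ) :
    ∃ δ F M, DomBall f Θ θ₁ δ F M := by
  obtain ⟨U, hU, F, M, hs, hb⟩ := hdom θ₁ h₁
  obtain ⟨δ, hδ, hball⟩ := Metric.mem_nhds_iff.1 (inter_mem hU (hΘ.mem_nhds h₁))
  have hc : θ₁ ∈ U ∩ Θ := hball (Metric.mem_ball_self hδ)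
  refine ⟨δ, F, M, hδ, fun θ h => (hball h).2, fun x => ?_, fun x => ?_, hs, fun x θ h => ?_,
    fun x θ h k h1 h3 => ?_, fun x θ h => ?_⟩
  · exact (hf.nonneg x θ₁ h₁).trans (hb x θ₁ hc).1
  · exact (norm_nonneg _).trans ((hb x θ₁ hc).2 1 (by simp))
  · exact (hb x θ (hball h)).1
  · exact (hb x θ (hball h)).2 k (by simp [h1, h3])
  · exact (hsmooth x).contDiffAt (hΘ.mem_nhds (hball h).2)

theorem IsModel.pos_or_eq_zero (hf : IsModel f Θ) (x : 𝒳) :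
    (∀ θ ∈ Θ, 0 < f x θ) ∨ ∀ θ ∈ Θ, f x θ = 0 := by
  by_cases h : ∃ θ ∈ Θ, f x θ = 0
  · obtain ⟨θ, hθ, h0⟩ := h
    exact Or.inr fun θ' hθ' => hf.support x θ hθ θ' hθ' h0
  · push Not at h
    exact Or.inl fun θ hθ => (hf.nonneg x θ hθ).lt_of_ne' (h θ hθ)

theorem dlog_smul (k : ℕ) (x : 𝒳) (θ v : Param p) (c : ℝ) :
    dlog f k x θ (c • v) = c ^ k * dlog f k x θ v := by
  have := (iteratedFDeriv ℝ k (fun η => Real.log (f x η)) θ).map_smul_univ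
    (fun _ => c) (fun _ => v)
  simpa [dlog] using this

theorem dlog_zero (x : 𝒳) (θ v : Param p) : dlog f 0 x θ v = Real.log (f x θ) := by
  simp [dlog]

theorem dlog_one (x : 𝒳) (θ v : Param p) :
    dlog f 1 x θ v = fderiv ℝ (fun η => Real.log (f x η)) θ v := by
  simp [dlog, iteratedFDeriv_one_apply]

theorem score_inner (x : 𝒳) (θ v : Param p) : ∑ a, score f x θ a * v a = dlog f 1 x θ v := by
  rw [dlog_one, ← inner_gradient_left, PiLp.inner_apply]
  simp [score, mul_comm]

theorem DomBall.abs_dlog_le (hd : DomBall f Θ θ₁ δ F M) {x : 𝒳} {θ : Param p}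
    (hθ : θ ∈ Metric.ball θ₁ δ) {k : ℕ} (h1 : 1 ≤ k) (h3 : k ≤ 3) (v : Param p) :
    |dlog f k x θ v| ≤ M x * ‖v‖ ^ k := by
  have := (iteratedFDeriv ℝ k (fun η => Real.log (f x η)) θ).le_opNorm (fun _ => v)
  simp only [Finset.prod_const, Finset.card_univ, Fintype.card_fin, Real.norm_eq_abs] at this
  exact this.trans (by gcongr; exact hd.norm_le x θ hθ k h1 h3)

theorem DomBall.abs_dlog_sub_le (hd : DomBall f Θ θ₁ δ F M) {x : 𝒳} {θ t : Param p}
    (hθ : θ ∈ Metric.ball θ₁ δ) (ht : t ∈ Metric.ball θ₁ δ) {k : ℕ} (h3 : k < 3) (v : Param p) :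
    |dlog f k x θ v - dlog f k x t v| ≤ M x * ‖θ - t‖ * ‖v‖ ^ k := by
  have h := (convex_ball θ₁ δ).norm_image_sub_le_of_norm_fderiv_le (𝕜 := ℝ) (C := M x)
    (f := iteratedFDeriv ℝ k (fun η => Real.log (f x η)))
    (fun y hy => (hd.smooth x y hy).differentiableAt_iteratedFDeriv (by exact_mod_cast h3))
    (fun y hy => by
      rw [norm_fderiv_iteratedFDeriv]
      exact hd.norm_le x y hy _ (by omega) (by omega)) ht hθ
  have := (iteratedFDeriv ℝ k (fun η => Real.log (f x η)) θ -
    iteratedFDeriv ℝ k (fun η => Real.log (f x η)) t).le_opNorm (fun _ => v)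
  simp only [Finset.prod_const, Finset.card_univ, Fintype.card_fin, Real.norm_eq_abs] at this
  exact this.trans (by gcongr)

theorem DomBall.abs_log_sub_le (hd : DomBall f Θ θ₁ δ F M) {x : 𝒳} {θ t : Param p}
    (hθ : θ ∈ Metric.ball θ₁ δ) (ht : t ∈ Metric.ball θ₁ δ) :
    |Real.log (f x θ) - Real.log (f x t)| ≤ M x * ‖θ - t‖ := by
  simpa [dlog_zero] using hd.abs_dlog_sub_le (x := x) hθ ht (k := 0) (by norm_num) 0

theorem DomBall.hasDerivAt_dlog (hd : DomBall f Θ θ₁ δ F M) {x : 𝒳} {a v : Param p} {h : ℝ}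
    (hθ : a + h • v ∈ Metric.ball θ₁ δ) {k : ℕ} (h3 : k < 3) :
    HasDerivAt (fun s : ℝ => dlog f k x (a + s • v) v) (dlog f (k + 1) x (a + h • v) v) h := by
  have h1 : HasFDerivAt (iteratedFDeriv ℝ k (fun η => Real.log (f x η))) _ (a + h • v) :=
    ((hd.smooth x _ hθ).differentiableAt_iteratedFDeriv
      (by exact_mod_cast h3)).hasFDerivAt
  have h2 : HasDerivAt (fun s : ℝ => a + s • v) v h := by
    simpa using ((hasDerivAt_id h).smul_const v).const_add a
  have h3 := h1.comp_hasDerivAt h h2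
  have h4 := ((ContinuousMultilinearMap.apply ℝ (fun _ : Fin k => Param p) ℝ
    (fun _ => v)).hasFDerivAt).comp_hasDerivAt h h3
  refine h4.congr_deriv ?_
  simp [dlog, iteratedFDeriv_succ_apply_left]
  rfl

/-- A Taylor estimate of order two on the unit interval, with a crude constant. -/
theorem abs_taylor_two_le {φ₀ φ₁ φ₂ φ₃ : ℝ → ℝ} {C : ℝ}
    (h₀ : ∀ t ∈ Icc (0 : ℝ) 1, HasDerivAt φ₀ (φ₁ t) t)
    (h₁ : ∀ t ∈ Icc (0 : ℝ) 1, HasDerivAt φ₁ (φ₂ t) t)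
    (h₂ : ∀ t ∈ Icc (0 : ℝ) 1, HasDerivAt φ₂ (φ₃ t) t)
    (hC : ∀ t ∈ Icc (0 : ℝ) 1, |φ₃ t| ≤ C) :
    |φ₀ 1 - φ₀ 0 - φ₁ 0 - φ₂ 0 / 2| ≤ C := by
  have hC0 : 0 ≤ C := (abs_nonneg _).trans (hC 0 (by simp))
  have e2 : ∀ t ∈ Icc (0 : ℝ) 1, |φ₂ t - φ₂ 0| ≤ C := fun t ht => by
    have := norm_image_sub_le_of_norm_deriv_le_segment' (f := φ₂) (f' := φ₃) (a := 0) (b := 1)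
      (C := C) (fun x hx => (h₂ x hx).hasDerivWithinAt)
      (fun x hx => hC x (Ico_subset_Icc_self hx)) t ht
    rw [Real.norm_eq_abs] at this
    nlinarith [ht.1, ht.2]
  have e1 : ∀ t ∈ Icc (0 : ℝ) 1, |φ₁ t - φ₁ 0 - t * φ₂ 0| ≤ C := fun t ht => by
    have := norm_image_sub_le_of_norm_deriv_le_segment' (f := fun t => φ₁ t - t * φ₂ 0)
      (f' := fun t => φ₂ t - 1 * φ₂ 0) (a := 0) (b := 1) (C := C)
      (fun x hx => ((h₁ x hx).sub ((hasDerivAt_id x).mul_const _)).hasDerivWithinAt)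
      (fun x hx => by simpa using e2 x (Ico_subset_Icc_self hx)) t ht
    rw [Real.norm_eq_abs] at this
    have h' : φ₁ t - φ₁ 0 - t * φ₂ 0 = φ₁ t - t * φ₂ 0 - (φ₁ 0 - 0 * φ₂ 0) := by ring
    rw [h']
    nlinarith [ht.1, ht.2]
  have := norm_image_sub_le_of_norm_deriv_le_segment'
      (f := fun t => φ₀ t - t * φ₁ 0 - t ^ 2 * (φ₂ 0 / 2))
      (f' := fun t => φ₁ t - 1 * φ₁ 0 - (2 * t) * (φ₂ 0 / 2)) (a := 0) (b := 1) (C := C)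
      (fun x hx => (((h₀ x hx).sub ((hasDerivAt_id x).mul_const _)).sub
        (((hasDerivAt_pow 2 x).congr_deriv (by simp)).mul_const _)).hasDerivWithinAt)
      (fun x hx => by
        have := e1 x (Ico_subset_Icc_self hx)
        rw [Real.norm_eq_abs]
        convert this using 2
        ring) 1 (by simp)
  rw [Real.norm_eq_abs] at this
  convert this using 2 <;> ring

theorem segment_mem_ball {c a v : Param p} {r : ℝ} (ha : a ∈ Metric.ball c r)
    (hv : a + v ∈ Metric.ball c r) {t : ℝ} (ht : t ∈ Icc (0 : ℝ) 1) :
    a + t • v ∈ Metric.ball c r := by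
  have := (convex_ball c r).add_smul_sub_mem ha hv ht
  simpa using this

theorem DomBall.abs_log_taylor_le (hd : DomBall f Θ θ₁ δ F M) {x : 𝒳} {a v : Param p}
    (ha : a ∈ Metric.ball θ₁ δ) (hv : a + v ∈ Metric.ball θ₁ δ) :
    |Real.log (f x (a + v)) - Real.log (f x a) - dlog f 1 x a v - dlog f 2 x a v / 2|
      ≤ M x * ‖v‖ ^ 3 := by
  have hm := fun t ht => segment_mem_ball ha hv (t := t) ht
  have := abs_taylor_two_le (φ₀ := fun s => dlog f 0 x (a + s • v) v)
    (φ₁ := fun s => dlog f 1 x (a + s • v) v) (φ₂ := fun s => dlog f 2 x (a + s • v) v)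
    (φ₃ := fun s => dlog f 3 x (a + s • v) v) (C := M x * ‖v‖ ^ 3)
    (fun t ht => hd.hasDerivAt_dlog (hm t ht) (by norm_num))
    (fun t ht => hd.hasDerivAt_dlog (hm t ht) (by norm_num))
    (fun t ht => hd.hasDerivAt_dlog (hm t ht) (by norm_num))
    (fun t ht => hd.abs_dlog_le (hm t ht) (by norm_num) (by norm_num) v)
  simpa [dlog_zero] using this

/-- The third derivative of `f x` along a line is at most `5 F (1 + M)³`. -/
theorem DomBall.abs_taylor_le (hf : IsModel f Θ) (hd : DomBall f Θ θ₁ δ F M) {x : 𝒳}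
    {a v : Param p} (ha : a ∈ Metric.ball θ₁ δ) (hv : a + v ∈ Metric.ball θ₁ δ) :
    |f x (a + v) - f x a - f x a * dlog f 1 x a v -
        f x a * (dlog f 1 x a v ^ 2 + dlog f 2 x a v) / 2|
      ≤ 5 * (F x * (1 + M x) ^ 3) * ‖v‖ ^ 3 := by
  have hF := hd.F_nonneg x
  have hM := hd.M_nonneg x
  rcases hf.pos_or_eq_zero x with hpos | h0
  · have hm := fun t ht => segment_mem_ball ha hv (t := t) ht
    set φ : ℝ → ℝ := fun s => Real.exp (dlog f 0 x (a + s • v) v) with hφ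
    have hφf : ∀ t ∈ Icc (0 : ℝ) 1, φ t = f x (a + t • v) := fun t ht => by
      simp only [hφ, dlog_zero]
      exact Real.exp_log (hpos _ (hd.subset (hm t ht)))
    have d0 := fun t ht => hd.hasDerivAt_dlog (x := x) (hm t ht) (k := 0) (by norm_num)
    have d1 := fun t ht => hd.hasDerivAt_dlog (x := x) (hm t ht) (k := 1) (by norm_num)
    have d2 := fun t ht => hd.hasDerivAt_dlog (x := x) (hm t ht) (k := 2) (by norm_num)
    simp only [zero_add, Nat.reduceAdd] at d0 d1 d2
    have e0 : ∀ t ∈ Icc (0 : ℝ) 1,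
        HasDerivAt φ (φ t * dlog f 1 x (a + t • v) v) t := fun t ht => (d0 t ht).exp
    have e1 : ∀ t ∈ Icc (0 : ℝ) 1,
        HasDerivAt (fun t => φ t * dlog f 1 x (a + t • v) v)
          (φ t * (dlog f 1 x (a + t • v) v ^ 2 + dlog f 2 x (a + t • v) v)) t := fun t ht =>
      ((e0 t ht).mul (d1 t ht)).congr_deriv (by ring)
    have e2 : ∀ t ∈ Icc (0 : ℝ) 1,
        HasDerivAt (fun t => φ t * (dlog f 1 x (a + t • v) v ^ 2 + dlog f 2 x (a + t • v) v))
          (φ t * (dlog f 1 x (a + t • v) v ^ 3 + 3 * (dlog f 1 x (a + t • v) v *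
            dlog f 2 x (a + t • v) v) + dlog f 3 x (a + t • v) v)) t := fun t ht =>
      ((e0 t ht).mul (((d1 t ht).pow 2).add (d2 t ht))).congr_deriv (by simp; ring)
    have hb : ∀ t ∈ Icc (0 : ℝ) 1, |φ t * (dlog f 1 x (a + t • v) v ^ 3 +
        3 * (dlog f 1 x (a + t • v) v * dlog f 2 x (a + t • v) v) + dlog f 3 x (a + t • v) v)| ≤
          5 * (F x * (1 + M x) ^ 3) * ‖v‖ ^ 3 := fun t ht => by
      have b1 := hd.abs_dlog_le (x := x) (hm t ht) (k := 1) (by norm_num) (by norm_num) v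
      have b2 := hd.abs_dlog_le (x := x) (hm t ht) (k := 2) (by norm_num) (by norm_num) v
      have b3 := hd.abs_dlog_le (x := x) (hm t ht) (k := 3) (by norm_num) (by norm_num) v
      rw [abs_mul, abs_of_pos (Real.exp_pos _)]
      have hle : φ t ≤ F x := by rw [hφf t ht]; exact hd.le x _ (hm t ht)
      have hin : |dlog f 1 x (a + t • v) v ^ 3 +
        3 * (dlog f 1 x (a + t • v) v * dlog f 2 x (a + t • v) v) + dlog f 3 x (a + t • v) v| ≤
          5 * (1 + M x) ^ 3 * ‖v‖ ^ 3 := by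
        calc _ ≤ |dlog f 1 x (a + t • v) v| ^ 3 +
              3 * (|dlog f 1 x (a + t • v) v| * |dlog f 2 x (a + t • v) v|) +
              |dlog f 3 x (a + t • v) v| := by
              refine (abs_add_le _ _).trans (add_le_add ((abs_add_le _ _).trans ?_) le_rfl)
              rw [abs_pow, abs_mul, abs_mul, abs_of_pos (by norm_num : (0:ℝ) < 3)]
          _ ≤ (M x * ‖v‖ ^ 1) ^ 3 + 3 * ((M x * ‖v‖ ^ 1) * (M x * ‖v‖ ^ 2)) + M x * ‖v‖ ^ 3 := by
              gcongr
          _ = (M x ^ 3 + 3 * M x ^ 2 + M x) * ‖v‖ ^ 3 := by ring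
          _ ≤ _ := by
              gcongr
              nlinarith [pow_nonneg hM 3, pow_nonneg hM 2]
      calc _ ≤ F x * (5 * (1 + M x) ^ 3 * ‖v‖ ^ 3) := mul_le_mul hle hin (abs_nonneg _) hF
        _ = _ := by ring
    have := abs_taylor_two_le e0 e1 e2 hb
    rw [hφf 1 (by simp), hφf 0 (by simp)] at this
    simpa using this
  · simp only [h0 _ (hd.subset ha), h0 _ (hd.subset hv)]
    have := pow_nonneg (add_nonneg zero_le_one hM) 3
    simp only [sub_self, zero_mul, zero_div, abs_zero]
    positivity

end

/-! ### The Fisher form and the Bartlett identities -/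

section

variable {f : 𝒳 → Param p → ℝ} {Θ : Set (Param p)} {θ₁ : Param p} {δ : ℝ} {F M : 𝒳 → ℝ}

theorem DomBall.center_mem (hd : DomBall f Θ θ₁ δ F M) : θ₁ ∈ Metric.ball θ₁ δ :=
  Metric.mem_ball_self hd.pos

theorem DomBall.env_nonneg (hd : DomBall f Θ θ₁ δ F M) (x : 𝒳) : 0 ≤ F x * (1 + M x) ^ 3 :=
  mul_nonneg (hd.F_nonneg x) (pow_nonneg (add_nonneg zero_le_one (hd.M_nonneg x)) 3)

theorem DomBall.summable_of_abs_le (hd : DomBall f Θ θ₁ δ F M) {g : 𝒳 → ℝ} (c : ℝ)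
    (hg : ∀ x, |g x| ≤ c * (F x * (1 + M x) ^ 3)) : Summable g :=
  Summable.of_norm_bounded (hd.summable.mul_left c) hg

/-- The total mass of the dominating envelope `F (1 + M)³`. -/
def envMass (F M : 𝒳 → ℝ) : ℝ := ∑' x, F x * (1 + M x) ^ 3

theorem DomBall.envMass_nonneg (hd : DomBall f Θ θ₁ δ F M) : 0 ≤ envMass F M :=
  tsum_nonneg hd.env_nonneg

theorem DomBall.abs_tsum_le (hd : DomBall f Θ θ₁ δ F M) {g : 𝒳 → ℝ} {c : ℝ}
    (hg : ∀ x, |g x| ≤ c * (F x * (1 + M x) ^ 3)) : |∑' x, g x| ≤ c * envMass F M := by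
  have := tsum_of_norm_bounded (f := g) (hd.summable.hasSum.mul_left c) hg
  simpa [envMass] using this

theorem DomBall.mul_pow_le (hd : DomBall f Θ θ₁ δ F M) (x : 𝒳) {k : ℕ} (hk : k ≤ 3) :
    F x * M x ^ k ≤ F x * (1 + M x) ^ 3 := by
  have hM := hd.M_nonneg x
  refine mul_le_mul_of_nonneg_left ?_ (hd.F_nonneg x)
  calc M x ^ k ≤ (1 + M x) ^ k := by gcongr; linarith
    _ ≤ (1 + M x) ^ 3 := pow_le_pow_right₀ (by linarith) hk

theorem DomBall.f_nonneg (hf : IsModel f Θ) (hd : DomBall f Θ θ₁ δ F M) (x : 𝒳) {θ : Param p}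
    (hθ : θ ∈ Metric.ball θ₁ δ) : 0 ≤ f x θ := hf.nonneg x θ (hd.subset hθ)

theorem DomBall.abs_score_le (hd : DomBall f Θ θ₁ δ F M) {x : 𝒳} {θ : Param p}
    (hθ : θ ∈ Metric.ball θ₁ δ) (a : Fin p) : |score f x θ a| ≤ M x := by
  have h := score_inner (f := f) x θ (EuclideanSpace.single a (1 : ℝ))
  simp only [PiLp.single_apply, mul_ite, mul_one, mul_zero, Finset.sum_ite_eq',
    Finset.mem_univ, if_true] at h
  rw [h]
  simpa using hd.abs_dlog_le (x := x) hθ (k := 1) (by norm_num) (by norm_num)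
    (EuclideanSpace.single a (1 : ℝ))

theorem DomBall.hasSum_fisherForm (hf : IsModel f Θ) (hd : DomBall f Θ θ₁ δ F M) {θ : Param p}
    (hθ : θ ∈ Metric.ball θ₁ δ) (v : Param p) :
    HasSum (fun x => f x θ * dlog f 1 x θ v ^ 2) (fisherForm f θ v) := by
  have hs : ∀ a b, Summable fun x => f x θ * (score f x θ a * score f x θ b) := fun a b => by
    refine hd.summable_of_abs_le 1 fun x => ?_
    rw [abs_mul, abs_mul, abs_of_nonneg (hd.f_nonneg hf x hθ), one_mul]
    refine le_trans ?_ (hd.mul_pow_le x (k := 2) (by norm_num))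
    rw [sq]
    have := hd.M_nonneg x
    have := hd.F_nonneg x
    gcongr
    exacts [hd.le x θ hθ, hd.abs_score_le hθ a, hd.abs_score_le hθ b]
  have := hasSum_sum (s := Finset.univ) fun a _ => hasSum_sum (s := Finset.univ) fun b _ =>
    (((hs a b).hasSum.mul_left (v a)).mul_right (v b))
  refine HasSum.congr_fun (a := fisherForm f θ v) this fun x => ?_
  rw [← score_inner, sq, Finset.sum_mul_sum, Finset.mul_sum]
  refine Finset.sum_congr rfl fun a _ => ?_
  rw [Finset.mul_sum]
  exact Finset.sum_congr rfl fun b _ => by ring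

theorem DomBall.abs_f_sub_le (hf : IsModel f Θ) (hd : DomBall f Θ θ₁ δ F M) {x : 𝒳}
    {θ t : Param p} (hθ : θ ∈ Metric.ball θ₁ δ) (ht : t ∈ Metric.ball θ₁ δ) :
    |f x θ - f x t| ≤ F x * M x * ‖θ - t‖ := by
  have hF := hd.F_nonneg x
  have hM := hd.M_nonneg x
  -- `e^a - e^b ≤ e^a (a - b)`
  have key : ∀ {θ t : Param p}, θ ∈ Metric.ball θ₁ δ → t ∈ Metric.ball θ₁ δ →
      f x θ - f x t ≤ F x * M x * ‖θ - t‖ := fun {θ t} hθ ht => by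
    rcases hf.pos_or_eq_zero x with hpos | h0
    · have p1 := hpos _ (hd.subset hθ)
      have p2 := hpos _ (hd.subset ht)
      have h1 := Real.add_one_le_exp (Real.log (f x t) - Real.log (f x θ))
      rw [Real.exp_sub, Real.exp_log p1, Real.exp_log p2, le_div_iff₀ p1] at h1
      have h2 := (le_abs_self _).trans (hd.abs_log_sub_le (x := x) hθ ht)
      calc f x θ - f x t ≤ f x θ * (Real.log (f x θ) - Real.log (f x t)) := by nlinarith
        _ ≤ f x θ * (M x * ‖θ - t‖) := by gcongr
        _ ≤ F x * (M x * ‖θ - t‖) := by gcongr; exact hd.le x θ hθ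
        _ = _ := by ring
    · rw [h0 _ (hd.subset hθ), h0 _ (hd.subset ht)]
      simp only [sub_self]
      positivity
  rw [abs_le]
  constructor
  · have := key ht hθ
    rw [norm_sub_rev] at this
    linarith
  · exact key hθ ht

theorem DomBall.abs_sqrt_sub_le (hf : IsModel f Θ) (hd : DomBall f Θ θ₁ δ F M) {x : 𝒳}
    {θ t : Param p} (hθ : θ ∈ Metric.ball θ₁ δ) (ht : t ∈ Metric.ball θ₁ δ) :
    |√(f x θ) - √(f x t)| ≤ √(F x) * M x * ‖θ - t‖ := by
  have hM := hd.M_nonneg x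
  have key : ∀ {θ t : Param p}, θ ∈ Metric.ball θ₁ δ → t ∈ Metric.ball θ₁ δ →
      √(f x θ) - √(f x t) ≤ √(F x) * M x * ‖θ - t‖ := fun {θ t} hθ ht => by
    rcases hf.pos_or_eq_zero x with hpos | h0
    · have p1 := hpos _ (hd.subset hθ)
      have p2 := hpos _ (hd.subset ht)
      have h1 := Real.add_one_le_exp (Real.log (√(f x t)) - Real.log (√(f x θ)))
      rw [Real.exp_sub, Real.exp_log (Real.sqrt_pos.2 p1), Real.exp_log (Real.sqrt_pos.2 p2),
        le_div_iff₀ (Real.sqrt_pos.2 p1), Real.log_sqrt p1.le, Real.log_sqrt p2.le] at h1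
      have h2 := (le_abs_self _).trans (hd.abs_log_sub_le (x := x) hθ ht)
      have h3 : 0 ≤ M x * ‖θ - t‖ := by positivity
      have h4 := Real.sqrt_nonneg (f x θ)
      calc √(f x θ) - √(f x t)
          ≤ √(f x θ) * ((Real.log (f x θ) - Real.log (f x t)) / 2) := by nlinarith
        _ ≤ √(f x θ) * (M x * ‖θ - t‖) := by gcongr; linarith
        _ ≤ √(F x) * (M x * ‖θ - t‖) := by gcongr; exact hd.le x θ hθ
        _ = _ := by ring
    · rw [h0 _ (hd.subset hθ), h0 _ (hd.subset ht)]
      simp only [sub_self]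
      positivity
  rw [abs_le]
  constructor
  · have := key ht hθ
    rw [norm_sub_rev] at this
    linarith
  · exact key hθ ht

/-- The Fisher form is Lipschitz in the parameter. -/
theorem DomBall.abs_fisherForm_sub_le (hf : IsModel f Θ) (hd : DomBall f Θ θ₁ δ F M)
    {θ t : Param p} (hθ : θ ∈ Metric.ball θ₁ δ) (ht : t ∈ Metric.ball θ₁ δ) (v : Param p) :
    |fisherForm f θ v - fisherForm f t v| ≤ 3 * envMass F M * ‖θ - t‖ * ‖v‖ ^ 2 := by
  have h := (hd.hasSum_fisherForm hf hθ v).sub (hd.hasSum_fisherForm hf ht v)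
  rw [← h.tsum_eq]
  refine (hd.abs_tsum_le (c := 3 * ‖θ - t‖ * ‖v‖ ^ 2) fun x => ?_).trans (le_of_eq (by ring))
  have hF := hd.F_nonneg x
  have hM := hd.M_nonneg x
  have b1 := hd.abs_dlog_le (x := x) hθ (k := 1) (by norm_num) (by norm_num) v
  have b2 := hd.abs_dlog_le (x := x) ht (k := 1) (by norm_num) (by norm_num) v
  have b3 := hd.abs_dlog_sub_le (x := x) hθ ht (k := 1) (by norm_num) v
  have b4 := hd.abs_f_sub_le (x := x) hf hθ ht
  have b5 : |f x t| ≤ F x := by rw [abs_of_nonneg (hd.f_nonneg hf x ht)]; exact hd.le x t ht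
  have e : f x θ * dlog f 1 x θ v ^ 2 - f x t * dlog f 1 x t v ^ 2 =
      (f x θ - f x t) * dlog f 1 x θ v ^ 2 + f x t * ((dlog f 1 x θ v - dlog f 1 x t v) *
        (dlog f 1 x θ v + dlog f 1 x t v)) := by ring
  rw [e]
  calc _ ≤ |f x θ - f x t| * |dlog f 1 x θ v| ^ 2 + |f x t| * (|dlog f 1 x θ v - dlog f 1 x t v| *
        (|dlog f 1 x θ v| + |dlog f 1 x t v|)) := by
        refine (abs_add_le _ _).trans ?_
        rw [abs_mul, abs_mul, abs_mul, abs_pow]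
        gcongr
        exact abs_add_le _ _
    _ ≤ F x * M x * ‖θ - t‖ * (M x * ‖v‖ ^ 1) ^ 2 + F x * ((M x * ‖θ - t‖ * ‖v‖ ^ 1) *
        (M x * ‖v‖ ^ 1 + M x * ‖v‖ ^ 1)) := by gcongr
    _ = (F x * M x ^ 3 + 2 * (F x * M x ^ 2)) * (‖θ - t‖ * ‖v‖ ^ 2) := by ring
    _ ≤ (F x * (1 + M x) ^ 3 + 2 * (F x * (1 + M x) ^ 3)) * (‖θ - t‖ * ‖v‖ ^ 2) := by
        have h3 := hd.mul_pow_le x (k := 3) (by norm_num)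
        have h2 := hd.mul_pow_le x (k := 2) (by norm_num)
        exact mul_le_mul_of_nonneg_right (by linarith) (by positivity)
    _ = _ := by ring

theorem FisherRegular.form_bounds (h : FisherRegular f Θ) {K : Set (Param p)} (hK : K ⊆ Θ)
    (hKc : IsCompact K) : ∃ c₁ c₂ : ℝ, 0 < c₁ ∧ c₁ ≤ c₂ ∧ ∀ θ ∈ K, ∀ v,
      c₁ * ‖v‖ ^ 2 ≤ fisherForm f θ v ∧ fisherForm f θ v ≤ c₂ * ‖v‖ ^ 2 := by
  obtain ⟨c₁, c₂, h0, h12, hb⟩ := h.bounds K hK hKc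
  have e1 : ∀ (A : Matrix (Fin p) (Fin p) ℝ) (v : Param p),
      (star (v : Fin p → ℝ)) ⬝ᵥ (A.mulVec v) = ∑ a, ∑ b, v a * A a b * v b := fun A v => by
    simp only [dotProduct, Matrix.mulVec, Pi.star_apply, star_trivial, Finset.mul_sum, mul_assoc]
  have e2 : ∀ v : Param p, ∑ a, ∑ b, v a * (1 : Matrix (Fin p) (Fin p) ℝ) a b * v b = ‖v‖ ^ 2 :=
    fun v => by
      rw [EuclideanSpace.real_norm_sq_eq]
      simp [Matrix.one_apply, sq]
  refine ⟨c₁, c₂, h0, h12, fun θ hθ v => ⟨?_, ?_⟩⟩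
  · have := (hb θ hθ).1.dotProduct_mulVec_nonneg v
    rw [e1] at this
    have e : ∑ a, ∑ b, v a * (fisherInfo f θ - c₁ • (1 : Matrix (Fin p) (Fin p) ℝ)) a b * v b
        = fisherForm f θ v - c₁ * ‖v‖ ^ 2 := by
      rw [← e2, fisherForm, Finset.mul_sum, ← Finset.sum_sub_distrib]
      refine Finset.sum_congr rfl fun a _ => ?_
      rw [Finset.mul_sum, ← Finset.sum_sub_distrib]
      refine Finset.sum_congr rfl fun b _ => ?_
      simp only [Matrix.sub_apply, Matrix.smul_apply, smul_eq_mul]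
      ring
    linarith
  · have := (hb θ hθ).2.dotProduct_mulVec_nonneg v
    rw [e1] at this
    have e : ∑ a, ∑ b, v a * (c₂ • (1 : Matrix (Fin p) (Fin p) ℝ) - fisherInfo f θ) a b * v b
        = c₂ * ‖v‖ ^ 2 - fisherForm f θ v := by
      rw [← e2, fisherForm, Finset.mul_sum, ← Finset.sum_sub_distrib]
      refine Finset.sum_congr rfl fun a _ => ?_
      rw [Finset.mul_sum, ← Finset.sum_sub_distrib]
      refine Finset.sum_congr rfl fun b _ => ?_
      simp only [Matrix.sub_apply, Matrix.smul_apply, smul_eq_mul]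
      ring
    linarith

/-- The coefficients of a quadratic polynomial without constant term that is `O(s ^ 3)` on the positive
side of `0` vanish. Applied to the expansion of `∑ x, f x (θ + s v) = 1` this gives the Bartlett
identities. -/
theorem eq_zero_of_abs_le_cube {A B C r : ℝ} (hr : 0 < r)
    (h : ∀ s, 0 < s → s < r → |s * A + s ^ 2 * B| ≤ C * s ^ 3) : A = 0 ∧ B = 0 := by
  have t1 : Tendsto (fun s : ℝ => C * s ^ 2 - s * B) (𝓝[>] 0) (𝓝 0) := by
    have : Tendsto (fun s : ℝ => C * s ^ 2 - s * B) (𝓝 0) (𝓝 (C * 0 ^ 2 - 0 * B)) :=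
      (by fun_prop : Continuous fun s : ℝ => C * s ^ 2 - s * B).tendsto 0
    simpa using this.mono_left nhdsWithin_le_nhds
  have t2 : Tendsto (fun s : ℝ => C * s ^ 2 + s * B) (𝓝[>] 0) (𝓝 0) := by
    have : Tendsto (fun s : ℝ => C * s ^ 2 + s * B) (𝓝 0) (𝓝 (C * 0 ^ 2 + 0 * B)) :=
      (by fun_prop : Continuous fun s : ℝ => C * s ^ 2 + s * B).tendsto 0
    simpa using this.mono_left nhdsWithin_le_nhds
  have t3 : Tendsto (fun s : ℝ => C * s) (𝓝[>] 0) (𝓝 0) := by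
    have : Tendsto (fun s : ℝ => C * s) (𝓝 0) (𝓝 (C * 0)) :=
      (by fun_prop : Continuous fun s : ℝ => C * s).tendsto 0
    simpa using this.mono_left nhdsWithin_le_nhds
  have hev : ∀ᶠ s in 𝓝[>] (0 : ℝ), 0 < s ∧ s < r := Ioo_mem_nhdsGT hr
  have hA : A = 0 := by
    apply le_antisymm
    · refine ge_of_tendsto t1 (hev.mono fun s hs => ?_)
      have := (abs_le.1 (h s hs.1 hs.2)).2
      have h' : s * A ≤ s * (C * s ^ 2 - s * B) := by nlinarith
      exact le_of_mul_le_mul_left h' hs.1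
    · rw [← neg_nonpos]
      refine ge_of_tendsto t2 (hev.mono fun s hs => ?_)
      have := (abs_le.1 (h s hs.1 hs.2)).1
      have h' : s * (-A) ≤ s * (C * s ^ 2 + s * B) := by nlinarith
      exact le_of_mul_le_mul_left h' hs.1
  refine ⟨hA, ?_⟩
  subst hA
  apply le_antisymm
  · refine ge_of_tendsto t3 (hev.mono fun s hs => ?_)
    have := (abs_le.1 (h s hs.1 hs.2)).2
    have h' : s ^ 2 * B ≤ s ^ 2 * (C * s) := by nlinarith
    exact le_of_mul_le_mul_left h' (pow_pos hs.1 2)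
  · rw [← neg_nonpos]
    refine ge_of_tendsto t3 (hev.mono fun s hs => ?_)
    have := (abs_le.1 (h s hs.1 hs.2)).1
    have h' : s ^ 2 * (-B) ≤ s ^ 2 * (C * s) := by nlinarith
    exact le_of_mul_le_mul_left h' (pow_pos hs.1 2)

theorem DomBall.summable_f_mul (hf : IsModel f Θ) (hd : DomBall f Θ θ₁ δ F M) {g : 𝒳 → ℝ}
    {θ : Param p} (hθ : θ ∈ Metric.ball θ₁ δ) (c : ℝ) {k : ℕ} (hk : k ≤ 3)
    (hg : ∀ x, |g x| ≤ c * M x ^ k) : Summable fun x => f x θ * g x := by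
  rcases isEmpty_or_nonempty 𝒳 with h | ⟨⟨x₀⟩⟩
  · exact summable_empty
  refine hd.summable_of_abs_le |c| fun x => ?_
  rw [abs_mul, abs_of_nonneg (hd.f_nonneg hf x hθ)]
  have := hd.M_nonneg x
  have := hd.F_nonneg x
  calc f x θ * |g x| ≤ F x * (|c| * M x ^ k) := by
        gcongr
        · exact hd.le x θ hθ
        · exact (hg x).trans (by gcongr; exact le_abs_self c)
    _ = |c| * (F x * M x ^ k) := by ring
    _ ≤ _ := mul_le_mul_of_nonneg_left (hd.mul_pow_le x hk) (abs_nonneg c)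

/-- The score has mean zero, and the expected second derivative of the log-density is minus the
Fisher information: both follow by comparing the coefficients in the third-order expansion of
`∑ₓ f x (θ₁ + s v) = 1`. -/
theorem DomBall.bartlett (hf : IsModel f Θ) (hd : DomBall f Θ θ₁ δ F M) (v : Param p) :
    HasSum (fun x => f x θ₁ * dlog f 1 x θ₁ v) 0 ∧
    HasSum (fun x => f x θ₁ * dlog f 2 x θ₁ v) (-fisherForm f θ₁ v) := by
  have hc := hd.center_mem
  have hJ := hd.hasSum_fisherForm hf hc v
  have s1 : Summable fun x => f x θ₁ * dlog f 1 x θ₁ v :=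
    hd.summable_f_mul hf hc (‖v‖ ^ 1) (k := 1) (by norm_num) fun x => by
      have := hd.abs_dlog_le (x := x) hc (k := 1) (by norm_num) (by norm_num) v
      rw [pow_one (M x)]; linarith
  have s2 : Summable fun x => f x θ₁ * dlog f 2 x θ₁ v :=
    hd.summable_f_mul hf hc (‖v‖ ^ 2) (k := 1) (by norm_num) fun x => by
      have := hd.abs_dlog_le (x := x) hc (k := 2) (by norm_num) (by norm_num) v
      rw [pow_one (M x)]; linarith
  obtain ⟨h1, h2⟩ := s1.hasSum, s2.hasSum
  set A := ∑' x, f x θ₁ * dlog f 1 x θ₁ v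
  set B := ∑' x, f x θ₁ * dlog f 2 x θ₁ v
  have key := eq_zero_of_abs_le_cube (A := A) (B := (fisherForm f θ₁ v + B) / 2)
    (C := 5 * ‖v‖ ^ 3 * envMass F M) (r := δ / (1 + ‖v‖)) (div_pos hd.pos (by positivity))
    fun s hs hsr => ?_
  · have hB : B = -fisherForm f θ₁ v := by linarith [key.2]
    exact ⟨key.1 ▸ h1, hB ▸ h2⟩
  · have hmem : θ₁ + s • v ∈ Metric.ball θ₁ δ := by
      rw [mem_ball_iff_norm, add_sub_cancel_left, norm_smul, Real.norm_eq_abs, abs_of_pos hs]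
      rw [lt_div_iff₀ (by positivity)] at hsr
      nlinarith [norm_nonneg v]
    have hsum := (((hf.hasSum_one _ (hd.subset hmem)).sub (hf.hasSum_one _ (hd.subset hc))).sub
      (h1.mul_left s)).sub ((hJ.add h2).mul_left (s ^ 2 / 2))
    have hle := hd.abs_tsum_le (c := 5 * (s * ‖v‖) ^ 3)
      (g := fun x => f x (θ₁ + s • v) - f x θ₁ - s * (f x θ₁ * dlog f 1 x θ₁ v) -
        s ^ 2 / 2 * (f x θ₁ * dlog f 1 x θ₁ v ^ 2 + f x θ₁ * dlog f 2 x θ₁ v)) fun x => by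
      have := hd.abs_taylor_le (x := x) hf hc hmem
      rw [dlog_smul, dlog_smul, norm_smul, Real.norm_eq_abs, abs_of_pos hs] at this
      convert this using 1
      · congr 1; ring
      · ring
    rw [hsum.tsum_eq] at hle
    calc _ = |1 - 1 - s * A - s ^ 2 / 2 * (fisherForm f θ₁ v + B)| := by
          rw [← abs_neg]; congr 1; ring
      _ ≤ _ := hle
      _ = _ := by ring

end

/-! ### Local comparison of the Fisher–Rao distance with the Fisher form -/

section

variable {f : 𝒳 → Param p → ℝ} {Θ : Set (Param p)} {θ₁ : Param p} {δ : ℝ} {F M : 𝒳 → ℝ}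

/-- The symmetric bilinear form of `J₁(θ)`, as a continuous linear functional of its second
argument. -/
def fisherBilin (f : 𝒳 → Param p → ℝ) (θ v : Param p) : Param p →L[ℝ] ℝ :=
  ∑ b, (∑ a, v a * fisherInfo f θ a b) • (EuclideanSpace.proj b : Param p →L[ℝ] ℝ)

theorem fisherBilin_apply (θ v u : Param p) :
    fisherBilin f θ v u = ∑ a, ∑ b, v a * fisherInfo f θ a b * u b := by
  have : fisherBilin f θ v u = ∑ b, (∑ a, v a * fisherInfo f θ a b) * u b := by
    simp [fisherBilin]
  rw [this, Finset.sum_comm]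
  simp only [Finset.sum_mul]

theorem fisherBilin_self (θ v : Param p) : fisherBilin f θ v v = fisherForm f θ v :=
  fisherBilin_apply θ v v

theorem fisherForm_add_smul (θ v u : Param p) (s : ℝ) :
    fisherForm f θ (v + s • u) =
      fisherForm f θ u * (s * s) + 2 * fisherBilin f θ v u * s + fisherForm f θ v := by
  have hsymm : fisherBilin f θ v u = ∑ a, ∑ b, u a * fisherInfo f θ a b * v b := by
    rw [fisherBilin_apply, Finset.sum_comm]
    refine Finset.sum_congr rfl fun a _ => Finset.sum_congr rfl fun b _ => ?_
    have : fisherInfo f θ b a = fisherInfo f θ a b := by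
      simp only [fisherInfo, mul_comm (score f _ θ b)]
    rw [this]; ring
  have h2 : 2 * fisherBilin f θ v u * s =
      fisherBilin f θ v u * s + (∑ a, ∑ b, u a * fisherInfo f θ a b * v b) * s := by
    rw [← hsymm]; ring
  rw [h2, fisherBilin_apply]
  simp only [fisherForm, Finset.sum_mul, ← Finset.sum_add_distrib]
  refine Finset.sum_congr rfl fun a _ => Finset.sum_congr rfl fun b _ => ?_
  simp only [PiLp.add_apply, PiLp.smul_apply, smul_eq_mul]
  ring

theorem fisherBilin_sq_le {θ : Param p} (h0 : ∀ u, 0 ≤ fisherForm f θ u) (v u : Param p) :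
    fisherBilin f θ v u ^ 2 ≤ fisherForm f θ v * fisherForm f θ u := by
  have := discrim_le_zero (a := fisherForm f θ u) (b := 2 * fisherBilin f θ v u)
    (c := fisherForm f θ v) fun s => by
      rw [← fisherForm_add_smul]; exact h0 _
  rw [discrim] at this
  nlinarith

/-- Calibration: a linear functional that is dominated by `κ` times the Riemannian norm along a
path increases along the path by at most `κ` times its length. -/
theorem ofReal_le_fisherLength {γ : ℝ → Param p} (hγ : ContDiffOn ℝ 1 γ (Icc 0 1)) {τ κ : ℝ}
    (hτ : τ ∈ Icc (0 : ℝ) 1) (l : Param p →L[ℝ] ℝ)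
    (hl : ∀ s ∈ Ioo (0 : ℝ) τ, ∀ u, l u ≤ κ * √(fisherForm f (γ s) u)) :
    ENNReal.ofReal (l (γ τ - γ 0)) ≤ ENNReal.ofReal κ * fisherLength f γ := by
  set g' : ℝ → ℝ := fun s => l (derivWithin γ (Icc 0 1) s) with hg'
  have hsub : Icc (0 : ℝ) τ ⊆ Icc 0 1 := Icc_subset_Icc_right hτ.2
  have hcont : ContinuousOn g' (Icc 0 τ) := l.continuous.comp_continuousOn
    ((hγ.continuousOn_derivWithin (uniqueDiffOn_Icc zero_lt_one) le_rfl).mono hsub)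
  have hint : IntegrableOn g' (Icc 0 τ) := hcont.integrableOn_Icc
  have hftc : ∫ s in (0 : ℝ)..τ, g' s = l (γ τ) - l (γ 0) := by
    refine intervalIntegral.integral_eq_sub_of_hasDerivAt_of_le hτ.1
      (f := fun s => l (γ s)) (l.continuous.comp_continuousOn (hγ.continuousOn.mono hsub))
      (fun s hs => ?_) ?_
    · have hmem : Icc (0 : ℝ) 1 ∈ 𝓝 s := Icc_mem_nhds hs.1 (hs.2.trans_le hτ.2)
      have hd : DifferentiableWithinAt ℝ γ (Icc 0 1) s :=
        (hγ.differentiableOn one_ne_zero) s (mem_of_mem_nhds hmem)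
      have := hd.hasDerivWithinAt.hasDerivAt hmem
      exact l.hasFDerivAt.comp_hasDerivAt s this
    · rw [intervalIntegrable_iff_integrableOn_Icc_of_le hτ.1]
      exact hint
  rw [map_sub, ← hftc, intervalIntegral.integral_of_le hτ.1, integral_Ioc_eq_integral_Ioo]
  have hint' : IntegrableOn g' (Ioo 0 τ) := hint.mono_set Ioo_subset_Icc_self
  calc ENNReal.ofReal (∫ s in Ioo 0 τ, g' s)
      ≤ ENNReal.ofReal (∫ s in Ioo 0 τ, max (g' s) 0) := by
        refine ENNReal.ofReal_le_ofReal (integral_mono hint' hint'.pos_part fun s => le_max_left _ _)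
    _ = ∫⁻ s in Ioo 0 τ, ENNReal.ofReal (max (g' s) 0) :=
        ofReal_integral_eq_lintegral_ofReal hint'.pos_part
          (Eventually.of_forall fun s => le_max_right _ _)
    _ ≤ ∫⁻ s in Ioo 0 τ, ENNReal.ofReal κ *
          ENNReal.ofReal (√(fisherForm f (γ s) (derivWithin γ (Icc 0 1) s))) := by
        refine setLIntegral_mono' measurableSet_Ioo fun s hs => ?_
        rw [← ENNReal.ofReal_mul' (Real.sqrt_nonneg _)]
        rcases le_total (g' s) 0 with h | h
        · simp [max_eq_right h]
        · rw [max_eq_left h]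
          exact ENNReal.ofReal_le_ofReal (hl s hs _)
    _ = ENNReal.ofReal κ * ∫⁻ s in Ioo 0 τ,
          ENNReal.ofReal (√(fisherForm f (γ s) (derivWithin γ (Icc 0 1) s))) :=
        lintegral_const_mul' _ _ ENNReal.ofReal_ne_top
    _ ≤ _ := by
        unfold fisherLength
        gcongr
        exact Ioo_subset_Icc_self.trans hsub

theorem fisherRao_le_length {γ : ℝ → Param p} {a b : Param p} (hc : ContDiffOn ℝ 1 γ (Icc 0 1))
    (hm : MapsTo γ (Icc 0 1) Θ) (h0 : γ 0 = a) (h1 : γ 1 = b) :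
    fisherRao f Θ a b ≤ fisherLength f γ :=
  iInf_le_of_le γ <| iInf_le_of_le hc <| iInf_le_of_le hm <| iInf_le_of_le h0 <|
    iInf_le_of_le h1 le_rfl

theorem exists_path_of_fisherRao_lt {a b : Param p} {d : ℝ≥0∞} (h : fisherRao f Θ a b < d) :
    ∃ γ : ℝ → Param p, ContDiffOn ℝ 1 γ (Icc 0 1) ∧ γ 0 = a ∧ γ 1 = b ∧
      fisherLength f γ < d := by
  simp only [fisherRao, iInf_lt_iff] at h
  obtain ⟨γ, hc, -, h0, h1, hl⟩ := h
  exact ⟨γ, hc, h0, h1, hl⟩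

theorem fisherRao_le_segment {t v : Param p} (hseg : ∀ s ∈ Icc (0 : ℝ) 1, t + s • v ∈ Θ)
    {A : ℝ} (hA : ∀ s ∈ Icc (0 : ℝ) 1, fisherForm f (t + s • v) v ≤ A) :
    fisherRao f Θ t (t + v) ≤ ENNReal.ofReal (√A) := by
  set γ : ℝ → Param p := fun s => t + s • v with hγ
  have hc : ContDiffOn ℝ 1 γ (Icc 0 1) := by
    apply ContDiff.contDiffOn
    fun_prop
  have hle : fisherRao f Θ t (t + v) ≤ fisherLength f γ :=
    fisherRao_le_length hc hseg (by simp [hγ]) (by simp [hγ])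
  refine hle.trans ?_
  have hderiv : ∀ s ∈ Icc (0 : ℝ) 1, derivWithin γ (Icc 0 1) s = v := fun s hs => by
    have : HasDerivAt γ v s :=
      (((hasDerivAt_id s).smul_const v).const_add t).congr_deriv (one_smul ℝ v)
    exact this.hasDerivWithinAt.derivWithin (uniqueDiffOn_Icc zero_lt_one s hs)
  calc fisherLength f γ ≤ ∫⁻ s in Icc (0 : ℝ) 1, ENNReal.ofReal (√A) := by
        refine setLIntegral_mono' measurableSet_Icc fun s hs => ?_
        rw [hderiv s hs]
        exact ENNReal.ofReal_le_ofReal (Real.sqrt_le_sqrt (hA s hs))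
    _ = ENNReal.ofReal (√A) := by simp

/-- A path of small length stays close to its starting point. -/
theorem norm_sub_le_of_fisherLength_lt {γ : ℝ → Param p} (hγ : ContDiffOn ℝ 1 γ (Icc 0 1))
    {c r d : ℝ} (hc : 0 < c)
    (hform : ∀ θ ∈ Metric.ball (γ 0) r, ∀ u, c ^ 2 * ‖u‖ ^ 2 ≤ fisherForm f θ u)
    (hlen : fisherLength f γ ≤ ENNReal.ofReal d) (hd0 : 0 ≤ d) (hd : d < c * r) :
    ∀ τ ∈ Icc (0 : ℝ) 1, ‖γ τ - γ 0‖ ≤ d / c := by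
  -- the bound holds as long as the path has not left the ball
  have euclid : ∀ τ ∈ Icc (0 : ℝ) 1, (∀ s ∈ Ioo 0 τ, γ s ∈ Metric.ball (γ 0) r) →
      ‖γ τ - γ 0‖ ≤ d / c := fun τ hτ hin => by
    set v := γ τ - γ 0 with hv
    have h1 := ofReal_le_fisherLength (f := f) hγ hτ (κ := ‖v‖ / c) (innerSL ℝ v) fun s hs u => by
      have h2 : c * ‖u‖ ≤ √(fisherForm f (γ s) u) := by
        apply Real.le_sqrt_of_sq_le
        rw [mul_pow]
        exact hform _ (hin s hs) u
      calc innerSL ℝ v u ≤ ‖v‖ * ‖u‖ := real_inner_le_norm v u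
        _ = ‖v‖ / c * (c * ‖u‖) := by field_simp
        _ ≤ _ := by gcongr
    have h2 := h1.trans (mul_le_mul_right hlen _)
    rw [← ENNReal.ofReal_mul (by positivity), ENNReal.ofReal_le_ofReal_iff (by positivity), ← hv,
      innerSL_apply_apply, real_inner_self_eq_norm_sq] at h2
    rcases (norm_nonneg v).eq_or_lt with h0 | h0
    · rw [← h0]; positivity
    · rw [le_div_iff₀ hc]
      have : ‖v‖ * (‖v‖ * c) ≤ ‖v‖ * d := by
        have : ‖v‖ ^ 2 * c ≤ ‖v‖ / c * d * c := by gcongr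
        rw [show ‖v‖ / c * d * c = ‖v‖ * d by field_simp] at this
        linarith
      exact le_of_mul_le_mul_left this h0
  -- up to the first exit time the path is too short to reach the boundary of the ball
  have hstay : ∀ τ ∈ Icc (0 : ℝ) 1, γ τ ∈ Metric.ball (γ 0) r := by
    by_contra! hex
    set S : Set ℝ := {s ∈ Icc (0 : ℝ) 1 | r ≤ ‖γ s - γ 0‖} with hS
    have hSc : IsCompact S := by
      have : S = Icc (0 : ℝ) 1 ∩ (fun s => ‖γ s - γ 0‖) ⁻¹' Ici r := rfl
      rw [this]
      exact isCompact_Icc.of_isClosed_subset ((hγ.continuousOn.sub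
        continuousOn_const).norm.preimage_isClosed_of_isClosed isClosed_Icc isClosed_Ici)
        inter_subset_left
    obtain ⟨τ, hτ, hτr⟩ := hex
    have hne : S.Nonempty := ⟨τ, hτ, by simpa [Metric.mem_ball, dist_eq_norm] using hτr⟩
    obtain ⟨σ, hσ, hmin⟩ := hSc.exists_isLeast hne
    have h1 := euclid σ hσ.1 fun s hs => by
      by_contra hns
      have : s ∈ S := ⟨⟨hs.1.le, hs.2.le.trans hσ.1.2⟩, by simpa [Metric.mem_ball, dist_eq_norm] using hns⟩
      exact absurd (hmin this) (not_le.2 hs.2)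
    have h2 : d / c < r := by rw [div_lt_iff₀ hc]; linarith
    linarith [hσ.2]
  exact fun τ hτ => euclid τ hτ fun s hs => hstay s ⟨hs.1.le, hs.2.le.trans hτ.2⟩

/-- Lower bound for the length of a path by the Fisher form at its starting point. -/
theorem fisherForm_le_of_fisherLength {γ : ℝ → Param p} (hγ : ContDiffOn ℝ 1 γ (Icc 0 1))
    {d η : ℝ} (hd0 : 0 ≤ d) (h0 : ∀ u, 0 ≤ fisherForm f (γ 0) u)
    (hform : ∀ s ∈ Icc (0 : ℝ) 1, ∀ u,
      (1 - η) * fisherForm f (γ 0) u ≤ fisherForm f (γ s) u)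
    (hlen : fisherLength f γ ≤ ENNReal.ofReal d) :
    (1 - η) * fisherForm f (γ 0) (γ 1 - γ 0) ≤ d ^ 2 := by
  set v := γ 1 - γ 0 with hv
  set A := fisherForm f (γ 0) v with hA
  have hA0 : 0 ≤ A := h0 v
  rcases le_or_gt (1 - η) 0 with hη' | hη'
  · nlinarith [mul_nonneg (neg_nonneg.2 hη') hA0]
  have h1 := ofReal_le_fisherLength (f := f) hγ (τ := 1) (by simp) (κ := √A / √(1 - η))
    (fisherBilin f (γ 0) v) fun s hs u => by
      have h2 := Real.le_sqrt_of_sq_le (fisherBilin_sq_le h0 v u)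
      rw [Real.sqrt_mul hA0] at h2
      refine h2.trans ?_
      rw [div_mul_eq_mul_div, le_div_iff₀ (Real.sqrt_pos.2 hη'), mul_assoc,
        ← Real.sqrt_mul (h0 u)]
      gcongr
      rw [mul_comm]
      exact hform s (Ioo_subset_Icc_self hs) u
  have h2 := h1.trans (mul_le_mul_right hlen _)
  rw [← ENNReal.ofReal_mul (by positivity), ENNReal.ofReal_le_ofReal_iff (by positivity), ← hv,
    fisherBilin_self, ← hA] at h2
  rcases hA0.eq_or_lt with hz | hpos
  · rw [← hz]; nlinarith
  · have h3 : √(1 - η) * √A ≤ d := by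
      have e : A = √A * √A := (Real.mul_self_sqrt hA0).symm
      rw [div_mul_eq_mul_div, le_div_iff₀ (Real.sqrt_pos.2 hη')] at h2
      have hs : 0 < √A := Real.sqrt_pos.2 hpos
      have : √A * (√(1 - η) * √A) ≤ √A * d := by
        calc √A * (√(1 - η) * √A) = √A * √A * √(1 - η) := by ring
          _ = A * √(1 - η) := by rw [← e]
          _ ≤ _ := h2
      exact le_of_mul_le_mul_left this hs
    calc (1 - η) * A = (√(1 - η) * √A) ^ 2 := by
          rw [mul_pow, Real.sq_sqrt hη'.le, Real.sq_sqrt hA0]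
      _ ≤ d ^ 2 := by gcongr

/-- Near each point of `Θ` the squared Fisher–Rao distance agrees with the Fisher form up to a
cubic error, and it is bi-Lipschitz to the Euclidean distance. -/
theorem exists_local_comparison (hΘ : IsOpen Θ) (hf : IsModel f Θ)
    (hsmooth : ∀ x, ContDiffOn ℝ 3 (fun θ => Real.log (f x θ)) Θ)
    (hdom : LocallyDominated f Θ) (hfisher : FisherRegular f Θ) (h₁ : θ₁ ∈ Θ) :
    ∃ ρ L η : ℝ, 0 < ρ ∧ 0 < L ∧ 0 < η ∧ ∀ t ∈ Metric.ball θ₁ ρ,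
      (∀ θ ∈ Metric.ball θ₁ ρ, fisherRao f Θ t θ ≤ ENNReal.ofReal (L * ‖θ - t‖)) ∧
      ∀ θ, fisherRao f Θ t θ ≤ ENNReal.ofReal η →
        ‖θ - t‖ ≤ L * (fisherRao f Θ t θ).toReal ∧
        |(fisherRao f Θ t θ).toReal ^ 2 - fisherForm f t (θ - t)| ≤ L * ‖θ - t‖ ^ 3 := by
  obtain ⟨δ, F, M, hd⟩ := exists_domBall hΘ hf hsmooth hdom h₁
  have hδ := hd.pos
  have hKb : Metric.closedBall θ₁ (δ / 2) ⊆ Metric.ball θ₁ δ :=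
    Metric.closedBall_subset_ball (by linarith)
  obtain ⟨c₁, c₂, hc₁, hc₁₂, hb⟩ := hfisher.form_bounds (hKb.trans hd.subset)
    (isCompact_closedBall θ₁ (δ / 2))
  set P := 3 * envMass F M with hP
  have hP0 : 0 ≤ P := by have := hd.envMass_nonneg; positivity
  set c := √c₁ with hc
  have hc0 : 0 < c := Real.sqrt_pos.2 hc₁
  have hcc : c ^ 2 = c₁ := Real.sq_sqrt hc₁.le
  have hc₂ : 0 < c₂ := hc₁.trans_le hc₁₂
  set s₂ := √c₂ with hs₂
  have hs0 : 0 < s₂ := Real.sqrt_pos.2 hc₂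
  have hss : s₂ ^ 2 = c₂ := Real.sq_sqrt hc₂.le
  set Q := P * s₂ * c₂ / (c * c₁) with hQ
  have hQ0 : 0 ≤ Q := by positivity
  have hKt : ∀ t ∈ Metric.ball θ₁ (δ / 4), ∀ θ, ‖θ - t‖ < δ / 4 →
      θ ∈ Metric.closedBall θ₁ (δ / 2) := fun t ht θ hθ => by
    rw [mem_closedBall_iff_norm]
    rw [mem_ball_iff_norm] at ht
    have := norm_add_le (θ - t) (t - θ₁)
    rw [sub_add_sub_cancel] at this
    linarith
  -- the straight segment gives the upper bounds
  have upper : ∀ t ∈ Metric.ball θ₁ (δ / 4), ∀ θ, ‖θ - t‖ < δ / 4 →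
      fisherRao f Θ t θ ≤ ENNReal.ofReal (s₂ * ‖θ - t‖) ∧
      fisherRao f Θ t θ ≤ ENNReal.ofReal (√(fisherForm f t (θ - t) + P * ‖θ - t‖ ^ 3)) :=
    fun t ht θ hθ => by
    have hin : ∀ s ∈ Icc (0 : ℝ) 1, t + s • (θ - t) ∈ Metric.closedBall θ₁ (δ / 2) :=
      fun s hs => hKt t ht _ (by
        rw [add_sub_cancel_left, norm_smul, Real.norm_eq_abs, abs_of_nonneg hs.1]
        nlinarith [hs.2, norm_nonneg (θ - t)])
    constructor
    · have := fisherRao_le_segment (f := f) (Θ := Θ) (t := t) (v := θ - t)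
        (fun s hs => hd.subset (hKb (hin s hs))) fun s hs => (hb _ (hin s hs) _).2
      rwa [add_sub_cancel, Real.sqrt_mul hc₂.le, Real.sqrt_sq (norm_nonneg _)] at this
    · have := fisherRao_le_segment (f := f) (Θ := Θ) (t := t) (v := θ - t)
        (A := fisherForm f t (θ - t) + P * ‖θ - t‖ ^ 3)
        (fun s hs => hd.subset (hKb (hin s hs))) fun s hs => by
          have := hd.abs_fisherForm_sub_le hf (hKb (hin s hs)) (hKb (hKt t ht t (by simpa)))
            (θ - t)
          rw [add_sub_cancel_left, norm_smul, Real.norm_eq_abs, abs_of_nonneg hs.1] at this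
          have h2 : P * (s * ‖θ - t‖) * ‖θ - t‖ ^ 2 ≤ P * ‖θ - t‖ ^ 3 := by
            have : s * (P * ‖θ - t‖ ^ 3) ≤ 1 * (P * ‖θ - t‖ ^ 3) := by
              gcongr; exact hs.2
            linarith
          linarith [(abs_le.1 this).2]
      rwa [add_sub_cancel] at this
  refine ⟨δ / 8, 1 / c + s₂ + P + Q + 1, c * (δ / 8), by positivity, by positivity, by positivity,
    fun t ht => ?_⟩
  have ht4 : t ∈ Metric.ball θ₁ (δ / 4) := Metric.ball_subset_ball (by linarith) ht
  refine ⟨fun θ hθ => ?_, fun θ hθ => ?_⟩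
  · have hlt : ‖θ - t‖ < δ / 4 := by
      rw [mem_ball_iff_norm] at ht hθ
      have := norm_sub_le (θ - θ₁) (t - θ₁)
      rw [sub_sub_sub_cancel_right] at this
      linarith
    refine (upper t ht4 θ hlt).1.trans (ENNReal.ofReal_le_ofReal ?_)
    gcongr
    have : 0 ≤ 1 / c := by positivity
    linarith
  set d := (fisherRao f Θ t θ).toReal with hdd
  have hfin : fisherRao f Θ t θ ≠ ∞ := (hθ.trans_lt ENNReal.ofReal_lt_top).ne
  have hd0 : 0 ≤ d := ENNReal.toReal_nonneg
  have hofd : ENNReal.ofReal d = fisherRao f Θ t θ := ENNReal.ofReal_toReal hfin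
  have hdη : d ≤ c * (δ / 8) := ENNReal.toReal_le_of_le_ofReal (by positivity) hθ
  have hA0 : ∀ u, 0 ≤ fisherForm f t u := fun u =>
    le_trans (by positivity) (hb t (hKt t ht4 t (by simpa)) u).1
  have hform : ∀ θ ∈ Metric.ball t (δ / 4), ∀ u, c ^ 2 * ‖u‖ ^ 2 ≤ fisherForm f θ u :=
    fun θ hθ u => by
      rw [hcc]
      exact (hb θ (hKt t ht4 θ (by rwa [mem_ball_iff_norm] at hθ)) u).1
  -- every path of length slightly above `d` gives both lower bounds
  have path : ∀ d', d < d' → d' < c * (δ / 4) → ‖θ - t‖ ≤ d' / c ∧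
      (1 - P * (d' / c) / c₁) * fisherForm f t (θ - t) ≤ d' ^ 2 := fun d' hd' hd'' => by
    obtain ⟨γ, hγ, hγ0, hγ1, hlen⟩ := exists_path_of_fisherRao_lt (f := f) (Θ := Θ) (a := t)
      (b := θ) (d := ENNReal.ofReal d') (by
        rw [← hofd]; exact (ENNReal.ofReal_lt_ofReal_iff_of_nonneg hd0).2 hd')
    have hd'0 : 0 ≤ d' := hd0.trans hd'.le
    have hst := norm_sub_le_of_fisherLength_lt hγ hc0 (by rw [hγ0]; exact hform) hlen.le hd'0 hd''
    have hlt : d' / c < δ / 4 := by rw [div_lt_iff₀ hc0]; linarith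
    constructor
    · have := hst 1 (by simp)
      rwa [hγ0, hγ1] at this
    · have := fisherForm_le_of_fisherLength (f := f) hγ (η := P * (d' / c) / c₁) hd'0
        (by rw [hγ0]; exact hA0) (fun s hs u => ?_) hlen.le
      · rwa [hγ0, hγ1] at this
      · have h1 := hst s hs
        rw [hγ0] at h1 ⊢
        have hmem := hKt t ht4 (γ s) (by linarith)
        have h2 := hd.abs_fisherForm_sub_le hf (hKb hmem) (hKb (hKt t ht4 t (by simpa))) u
        have h3 := (hb t (hKt t ht4 t (by simpa)) u).1
        have h4 : P * ‖γ s - t‖ * ‖u‖ ^ 2 ≤ P * (d' / c) / c₁ * fisherForm f t u := by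
          calc P * ‖γ s - t‖ * ‖u‖ ^ 2 ≤ P * (d' / c) * ‖u‖ ^ 2 := by gcongr
            _ = P * (d' / c) / c₁ * (c₁ * ‖u‖ ^ 2) := by field_simp
            _ ≤ _ := by gcongr
        linarith [(abs_le.1 h2).1]
  have hdlt : d < c * (δ / 4) := lt_of_le_of_lt hdη (by nlinarith)
  have hev : ∀ᶠ d' in 𝓝[>] d, d < d' ∧ d' < c * (δ / 4) := Ioo_mem_nhdsGT hdlt
  have hnorm : ‖θ - t‖ ≤ d / c := by
    have ht : Tendsto (fun d' : ℝ => d' / c) (𝓝[>] d) (𝓝 (d / c)) :=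
      ((continuous_id.div_const c).tendsto d).mono_left nhdsWithin_le_nhds
    exact ge_of_tendsto ht (hev.mono fun d' h => (path d' h.1 h.2).1)
  have hlow : (1 - P * (d / c) / c₁) * fisherForm f t (θ - t) ≤ d ^ 2 := by
    have ht1 : Tendsto (fun d' : ℝ => (1 - P * (d' / c) / c₁) * fisherForm f t (θ - t))
        (𝓝[>] d) (𝓝 ((1 - P * (d / c) / c₁) * fisherForm f t (θ - t))) :=
      ((by fun_prop : Continuous fun d' : ℝ =>
        (1 - P * (d' / c) / c₁) * fisherForm f t (θ - t)).tendsto d).mono_left nhdsWithin_le_nhds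
    have ht2 : Tendsto (fun d' : ℝ => d' ^ 2) (𝓝[>] d) (𝓝 (d ^ 2)) :=
      ((continuous_pow 2).tendsto d).mono_left nhdsWithin_le_nhds
    exact le_of_tendsto_of_tendsto ht1 ht2 (hev.mono fun d' h => (path d' h.1 h.2).2)
  have hlt : ‖θ - t‖ < δ / 4 := by
    have : d / c ≤ δ / 8 := by rw [div_le_iff₀ hc0]; linarith
    linarith
  have hinv : 0 ≤ 1 / c := by positivity
  obtain ⟨u1, u2⟩ := upper t ht4 θ hlt
  have hdv : d ≤ s₂ * ‖θ - t‖ := ENNReal.toReal_le_of_le_ofReal (by positivity) u1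
  have hv0 := norm_nonneg (θ - t)
  have hv3 : 0 ≤ ‖θ - t‖ ^ 3 := by positivity
  refine ⟨hnorm.trans ?_, ?_⟩
  · rw [div_eq_inv_mul, ← one_div]
    gcongr
    linarith
  · have hup : d ^ 2 ≤ fisherForm f t (θ - t) + P * ‖θ - t‖ ^ 3 := by
      have h := ENNReal.toReal_le_of_le_ofReal (Real.sqrt_nonneg _) u2
      have := hA0 (θ - t)
      calc d ^ 2 ≤ (√(fisherForm f t (θ - t) + P * ‖θ - t‖ ^ 3)) ^ 2 := by gcongr
        _ = _ := Real.sq_sqrt (by positivity)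
    have h1 : P * (d / c) / c₁ * fisherForm f t (θ - t) ≤ Q * ‖θ - t‖ ^ 3 := by
      calc P * (d / c) / c₁ * fisherForm f t (θ - t)
          ≤ P * (s₂ * ‖θ - t‖ / c) / c₁ * (c₂ * ‖θ - t‖ ^ 2) := by
            gcongr
            exacts [hA0 _, (hb t (hKt t ht4 t (by simpa)) _).2]
        _ = Q * ‖θ - t‖ ^ 3 := by rw [hQ]; field_simp
    rw [abs_le]
    constructor
    · have : Q * ‖θ - t‖ ^ 3 ≤ (1 / c + s₂ + P + Q + 1) * ‖θ - t‖ ^ 3 := by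
        gcongr; linarith
      linarith
    · have : P * ‖θ - t‖ ^ 3 ≤ (1 / c + s₂ + P + Q + 1) * ‖θ - t‖ ^ 3 := by
        gcongr; linarith
      linarith

end

/-! ### Likelihoods and the marginal distribution -/

theorem hasSum_prod_apply {a : 𝒳 → ℝ} {A : ℝ} (ha : ∀ x, 0 ≤ a x) (hA : HasSum a A) (n : ℕ) :
    HasSum (fun x : Fin n → 𝒳 => ∏ i, a (x i)) (A ^ n) := by
  induction n with
  | zero => simp [hasSum_unique]
  | succ n ih =>
    have h0 : ∀ x : Fin n → 𝒳, 0 ≤ ∏ i, a (x i) := fun x => Finset.prod_nonneg fun i _ => ha _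
    have hs := hA.summable.mul_of_nonneg ih.summable ha h0
    have := hA.mul ih hs
    rw [pow_succ', ← (Fin.consEquiv fun _ : Fin (n + 1) => 𝒳).hasSum_iff]
    refine this.congr_fun fun y => ?_
    simp [Fin.prod_univ_succ, Fin.consEquiv]

section

variable {f : 𝒳 → Param p → ℝ} {Θ : Set (Param p)} {θ₀ : Param p} {π : Param p → ℝ}

theorem IsModel.le_one (hf : IsModel f Θ) {θ : Param p} (hθ : θ ∈ Θ) (x : 𝒳) : f x θ ≤ 1 :=
  le_hasSum (hf.hasSum_one θ hθ) x fun y _ => hf.nonneg y θ hθ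

theorem IsModel.lik_nonneg (hf : IsModel f Θ) {θ : Param p} (hθ : θ ∈ Θ) (x : Fin n → 𝒳) :
    0 ≤ lik f x θ := Finset.prod_nonneg fun _ _ => hf.nonneg _ θ hθ

theorem IsModel.lik_le_one (hf : IsModel f Θ) {θ : Param p} (hθ : θ ∈ Θ) (x : Fin n → 𝒳) :
    lik f x θ ≤ 1 :=
  Finset.prod_le_one (fun _ _ => hf.nonneg _ θ hθ) fun _ _ => hf.le_one hθ _

theorem IsModel.hasSum_lik (hf : IsModel f Θ) {θ : Param p} (hθ : θ ∈ Θ) (n : ℕ) :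
    HasSum (fun x : Fin n → 𝒳 => lik f x θ) 1 := by
  simpa [lik] using hasSum_prod_apply (fun x => hf.nonneg x θ hθ) (hf.hasSum_one θ hθ) n

theorem IsModel.sum_lik_le_one (hf : IsModel f Θ) {θ : Param p} (hθ : θ ∈ Θ)
    (G : Finset (Fin n → 𝒳)) : ∑ x ∈ G, lik f x θ ≤ 1 :=
  sum_le_hasSum G (fun x _ => hf.lik_nonneg hθ x) (hf.hasSum_lik hθ n)

theorem IsModel.pos_of_pos (hf : IsModel f Θ) {x : 𝒳} {θ t : Param p} (hθ : θ ∈ Θ) (ht : t ∈ Θ)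
    (h : 0 < f x θ) : 0 < f x t :=
  (hf.nonneg x t ht).lt_of_ne' fun h0 => h.ne' (hf.support x t ht θ hθ h0)

theorem IsModel.pos_of_lik_pos (hf : IsModel f Θ) {x : Fin n → 𝒳} {θ : Param p} (hθ : θ ∈ Θ)
    (h : 0 < lik f x θ) (i : Fin n) :
    0 < f (x i) θ :=
  (hf.nonneg _ θ hθ).lt_of_ne' fun h0 => h.ne' (Finset.prod_eq_zero (Finset.mem_univ i) h0)

theorem IsModel.lik_pos_of_pos (hf : IsModel f Θ) {x : Fin n → 𝒳} {θ t : Param p} (hθ : θ ∈ Θ)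
    (ht : t ∈ Θ) (h : 0 < lik f x θ) : 0 < lik f x t :=
  Finset.prod_pos fun i _ => hf.pos_of_pos hθ ht (hf.pos_of_lik_pos hθ h i)

theorem IsModel.log_lik (hf : IsModel f Θ) {x : Fin n → 𝒳} {θ : Param p} (hθ : θ ∈ Θ)
    (h : 0 < lik f x θ) : Real.log (lik f x θ) = ∑ i, Real.log (f (x i) θ) :=
  Real.log_prod fun i _ => (hf.pos_of_lik_pos hθ h i).ne'

theorem IsModel.continuousOn (hf : IsModel f Θ)
    (hsmooth : ∀ x, ContDiffOn ℝ 3 (fun θ => Real.log (f x θ)) Θ) (x : 𝒳) :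
    ContinuousOn (f x) Θ := by
  rcases hf.pos_or_eq_zero x with h | h
  · exact (hsmooth x).continuousOn.rexp.congr fun θ hθ => (Real.exp_log (h θ hθ)).symm
  · exact continuousOn_const.congr h

theorem integrableOn_lik_mul (hΘ : IsOpen Θ) (hf : IsModel f Θ) (hπ : IsPrior π Θ θ₀)
    (hsmooth : ∀ x, ContDiffOn ℝ 3 (fun θ => Real.log (f x θ)) Θ) (x : Fin n → 𝒳) :
    IntegrableOn (fun θ => lik f x θ * π θ) Θ := by
  have hc : ContinuousOn (lik f x) Θ :=
    continuousOn_finsetProd _ fun i _ => hf.continuousOn hsmooth (x i)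
  refine Integrable.bdd_mul (c := 1) hπ.integrable
    (hc.aestronglyMeasurable hΘ.measurableSet) ?_
  filter_upwards [self_mem_ae_restrict hΘ.measurableSet] with θ hθ
  rw [Real.norm_eq_abs, abs_of_nonneg (hf.lik_nonneg hθ x)]
  exact hf.lik_le_one hθ x

theorem marginal_nonneg (hΘ : IsOpen Θ) (hf : IsModel f Θ) (hπ : IsPrior π Θ θ₀)
    (x : Fin n → 𝒳) : 0 ≤ marginal f Θ π x :=
  setIntegral_nonneg hΘ.measurableSet fun θ hθ =>
    mul_nonneg (hf.lik_nonneg hθ x) (hπ.nonneg θ hθ)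

theorem sum_marginal (hΘ : IsOpen Θ) (hf : IsModel f Θ) (hπ : IsPrior π Θ θ₀)
    (hsmooth : ∀ x, ContDiffOn ℝ 3 (fun θ => Real.log (f x θ)) Θ) (G : Finset (Fin n → 𝒳)) :
    ∑ x ∈ G, marginal f Θ π x = ∫ θ in Θ, (∑ x ∈ G, lik f x θ) * π θ := by
  simp only [Finset.sum_mul, marginal]
  exact (integral_finsetSum _ fun x _ => integrableOn_lik_mul hΘ hf hπ hsmooth x).symm

theorem integrableOn_sum_lik_mul (hΘ : IsOpen Θ) (hf : IsModel f Θ) (hπ : IsPrior π Θ θ₀)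
    (hsmooth : ∀ x, ContDiffOn ℝ 3 (fun θ => Real.log (f x θ)) Θ) (G : Finset (Fin n → 𝒳)) :
    IntegrableOn (fun θ => (∑ x ∈ G, lik f x θ) * π θ) Θ := by
  simp only [Finset.sum_mul]
  exact integrable_finsetSum _ fun x _ => integrableOn_lik_mul hΘ hf hπ hsmooth x

theorem hasSum_marginal [Countable 𝒳] (hΘ : IsOpen Θ) (hf : IsModel f Θ) (hπ : IsPrior π Θ θ₀)
    (hsmooth : ∀ x, ContDiffOn ℝ 3 (fun θ => Real.log (f x θ)) Θ) :
    HasSum (fun x : Fin n → 𝒳 => marginal f Θ π x) 1 := by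
  have hnorm : ∀ x : Fin n → 𝒳, ∫ θ in Θ, ‖lik f x θ * π θ‖ = marginal f Θ π x := fun x =>
    setIntegral_congr_fun hΘ.measurableSet fun θ hθ => by
      simp only [Real.norm_eq_abs]
      rw [abs_of_nonneg (mul_nonneg (hf.lik_nonneg hθ x) (hπ.nonneg θ hθ))]
  have hs : Summable fun x : Fin n → 𝒳 => marginal f Θ π x := by
    refine summable_of_sum_le (c := 1) (fun x => marginal_nonneg hΘ hf hπ x) fun G => ?_
    rw [sum_marginal hΘ hf hπ hsmooth, ← hπ.integral_one]
    refine setIntegral_mono_on (integrableOn_sum_lik_mul hΘ hf hπ hsmooth G) hπ.integrable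
      hΘ.measurableSet fun θ hθ => ?_
    exact mul_le_of_le_one_left (hπ.nonneg θ hθ) (hf.sum_lik_le_one hθ G)
  have := hasSum_integral_of_summable_integral_norm (μ := volume.restrict Θ)
    (F := fun (x : Fin n → 𝒳) θ => lik f x θ * π θ)
    (fun x => integrableOn_lik_mul hΘ hf hπ hsmooth x) (by simpa only [hnorm] using hs)
  have e : ∫ θ in Θ, ∑' x : Fin n → 𝒳, lik f x θ * π θ = 1 := by
    rw [← hπ.integral_one]
    refine setIntegral_congr_fun hΘ.measurableSet fun θ hθ => ?_
    rw [tsum_mul_right, (hf.hasSum_lik hθ n).tsum_eq, one_mul]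
  exact e ▸ this

theorem lik_pos_of_marginal_pos (hΘ : IsOpen Θ) (hf : IsModel f Θ) {x : Fin n → 𝒳}
    (hx : 0 < marginal f Θ π x) {θ : Param p} (hθ : θ ∈ Θ) : 0 < lik f x θ := by
  refine (hf.lik_nonneg hθ x).lt_of_ne' fun h0 => hx.ne' ?_
  rw [marginal, setIntegral_congr_fun hΘ.measurableSet (g := fun _ => (0 : ℝ)) fun t ht => ?_]
  · simp
  · have : lik f x t = 0 := by
      by_contra hne
      exact (hf.lik_pos_of_pos ht hθ ((hf.lik_nonneg ht x).lt_of_ne' hne)).ne' h0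
    simp [this]

end

/-! ### Consequences of optimality of a two-part code -/

/-- The facts about the marginal distribution of the data that the comparison of two-part codes
uses. -/
structure IsMarginal (f : 𝒳 → Param p → ℝ) (Θ : Set (Param p)) (π : Param p → ℝ) (n : ℕ) :
    Prop where
  nonneg : ∀ x : Fin n → 𝒳, 0 ≤ marginal f Θ π x
  hasSum_one : HasSum (fun x : Fin n → 𝒳 => marginal f Θ π x) 1
  lik_pos : ∀ x : Fin n → 𝒳, 0 < marginal f Θ π x → ∀ θ ∈ Θ, 0 < lik f x θ
  lik_le : ∀ x : Fin n → 𝒳, ∀ θ ∈ Θ, lik f x θ ≤ 1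

theorem isMarginal [Countable 𝒳] {f : 𝒳 → Param p → ℝ} {Θ : Set (Param p)} {θ₀ : Param p}
    {π : Param p → ℝ} (hΘ : IsOpen Θ) (hf : IsModel f Θ) (hπ : IsPrior π Θ θ₀)
    (hsmooth : ∀ x, ContDiffOn ℝ 3 (fun θ => Real.log (f x θ)) Θ) (n : ℕ) :
    IsMarginal f Θ π n :=
  ⟨marginal_nonneg hΘ hf hπ, hasSum_marginal hΘ hf hπ hsmooth,
    fun _ hx _ hθ => lik_pos_of_marginal_pos hΘ hf hx hθ, fun x _ hθ => hf.lik_le_one hθ x⟩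

namespace TwoPartCode

variable {f : 𝒳 → Param p → ℝ} {Θ : Set (Param p)} {π : Param p → ℝ} {C : TwoPartCode p 𝒳 n}

theorem hasSum_assertion (h : IsMarginal f Θ π n) (j : Fin C.k) :
    HasSum ((C.part j).indicator (marginal f Θ π)) (C.assertion f Θ π j) :=
  (h.hasSum_one.summable.indicator _).hasSum

theorem hasSum_marginal_mul (h : IsMarginal f Θ π n) (φ : Fin C.k → ℝ) :
    HasSum (fun x => marginal f Θ π x * φ (C.cell x)) (∑ j, C.assertion f Θ π j * φ j) := by
  have := hasSum_sum (s := Finset.univ) fun j _ => (hasSum_assertion (C := C) h j).mul_right (φ j)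
  refine this.congr_fun fun x => ?_
  rw [Finset.sum_eq_single (C.cell x)]
  · rw [indicator_of_mem (show x ∈ C.part (C.cell x) from rfl)]
  · intro j _ hj
    have hx : x ∉ C.part j := fun hx => hj (Eq.symm hx)
    rw [indicator_of_notMem hx, zero_mul]
  · simp

theorem sum_assertion (h : IsMarginal f Θ π n) : ∑ j, C.assertion f Θ π j = 1 := by
  have := (hasSum_marginal_mul (C := C) h fun _ => 1).unique (by simpa using h.hasSum_one)
  simpa using this

theorem assertion_nonneg (h : IsMarginal f Θ π n) (j : Fin C.k) : 0 ≤ C.assertion f Θ π j :=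
  tsum_nonneg fun x => indicator_nonneg (fun x _ => h.nonneg x) x

theorem assertion_le_one (h : IsMarginal f Θ π n) (j : Fin C.k) : C.assertion f Θ π j ≤ 1 := by
  rw [← sum_assertion (C := C) h]
  exact Finset.single_le_sum (fun j _ => assertion_nonneg h j) (Finset.mem_univ j)

theorem marginal_le_assertion (h : IsMarginal f Θ π n) (x : Fin n → 𝒳) :
    marginal f Θ π x ≤ C.assertion f Θ π (C.cell x) := by
  have := le_hasSum (hasSum_assertion (C := C) h (C.cell x)) x
    fun y _ => indicator_nonneg (fun x _ => h.nonneg x) y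
  rwa [indicator_of_mem (show x ∈ C.part (C.cell x) from rfl)] at this

/-- One data set's contribution to the expected codelength, as a real number. -/
theorem ofReal_mul_eq (h : IsMarginal f Θ π n) (hC : ∀ j, C.code j ∈ Θ) (x : Fin n → 𝒳) :
    ENNReal.ofReal (marginal f Θ π x) *
      (ENNReal.ofReal (-Real.log (C.assertion f Θ π (C.cell x))) +
      ENNReal.ofReal (-Real.log (lik f x (C.code (C.cell x))))) =
    ENNReal.ofReal (marginal f Θ π x * C.messageLength f Θ π (C.cell x) x) ∧
    0 ≤ marginal f Θ π x * C.messageLength f Θ π (C.cell x) x := by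
  rcases (h.nonneg x).eq_or_lt with h0 | h0
  · simp [← h0]
  · have l1 : 0 ≤ -Real.log (C.assertion f Θ π (C.cell x)) := by
      rw [neg_nonneg]
      exact Real.log_nonpos (assertion_nonneg h _) (assertion_le_one h _)
    have l2 : 0 ≤ -Real.log (lik f x (C.code (C.cell x))) := by
      rw [neg_nonneg]
      exact Real.log_nonpos (h.lik_pos x h0 _ (hC _)).le (h.lik_le x _ (hC _))
    have e : C.messageLength f Θ π (C.cell x) x = -Real.log (C.assertion f Θ π (C.cell x)) +
        -Real.log (lik f x (C.code (C.cell x))) := by rw [messageLength]; ring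
    rw [e]
    exact ⟨by rw [← ENNReal.ofReal_add l1 l2, ← ENNReal.ofReal_mul h0.le], by positivity⟩

theorem codelength_eq (h : IsMarginal f Θ π n) (hC : ∀ j, C.code j ∈ Θ) :
    C.codelength f Θ π =
      ∑' x, ENNReal.ofReal (marginal f Θ π x * C.messageLength f Θ π (C.cell x) x) :=
  tsum_congr fun x => (ofReal_mul_eq h hC x).1

theorem IsOptimal.summable (h : IsMarginal f Θ π n) (hC : C.IsOptimal f Θ π) :
    Summable fun x => marginal f Θ π x * C.messageLength f Θ π (C.cell x) x := by
  have := hC.finite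
  rw [codelength_eq h hC.code_mem] at this
  refine (ENNReal.summable_toReal this).congr fun x => ?_
  rw [ENNReal.toReal_ofReal (ofReal_mul_eq h hC.code_mem x).2]

/-- Optimality in the form used below: no code with codepoints in `Θ` and no choice of
(sub-)probability weights `w` for its cells has a smaller expected codelength. The passage from the
assertion probabilities of the competitor to arbitrary weights is Gibbs' inequality. -/
theorem IsOptimal.tsum_le (h : IsMarginal f Θ π n) (hC : C.IsOptimal f Θ π)
    (C' : TwoPartCode p 𝒳 n) (hC' : ∀ j, C'.code j ∈ Θ) {w : Fin C'.k → ℝ} (hw : ∀ j, 0 < w j)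
    (hw1 : ∑ j, w j ≤ 1) {S : ℝ}
    (hS : HasSum (fun x => marginal f Θ π x *
      (-Real.log (w (C'.cell x)) - Real.log (lik f x (C'.code (C'.cell x))))) S) :
    ∑' x, marginal f Θ π x * C.messageLength f Θ π (C.cell x) x ≤ S := by
  -- `log (w / q) ≤ w / q - 1`, and the sum of `q (w / q - 1)` over the cells is at most `0`
  set q := fun j => C'.assertion f Θ π j with hq
  have hu := hS.add (hasSum_marginal_mul (C := C') h fun j => w j / q j - 1)
  set T := ∑ j, C'.assertion f Θ π j * (w j / q j - 1) with hT
  have hT0 : T ≤ 0 := by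
    calc T ≤ ∑ j, (w j - C'.assertion f Θ π j) := by
          refine Finset.sum_le_sum fun j _ => ?_
          rcases (assertion_nonneg (C := C') h j).eq_or_lt with h0 | h0
          · rw [← h0]; simpa using (hw j).le
          · rw [mul_sub, mul_div_cancel₀ _ h0.ne', mul_one]
      _ ≤ 0 := by rw [Finset.sum_sub_distrib, sum_assertion h]; linarith
  have hpt : ∀ x, marginal f Θ π x * C'.messageLength f Θ π (C'.cell x) x ≤
      marginal f Θ π x * (-Real.log (w (C'.cell x)) - Real.log (lik f x (C'.code (C'.cell x)))) +
        marginal f Θ π x * (w (C'.cell x) / q (C'.cell x) - 1) := fun x => by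
    rcases (h.nonneg x).eq_or_lt with h0 | h0
    · simp [← h0]
    · have hqp : 0 < q (C'.cell x) := h0.trans_le (marginal_le_assertion h x)
      have hl := Real.log_le_sub_one_of_pos (div_pos (hw (C'.cell x)) hqp)
      rw [Real.log_div (hw _).ne' hqp.ne'] at hl
      rw [← mul_add]
      refine mul_le_mul_of_nonneg_left ?_ h0.le
      rw [messageLength]
      linarith
  have hle : C.codelength f Θ π ≤ ENNReal.ofReal (S + T) := by
    refine (hC.minimal C' hC').trans ?_
    rw [codelength_eq h hC', ← hu.tsum_eq, ENNReal.ofReal_tsum_of_nonneg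
      (fun x => ((ofReal_mul_eq h hC' x).2.trans (hpt x))) hu.summable]
    exact ENNReal.tsum_le_tsum fun x => ENNReal.ofReal_le_ofReal (hpt x)
  have hST : 0 ≤ S + T :=
    hu.nonneg fun x => (ofReal_mul_eq h hC' x).2.trans (hpt x)
  rw [codelength_eq h hC.code_mem, ← ENNReal.ofReal_tsum_of_nonneg
    (fun x => (ofReal_mul_eq h hC.code_mem x).2) (hC.summable h),
    ENNReal.ofReal_le_ofReal_iff hST] at hle
  linarith

/-- An optimal code is nowhere much worse than the plain likelihood code of a single parameter:
the data sets on which it loses `B` nats have marginal probability at most `exp (1 - B)`.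
Otherwise it would pay to give these data sets a cell of their own. -/
theorem IsOptimal.sum_marginal_le_exp (h : IsMarginal f Θ π n) (hC : C.IsOptimal f Θ π)
    {θ : Param p} (hθ : θ ∈ Θ) {B : ℝ} (G : Finset (Fin n → 𝒳))
    (hG : ∀ x ∈ G, B ≤ C.messageLength f Θ π (C.cell x) x + Real.log (lik f x θ)) :
    ∑ x ∈ G, marginal f Θ π x ≤ Real.exp (1 - B) := by
  classical
  set s := ∑ x ∈ G, marginal f Θ π x with hs
  have hs0 : 0 ≤ s := Finset.sum_nonneg fun x _ => h.nonneg x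
  rcases hs0.eq_or_lt with h0 | h0
  · rw [← h0]; positivity
  let C' : TwoPartCode p 𝒳 n :=
    { k := C.k + 1
      cell := fun x => if x ∈ G then Fin.last C.k else (C.cell x).castSucc
      code := Fin.lastCases θ C.code }
  -- the mass `s` of the new cell is added without reducing the other assertion probabilities; the
  -- normalisation costs `log (1 + s) ≤ s`
  let w : Fin C'.k → ℝ :=
    Fin.lastCases (motive := fun _ => ℝ) (s / (1 + s)) fun j => C.assertion f Θ π j / (1 + s)
  have hw : ∀ j, 0 < w j := by
    intro j
    refine Fin.lastCases ?_ (fun j => ?_) j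
    · simp only [w, Fin.lastCases_last]; positivity
    · simp only [w, Fin.lastCases_castSucc]
      have := hC.assertion_pos j
      positivity
  have hw1 : ∑ j, w j ≤ 1 := by
    have e : ∑ j, w j = ∑ j, C.assertion f Θ π j / (1 + s) + s / (1 + s) := by
      change ∑ j : Fin (C.k + 1), w j = _
      rw [Fin.sum_univ_castSucc]
      simp [w]
    rw [e, ← Finset.sum_div, sum_assertion h, ← add_div, div_self (by positivity)]
  have hC' : ∀ j, C'.code j ∈ Θ := by
    intro j
    refine Fin.lastCases ?_ (fun j => ?_) j
    · simpa [C'] using hθ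
    · simpa [C'] using hC.code_mem j
  have hfin := hasSum_sum_of_ne_finset_zero (s := G) (L := .unconditional _)
    (f := fun x => if x ∈ G then marginal f Θ π x * (-Real.log s -
      (C.messageLength f Θ π (C.cell x) x + Real.log (lik f x θ))) else 0)
    fun x hx => if_neg hx
  have hS := ((hC.summable h).hasSum.add (h.hasSum_one.mul_right (Real.log (1 + s)))).add hfin
  have key := hC.tsum_le h C' hC' hw hw1 (hS.congr_fun fun x => ?_)
  · have e : ∑ x ∈ G, (if x ∈ G then marginal f Θ π x * (-Real.log s -
        (C.messageLength f Θ π (C.cell x) x + Real.log (lik f x θ))) else 0) ≤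
        s * (-Real.log s - B) := by
      rw [hs, Finset.sum_mul]
      refine Finset.sum_le_sum fun x hx => ?_
      rw [if_pos hx]
      exact mul_le_mul_of_nonneg_left (by linarith [hG x hx]) (h.nonneg x)
    have hl := Real.log_le_sub_one_of_pos (show 0 < 1 + s by positivity)
    have h3 : s * (Real.log s) ≤ s * (1 - B) := by nlinarith
    have h4 : Real.log s ≤ 1 - B := le_of_mul_le_mul_left h3 h0
    rwa [Real.log_le_iff_le_exp h0] at h4
  · by_cases hx : x ∈ G
    · simp only [C', w, hx, if_true, Fin.lastCases_last]
      rw [Real.log_div h0.ne' (by positivity)]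
      ring
    · simp only [C', w, hx, if_false, Fin.lastCases_castSucc, messageLength]
      rw [Real.log_div (hC.assertion_pos _).ne' (by positivity)]
      ring

/-- In an optimal code, near-ties are rare: the data sets outside cell `j` for which cell `j` would
be at most `ε` worse than their own cell have marginal probability at most `4 ε q_j`. Moving them
all to cell `j` would lose at most `ε` per unit of mass, but gain a second-order term through the
larger assertion probability of cell `j`. -/
theorem IsOptimal.sum_marginal_le_of_nearTie (h : IsMarginal f Θ π n) (hC : C.IsOptimal f Θ π)
    (j : Fin C.k) {ε : ℝ} (hε : 0 ≤ ε) (hε2 : ε ≤ 1 / 2) (G : Finset (Fin n → 𝒳))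
    (hGj : ∀ x ∈ G, C.cell x ≠ j)
    (hG : ∀ x ∈ G, C.messageLength f Θ π j x ≤ C.messageLength f Θ π (C.cell x) x + ε) :
    ∑ x ∈ G, marginal f Θ π x ≤ 4 * ε * C.assertion f Θ π j := by
  classical
  set g := ∑ x ∈ G, marginal f Θ π x with hg
  set q := C.assertion f Θ π j with hq
  have hg0 : 0 ≤ g := Finset.sum_nonneg fun x _ => h.nonneg x
  have hq0 : 0 < q := hC.assertion_pos j
  rcases hg0.eq_or_lt with h0 | h0
  · rw [← h0]; positivity
  let C' : TwoPartCode p 𝒳 n :=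
    { k := C.k
      cell := fun x => if x ∈ G then j else C.cell x
      code := C.code }
  -- only the weight of cell `j` is increased; the normalisation costs `log (1 + g) ≤ g`
  let w : Fin C.k → ℝ := fun l =>
    (C.assertion f Θ π l + if l = j then g else 0) / (1 + g)
  have hw : ∀ l, 0 < w l := fun l => by
    have := hC.assertion_pos l
    simp only [w]
    split_ifs <;> positivity
  have hw1 : ∑ l, w l ≤ 1 := by
    simp only [w]
    rw [← Finset.sum_div, Finset.sum_add_distrib, sum_assertion h, Finset.sum_ite_eq' _ j]
    simp only [Finset.mem_univ, if_true]
    rw [div_self (by positivity)]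
  set u := Real.log ((q + g) / q) with hu
  have hfin := hasSum_sum_of_ne_finset_zero (s := G) (L := .unconditional _)
    (f := fun x => if x ∈ G then marginal f Θ π x * (C.messageLength f Θ π j x -
      C.messageLength f Θ π (C.cell x) x - u) else 0)
    fun x hx => if_neg hx
  have hS := (((hC.summable h).hasSum.add (h.hasSum_one.mul_right (Real.log (1 + g)))).add
    hfin).sub (hasSum_marginal_mul (C := C) h fun l => if l = j then u else 0)
  have key := hC.tsum_le h C' hC.code_mem (w := w) hw hw1 (hS.congr_fun fun x => ?_)
  · have e : ∑ x ∈ G, (if x ∈ G then marginal f Θ π x * (C.messageLength f Θ π j x -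
        C.messageLength f Θ π (C.cell x) x - u) else 0) ≤ g * (ε - u) := by
      rw [hg, Finset.sum_mul]
      refine Finset.sum_le_sum fun x hx => ?_
      rw [if_pos hx]
      exact mul_le_mul_of_nonneg_left (by linarith [hG x hx]) (h.nonneg x)
    have e2 : ∑ l, C.assertion f Θ π l * (if l = j then u else 0) = q * u := by
      simp [hq]
    rw [e2] at key
    have hl := Real.log_le_sub_one_of_pos (show 0 < 1 + g by positivity)
    -- the first-order bound `log (1 + g / q) ≤ g / q` would not see the gain: its lower bound has to be
    -- correct up to second order
    have hul := Real.le_log_one_add_of_nonneg (show 0 ≤ g / q by positivity)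
    have e3 : 1 + g / q = (q + g) / q := by field_simp
    have e4 : 2 * (g / q) / (g / q + 2) = 2 * g / (g + 2 * q) := by field_simp
    rw [e3, e4, ← hu] at hul
    have h5 : (q + g) * (2 * g / (g + 2 * q)) ≤ g * (1 + ε) := by
      have : (q + g) * (2 * g / (g + 2 * q)) ≤ (q + g) * u := by gcongr
      nlinarith
    have h6 : g * (2 * (q + g)) ≤ g * ((1 + ε) * (g + 2 * q)) := by
      rw [mul_div_assoc', div_le_iff₀ (by positivity)] at h5
      nlinarith
    have h7 := le_of_mul_le_mul_left h6 h0
    nlinarith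
  · have hA := hC.assertion_pos
    by_cases hx : x ∈ G
    · have hxj := hGj x hx
      simp only [C', w, hx, hxj, if_true, if_false, messageLength, hu]
      rw [Real.log_div (by positivity) (by positivity), Real.log_div (by positivity) hq0.ne']
      ring
    · simp only [C', w, hx, if_false, messageLength, hu]
      split_ifs with hxj
      · rw [Real.log_div (by have := hA (C.cell x); positivity) (by positivity),
          Real.log_div (by positivity) hq0.ne', hxj]
        ring
      · rw [add_zero, Real.log_div (hA _).ne' (by positivity)]
        ring

end TwoPartCode

/-! ### Probabilities of events and Chebyshev's inequality -/

section

variable {f : 𝒳 → Param p → ℝ} {Θ : Set (Param p)} {θ : Param p}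

theorem hasSum_prob (hf : IsModel f Θ) (hθ : θ ∈ Θ) (A : Set (Fin n → 𝒳)) :
    HasSum (A.indicator fun x => lik f x θ) (prob f θ A) :=
  ((hf.hasSum_lik hθ n).summable.indicator A).hasSum

theorem prob_nonneg (hf : IsModel f Θ) (hθ : θ ∈ Θ) (A : Set (Fin n → 𝒳)) : 0 ≤ prob f θ A :=
  tsum_nonneg fun x => indicator_nonneg (fun x _ => hf.lik_nonneg hθ x) x

theorem prob_mono (hf : IsModel f Θ) (hθ : θ ∈ Θ) {A B : Set (Fin n → 𝒳)} (h : A ⊆ B) :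
    prob f θ A ≤ prob f θ B :=
  hasSum_le (fun x => indicator_le_indicator_of_subset h (fun x => hf.lik_nonneg hθ x) x)
    (hasSum_prob hf hθ A) (hasSum_prob hf hθ B)

theorem prob_union_le (hf : IsModel f Θ) (hθ : θ ∈ Θ) (A B : Set (Fin n → 𝒳)) :
    prob f θ (A ∪ B) ≤ prob f θ A + prob f θ B := by
  refine hasSum_le (fun x => ?_) (hasSum_prob hf hθ (A ∪ B))
    ((hasSum_prob hf hθ A).add (hasSum_prob hf hθ B))
  have := hf.lik_nonneg hθ x
  by_cases h1 : x ∈ A <;> by_cases h2 : x ∈ B <;> simp [h1, h2, this]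

theorem prob_compl (hf : IsModel f Θ) (hθ : θ ∈ Θ) (A : Set (Fin n → 𝒳)) :
    prob f θ A + prob f θ Aᶜ = 1 := by
  have h := (hasSum_prob hf hθ A).add (hasSum_prob hf hθ Aᶜ)
  refine h.unique ((hf.hasSum_lik hθ n).congr_fun fun x => ?_)
  simp

theorem prob_iUnion_le (hf : IsModel f Θ) (hθ : θ ∈ Θ) {ι : Type*} (s : Finset ι)
    (A : ι → Set (Fin n → 𝒳)) : prob f θ (⋃ k ∈ s, A k) ≤ ∑ k ∈ s, prob f θ (A k) := by
  classical
  induction s using Finset.induction_on with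
  | empty => simp [prob]
  | insert a s ha ih =>
    rw [Finset.set_biUnion_insert, Finset.sum_insert ha]
    exact (prob_union_le hf hθ _ _).trans (by gcongr)

theorem sum_lik_le_prob (hf : IsModel f Θ) (hθ : θ ∈ Θ) {A : Set (Fin n → 𝒳)}
    (G : Finset (Fin n → 𝒳)) (hG : ∀ x ∈ G, x ∈ A) : ∑ x ∈ G, lik f x θ ≤ prob f θ A := by
  have := sum_le_hasSum G (fun x _ => indicator_nonneg (fun x _ => hf.lik_nonneg hθ x) x)
    (hasSum_prob hf hθ A)
  refine le_trans (le_of_eq (Finset.sum_congr rfl fun x hx => ?_)) this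
  rw [indicator_of_mem (hG x hx)]

theorem prob_le_of_sum_le (hf : IsModel f Θ) (hθ : θ ∈ Θ) {A : Set (Fin n → 𝒳)} {b : ℝ}
    (h : ∀ G : Finset (Fin n → 𝒳), (∀ x ∈ G, x ∈ A ∧ 0 < lik f x θ) →
      ∑ x ∈ G, lik f x θ ≤ b) :
    prob f θ A ≤ b := by
  classical
  refine hasSum_le_of_sum_le (hasSum_prob hf hθ A) fun G => ?_
  refine le_trans (le_of_eq ?_) (h (G.filter fun x => x ∈ A ∧ 0 < lik f x θ)
    fun x hx => (Finset.mem_filter.1 hx).2)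
  rw [Finset.sum_filter]
  refine Finset.sum_congr rfl fun x _ => ?_
  by_cases h1 : x ∈ A
  · by_cases h2 : 0 < lik f x θ
    · simp [h1, h2]
    · simp [h1, le_antisymm (not_lt.1 h2) (hf.lik_nonneg hθ x)]
  · simp [h1]

theorem tendsto_prob_of_compl (hf : IsModel f Θ) (hθ : θ ∈ Θ) {A : ∀ n, Set (Fin n → 𝒳)}
    (h : ∀ η > 0, ∀ᶠ n in atTop, prob f θ (A n)ᶜ ≤ η) :
    Tendsto (fun n => prob f θ (A n)) atTop (𝓝 1) := by
  rw [Metric.tendsto_nhds]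
  intro ε hε
  filter_upwards [h (ε / 2) (by positivity)] with n hn
  have h1 := prob_compl hf hθ (A n)
  have h2 := prob_nonneg hf hθ (A n)ᶜ
  rw [Real.dist_eq, abs_lt]
  constructor <;> linarith

end

theorem hasSum_mul_prod {α β : Type*} {a : α → ℝ} {b : β → ℝ} {A B : ℝ} (ha : HasSum a A)
    (hb : HasSum b B) : HasSum (fun z : α × β => a z.1 * b z.2) (A * B) :=
  ha.mul hb (summable_mul_of_summable_norm ha.summable.abs hb.summable.abs)

/-- First and second moment of a sum of i.i.d. centred variables. -/
theorem hasSum_moments {w Y : 𝒳 → ℝ} {V : ℝ} (hw : HasSum w 1)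
    (hY : HasSum (fun x => w x * Y x) 0) (hV : HasSum (fun x => w x * Y x ^ 2) V) (n : ℕ) :
    HasSum (fun x : Fin n → 𝒳 => ∏ i, w (x i)) 1 ∧
    HasSum (fun x : Fin n → 𝒳 => (∏ i, w (x i)) * ∑ i, Y (x i)) 0 ∧
    HasSum (fun x : Fin n → 𝒳 => (∏ i, w (x i)) * (∑ i, Y (x i)) ^ 2) (n * V) := by
  induction n with
  | zero =>
    refine ⟨?_, ?_, ?_⟩
    · simp [hasSum_unique]
    · simp
    · simp
  | succ n ih =>
    obtain ⟨h0, h1, h2⟩ := ih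
    refine ⟨?_, ?_, ?_⟩
    · rw [← (Fin.consEquiv fun _ : Fin (n + 1) => 𝒳).hasSum_iff]
      have := hasSum_mul_prod hw h0
      rw [one_mul] at this
      exact this.congr_fun fun y => by simp [Fin.prod_univ_succ, Fin.consEquiv]
    · rw [← (Fin.consEquiv fun _ : Fin (n + 1) => 𝒳).hasSum_iff]
      have := (hasSum_mul_prod hY h0).add (hasSum_mul_prod hw h1)
      rw [zero_mul, mul_zero, add_zero] at this
      exact this.congr_fun fun y => by
        simp [Fin.prod_univ_succ, Fin.sum_univ_succ, Fin.consEquiv]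
        ring
    · rw [← (Fin.consEquiv fun _ : Fin (n + 1) => 𝒳).hasSum_iff]
      have := ((hasSum_mul_prod hV h0).add ((hasSum_mul_prod hY h1).mul_left 2)).add
        (hasSum_mul_prod hw h2)
      rw [show V * 1 + 2 * (0 * 0) + 1 * (n * V) = ((n + 1 : ℕ) : ℝ) * V by push_cast; ring] at this
      exact this.congr_fun fun y => by
        simp [Fin.prod_univ_succ, Fin.sum_univ_succ, Fin.consEquiv]
        ring

section

variable {f : 𝒳 → Param p → ℝ} {Θ : Set (Param p)} {θ₀ : Param p}

theorem prob_abs_sum_ge_le (hf : IsModel f Θ) (hθ : θ₀ ∈ Θ) {Y : 𝒳 → ℝ} {V : ℝ}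
    (hY : HasSum (fun x => f x θ₀ * Y x) 0) (hV : HasSum (fun x => f x θ₀ * Y x ^ 2) V)
    {c : ℝ} (hc : 0 < c) (hn : 0 < n) :
    prob f θ₀ {x : Fin n → 𝒳 | c * √n ≤ |∑ i, Y (x i)|} ≤ V / c ^ 2 := by
  have hn' : (0 : ℝ) < n := by exact_mod_cast hn
  have h := (hasSum_moments (hf.hasSum_one θ₀ hθ) hY hV n).2.2.div_const (c ^ 2 * n)
  have e : n * V / (c ^ 2 * n) = V / c ^ 2 := by field_simp
  rw [e] at h
  refine hasSum_le (fun x => ?_) (hasSum_prob hf hθ _) h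
  have hl := hf.lik_nonneg hθ x
  by_cases hx : x ∈ {x : Fin n → 𝒳 | c * √n ≤ |∑ i, Y (x i)|}
  · rw [indicator_of_mem hx, le_div_iff₀ (by positivity)]
    change lik f x θ₀ * _ ≤ lik f x θ₀ * _
    refine mul_le_mul_of_nonneg_left ?_ hl
    have h1 : (c * √n) ^ 2 ≤ |∑ i, Y (x i)| ^ 2 := by
      have : c * √n ≤ |∑ i, Y (x i)| := hx
      gcongr
    rwa [mul_pow, Real.sq_sqrt hn'.le, sq_abs] at h1
  · rw [indicator_of_notMem hx]
    exact div_nonneg (mul_nonneg hl (sq_nonneg _)) (by positivity)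

theorem exists_prob_abs_sum_ge_le (hf : IsModel f Θ) (hθ : θ₀ ∈ Θ) {ι : Type*} [Fintype ι]
    {Y : ι → 𝒳 → ℝ} (hY : ∀ k, HasSum (fun x => f x θ₀ * Y k x) 0)
    (hV : ∀ k, Summable (fun x => f x θ₀ * Y k x ^ 2)) {η : ℝ} (hη : 0 < η) :
    ∃ c > 0, ∀ n : ℕ, 0 < n →
      prob f θ₀ {x : Fin n → 𝒳 | ∃ k, c * √n ≤ |∑ i, Y k (x i)|} ≤ η := by
  set V := ∑ k, ∑' x, f x θ₀ * Y k x ^ 2 with hVdef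
  have hV0 : 0 ≤ V := Finset.sum_nonneg fun k _ => tsum_nonneg fun x =>
    mul_nonneg (hf.nonneg x θ₀ hθ) (sq_nonneg _)
  refine ⟨√((V + 1) / η), Real.sqrt_pos.2 (by positivity), fun n hn => ?_⟩
  have hc : 0 < √((V + 1) / η) := Real.sqrt_pos.2 (by positivity)
  have e : {x : Fin n → 𝒳 | ∃ k, √((V + 1) / η) * √n ≤ |∑ i, Y k (x i)|} =
      ⋃ k ∈ (Finset.univ : Finset ι), {x | √((V + 1) / η) * √n ≤ |∑ i, Y k (x i)|} := by
    ext x; simp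
  rw [e]
  refine (prob_iUnion_le hf hθ _ _).trans ((Finset.sum_le_sum fun k _ =>
    prob_abs_sum_ge_le hf hθ (hY k) (hV k).hasSum hc hn).trans ?_)
  rw [← Finset.sum_div, ← hVdef, Real.sq_sqrt (by positivity), div_le_iff₀ (by positivity)]
  have : η * ((V + 1) / η) = V + 1 := by field_simp
  linarith

/-! ### The event on which the log-likelihood is regular -/

/-- The data set `x` is regular with constant `c` at `θ₀`: it is possible, the envelope `M` of the
log-density derivatives has a bounded empirical mean, and the first two derivatives of the
log-likelihood at `θ₀` deviate from their expectations by at most the order `√n`. -/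
structure IsRegular (f : 𝒳 → Param p → ℝ) (θ₀ : Param p) (M : 𝒳 → ℝ) (c : ℝ)
    (x : Fin n → 𝒳) : Prop where
  pos : 0 < lik f x θ₀
  sum_le : ∑ i, M (x i) ≤ c * n
  score : ∀ v, |∑ i, dlog f 1 (x i) θ₀ v| ≤ c * √n * ‖v‖
  hess : ∀ v, |∑ i, dlog f 2 (x i) θ₀ v + n * fisherForm f θ₀ v| ≤ c * √n * ‖v‖ ^ 2

theorem abs_apply_le_norm (v : Param p) (a : Fin p) : |v a| ≤ ‖v‖ := by
  simpa using PiLp.norm_apply_le v a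

/-- A quadratic form is controlled by its values at the vectors `e_a` and `e_a + e_b`. -/
theorem abs_quadratic_le (T : Fin p → Fin p → ℝ) {Q : Param p → ℝ}
    (hQ : ∀ v, Q v = ∑ a, ∑ b, v a * T a b * v b) (v : Param p) :
    |Q v| ≤ ‖v‖ ^ 2 * ∑ a, ∑ b, (|Q (EuclideanSpace.single a 1 + EuclideanSpace.single b 1)| +
      |Q (EuclideanSpace.single a 1)| + |Q (EuclideanSpace.single b 1)|) := by
  have h1 : ∀ a, Q (EuclideanSpace.single a 1) = T a a := fun a => by
    rw [hQ]
    simp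
  have h2 : ∀ a b, Q (EuclideanSpace.single a 1 + EuclideanSpace.single b 1) =
      T a a + T a b + T b a + T b b := fun a b => by
    rw [hQ]
    simp [add_mul, mul_add, Finset.sum_add_distrib]
    ring
  have h3 : Q v = ∑ a, ∑ b, (v a * v b) * ((Q (EuclideanSpace.single a 1 +
      EuclideanSpace.single b 1) - Q (EuclideanSpace.single a 1) -
      Q (EuclideanSpace.single b 1)) / 2) := by
    have hT : Q v = ∑ a, ∑ b, v a * T b a * v b := by
      rw [hQ, Finset.sum_comm]
      exact Finset.sum_congr rfl fun a _ => Finset.sum_congr rfl fun b _ => by ring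
    have : Q v = (∑ a, ∑ b, v a * T a b * v b + ∑ a, ∑ b, v a * T b a * v b) / 2 := by
      rw [← hQ, ← hT]; ring
    rw [this, ← Finset.sum_add_distrib, Finset.sum_div]
    refine Finset.sum_congr rfl fun a _ => ?_
    rw [← Finset.sum_add_distrib, Finset.sum_div]
    refine Finset.sum_congr rfl fun b _ => ?_
    rw [h2, h1, h1]
    ring
  rw [h3, Finset.mul_sum]
  refine (Finset.abs_sum_le_sum_abs _ _).trans (Finset.sum_le_sum fun a _ => ?_)
  rw [Finset.mul_sum]
  refine (Finset.abs_sum_le_sum_abs _ _).trans (Finset.sum_le_sum fun b _ => ?_)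
  rw [abs_mul, abs_mul, sq]
  have ha := abs_apply_le_norm v a
  have hb := abs_apply_le_norm v b
  gcongr
  rw [abs_div, abs_two]
  set q1 := Q (EuclideanSpace.single a 1 + EuclideanSpace.single b 1)
  set q2 := Q (EuclideanSpace.single a 1)
  set q3 := Q (EuclideanSpace.single b 1)
  have := abs_sub (q1 - q2) q3
  have := abs_sub q1 q2
  have := abs_nonneg q1
  have := abs_nonneg q2
  have := abs_nonneg q3
  linarith

theorem exists_dlog_two_eq (x : 𝒳) (θ : Param p) :
    ∃ T : Fin p → Fin p → ℝ, ∀ v, dlog f 2 x θ v = ∑ a, ∑ b, v a * T a b * v b := by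
  set B := fderiv ℝ (fderiv ℝ fun η => Real.log (f x η)) θ with hB
  refine ⟨fun a b => B (EuclideanSpace.single a 1) (EuclideanSpace.single b 1), fun v => ?_⟩
  have hv : v = ∑ a, v a • (EuclideanSpace.single a (1 : ℝ) : Param p) := by
    ext b
    simp [Finset.sum_apply, Pi.single_apply]
  have h : dlog f 2 x θ v = B v v := by
    rw [dlog, iteratedFDeriv_two_apply]
  rw [h]
  conv_lhs => rw [hv]
  simp only [map_sum, map_smul, sum_apply, smul_apply,
    smul_eq_mul, Finset.mul_sum]
  rw [Finset.sum_comm]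
  exact Finset.sum_congr rfl fun a _ => Finset.sum_congr rfl fun b _ => by ring

variable {δ : ℝ} {F M : 𝒳 → ℝ}

/-- Regular data sets have probability close to one, uniformly in `n`. -/
theorem DomBall.exists_prob_not_isRegular_le (hf : IsModel f Θ) (hd : DomBall f Θ θ₀ δ F M)
    {η : ℝ} (hη : 0 < η) :
    ∃ c > 0, ∀ n : ℕ, 0 < n →
      prob f θ₀ {x : Fin n → 𝒳 | ¬ IsRegular f θ₀ M c x} ≤ η := by
  have hc := hd.center_mem
  have hθ := hd.subset hc
  -- all the variables below have second moments, being bounded by a multiple of `1 + M`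
  have hsq : ∀ (Y : 𝒳 → ℝ) (b : ℝ), 0 ≤ b → (∀ x, |Y x| ≤ b * (1 + M x)) →
      Summable fun x => f x θ₀ * Y x ^ 2 := fun Y b hb hY => by
    refine hd.summable_of_abs_le (b ^ 2) fun x => ?_
    have hF := hd.F_nonneg x
    have hM := hd.M_nonneg x
    rw [abs_mul, abs_of_nonneg (hd.f_nonneg hf x hc), abs_pow]
    calc f x θ₀ * |Y x| ^ 2 ≤ F x * (b * (1 + M x)) ^ 2 := by
          gcongr
          exacts [hd.le x _ hc, hY x]
      _ = b ^ 2 * (F x * (1 + M x) ^ 2) := by ring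
      _ ≤ _ := by
          gcongr
          · linarith
          · norm_num
  have hsM : Summable fun x => f x θ₀ * M x :=
    hd.summable_f_mul hf hc 1 (k := 1) (by norm_num) fun x => by
      rw [abs_of_nonneg (hd.M_nonneg x)]; simp
  set m := ∑' x, f x θ₀ * M x with hm
  have hm0 : 0 ≤ m := tsum_nonneg fun x => mul_nonneg (hd.f_nonneg hf x hc) (hd.M_nonneg x)
  obtain ⟨c0, hc0, h0⟩ := exists_prob_abs_sum_ge_le hf hθ (ι := Unit)
    (Y := fun _ x => M x - m) (fun _ => by
      have := hsM.hasSum.sub ((hf.hasSum_one θ₀ hθ).mul_right m)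
      rw [← hm, one_mul, sub_self] at this
      exact this.congr_fun fun x => by ring) (fun _ => hsq _ (1 + m) (by positivity) fun x => by
      have := hd.M_nonneg x
      rw [abs_le]; constructor <;> nlinarith) (η := η / 4) (by positivity)
  obtain ⟨c1, hc1, h1⟩ := exists_prob_abs_sum_ge_le hf hθ (ι := Fin p)
    (Y := fun a x => dlog f 1 x θ₀ (EuclideanSpace.single a 1))
    (fun a => (hd.bartlett hf _).1) (fun a => hsq _ 1 zero_le_one fun x => by
      have := hd.abs_dlog_le (x := x) hc (k := 1) (by norm_num) (by norm_num)
        (EuclideanSpace.single a (1 : ℝ))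
      simp at this; linarith) (η := η / 4) (by positivity)
  have hYhess : ∀ v : Param p, HasSum (fun x => f x θ₀ * (dlog f 2 x θ₀ v + fisherForm f θ₀ v)) 0 ∧
      Summable fun x => f x θ₀ * (dlog f 2 x θ₀ v + fisherForm f θ₀ v) ^ 2 := fun v => by
    constructor
    · have := (hd.bartlett hf v).2.add ((hf.hasSum_one θ₀ hθ).mul_right (fisherForm f θ₀ v))
      rw [one_mul, neg_add_cancel] at this
      exact this.congr_fun fun x => by ring
    · refine hsq _ (‖v‖ ^ 2 + |fisherForm f θ₀ v|) (by positivity) fun x => ?_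
      have h2 := hd.abs_dlog_le (x := x) hc (k := 2) (by norm_num) (by norm_num) v
      have := hd.M_nonneg x
      have := abs_nonneg (fisherForm f θ₀ v)
      have := abs_add_le (dlog f 2 x θ₀ v) (fisherForm f θ₀ v)
      nlinarith [norm_nonneg v, sq_nonneg ‖v‖]
  obtain ⟨c2, hc2, h2⟩ := exists_prob_abs_sum_ge_le hf hθ (ι := Fin p)
    (Y := fun a x => dlog f 2 x θ₀ (EuclideanSpace.single a 1) +
      fisherForm f θ₀ (EuclideanSpace.single a 1))
    (fun a => (hYhess _).1) (fun a => (hYhess _).2) (η := η / 4) (by positivity)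
  obtain ⟨c3, hc3, h3⟩ := exists_prob_abs_sum_ge_le hf hθ (ι := Fin p × Fin p)
    (Y := fun k x => dlog f 2 x θ₀ (EuclideanSpace.single k.1 1 + EuclideanSpace.single k.2 1) +
      fisherForm f θ₀ (EuclideanSpace.single k.1 1 + EuclideanSpace.single k.2 1))
    (fun a => (hYhess _).1) (fun a => (hYhess _).2) (η := η / 4) (by positivity)
  set c := (c0 + m) + p * c1 + p * (p * (c3 + c2 + c2)) with hcdef
  refine ⟨c, by positivity, fun n hn => ?_⟩
  have hn' : (1 : ℝ) ≤ n := by exact_mod_cast hn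
  refine prob_le_of_sum_le hf hθ fun G hG => ?_
  set A0 := {x : Fin n → 𝒳 | ∃ k : Unit, c0 * √n ≤ |∑ i, (M (x i) - m)|}
  set A1 := {x : Fin n → 𝒳 | ∃ a : Fin p, c1 * √n ≤
    |∑ i, dlog f 1 (x i) θ₀ (EuclideanSpace.single a 1)|}
  set A2 := {x : Fin n → 𝒳 | ∃ a : Fin p, c2 * √n ≤
    |∑ i, (dlog f 2 (x i) θ₀ (EuclideanSpace.single a 1) +
      fisherForm f θ₀ (EuclideanSpace.single a 1))|}
  set A3 := {x : Fin n → 𝒳 | ∃ k : Fin p × Fin p, c3 * √n ≤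
    |∑ i, (dlog f 2 (x i) θ₀ (EuclideanSpace.single k.1 1 + EuclideanSpace.single k.2 1) +
      fisherForm f θ₀ (EuclideanSpace.single k.1 1 + EuclideanSpace.single k.2 1))|}
  have hsub : ∀ x ∈ G, x ∈ (A0 ∪ A1) ∪ (A2 ∪ A3) := fun x hx => by
    by_contra hA
    simp only [mem_union, not_or] at hA
    obtain ⟨⟨a0, a1⟩, a2, a3⟩ := hA
    simp only [A0, A1, A2, A3, mem_ofPred_eq, not_exists, not_le] at a0 a1 a2 a3
    refine (hG x hx).1 ⟨(hG x hx).2, ?_, fun v => ?_, fun v => ?_⟩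
    · have h := (abs_lt.1 (a0 ())).2
      rw [Finset.sum_sub_distrib, Finset.sum_const, Finset.card_univ, Fintype.card_fin,
        nsmul_eq_mul] at h
      have hs : √(n : ℝ) ≤ n := by
        rw [Real.sqrt_le_left (by positivity)]; nlinarith
      have : (c0 + m) * n ≤ c * n := by
        gcongr; rw [hcdef]
        have : 0 ≤ p * c1 + p * (p * (c3 + c2 + c2)) := by positivity
        linarith
      nlinarith
    · have e : ∑ i, dlog f 1 (x i) θ₀ v =
          ∑ a, v a * ∑ i, dlog f 1 (x i) θ₀ (EuclideanSpace.single a 1) := by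
        simp only [← score_inner (f := f)]
        simp only [PiLp.single_apply, mul_ite, mul_one, mul_zero, Finset.sum_ite_eq',
          Finset.mem_univ, if_true, Finset.mul_sum]
        rw [Finset.sum_comm]
        exact Finset.sum_congr rfl fun a _ => Finset.sum_congr rfl fun i _ => by ring
      rw [e]
      calc _ ≤ ∑ a : Fin p, ‖v‖ * (c1 * √n) := by
            refine (Finset.abs_sum_le_sum_abs _ _).trans (Finset.sum_le_sum fun a _ => ?_)
            rw [abs_mul]
            exact mul_le_mul (abs_apply_le_norm v a) (a1 a).le (abs_nonneg _) (norm_nonneg _)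
        _ = p * c1 * √n * ‖v‖ := by simp; ring
        _ ≤ _ := by
            gcongr; rw [hcdef]
            have : 0 ≤ (c0 + m) + p * (p * (c3 + c2 + c2)) := by positivity
            linarith
    · have e : ∀ v, ∑ i, dlog f 2 (x i) θ₀ v + n * fisherForm f θ₀ v =
          ∑ i, (dlog f 2 (x i) θ₀ v + fisherForm f θ₀ v) := fun v => by
        simp [Finset.sum_add_distrib]
      choose T hT using fun i => exists_dlog_two_eq (f := f) (x i) θ₀
      have hq := abs_quadratic_le (fun a b => ∑ i, (T i a b + fisherInfo f θ₀ a b))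
        (Q := fun v => ∑ i, (dlog f 2 (x i) θ₀ v + fisherForm f θ₀ v)) (fun v => by
          simp only [hT, fisherForm, ← Finset.sum_add_distrib]
          rw [Finset.sum_comm]
          refine Finset.sum_congr rfl fun a _ => ?_
          rw [Finset.sum_comm]
          refine Finset.sum_congr rfl fun b _ => ?_
          rw [Finset.mul_sum, Finset.sum_mul]
          exact Finset.sum_congr rfl fun i _ => by ring) v
      rw [e]
      refine hq.trans ?_
      calc _ ≤ ‖v‖ ^ 2 * ∑ a : Fin p, ∑ b : Fin p, (c3 * √n + c2 * √n + c2 * √n) := by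
            gcongr with a _ b _
            · exact (a3 (a, b)).le
            · exact (a2 a).le
            · exact (a2 b).le
        _ = p * (p * (c3 + c2 + c2)) * √n * ‖v‖ ^ 2 := by simp; ring
        _ ≤ _ := by
            gcongr; rw [hcdef]
            have : 0 ≤ (c0 + m) + p * c1 := by positivity
            linarith
  refine (sum_lik_le_prob hf hθ G hsub).trans ?_
  have u1 := prob_union_le hf hθ (A0 ∪ A1) (A2 ∪ A3)
  have u2 := prob_union_le hf hθ A0 A1
  have u3 := prob_union_le hf hθ A2 A3
  have := h0 n hn
  have := h1 n hn
  have := h2 n hn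
  have := h3 n hn
  linarith

end

/-! ### Expansion of the log-likelihood on regular data sets -/

section

variable {f : 𝒳 → Param p → ℝ} {Θ : Set (Param p)} {θ₀ : Param p} {π : Param p → ℝ}
  {δ : ℝ} {F M : 𝒳 → ℝ} {c : ℝ} {x : Fin n → 𝒳}

theorem IsRegular.lik_pos (hf : IsModel f Θ) (h₀ : θ₀ ∈ Θ) (hx : IsRegular f θ₀ M c x)
    {θ : Param p} (hθ : θ ∈ Θ) : 0 < lik f x θ := hf.lik_pos_of_pos h₀ hθ hx.pos

/-- Third-order Taylor expansion of the log-likelihood, with the constant of the regular data set. -/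
theorem IsRegular.taylor (hf : IsModel f Θ) (hd : DomBall f Θ θ₀ δ F M)
    (hx : IsRegular f θ₀ M c x) {a v : Param p} (ha : a ∈ Metric.ball θ₀ δ)
    (hv : a + v ∈ Metric.ball θ₀ δ) :
    |Real.log (lik f x (a + v)) - Real.log (lik f x a) - ∑ i, dlog f 1 (x i) a v -
      (∑ i, dlog f 2 (x i) a v) / 2| ≤ c * n * ‖v‖ ^ 3 := by
  have h₀ := hd.subset hd.center_mem
  rw [hf.log_lik (hd.subset ha) (hx.lik_pos hf h₀ (hd.subset ha)),
    hf.log_lik (hd.subset hv) (hx.lik_pos hf h₀ (hd.subset hv)), Finset.sum_div,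
    ← Finset.sum_sub_distrib, ← Finset.sum_sub_distrib, ← Finset.sum_sub_distrib]
  calc _ ≤ ∑ i, M (x i) * ‖v‖ ^ 3 := (Finset.abs_sum_le_sum_abs _ _).trans
        (Finset.sum_le_sum fun i _ => hd.abs_log_taylor_le ha hv)
    _ = (∑ i, M (x i)) * ‖v‖ ^ 3 := by rw [Finset.sum_mul]
    _ ≤ _ := by gcongr; exact hx.sum_le

/-- The likelihood equation. -/
theorem IsMLE.sum_dlog_eq_zero (hf : IsModel f Θ) (hd : DomBall f Θ θ₀ δ F M)
    (hx : IsRegular f θ₀ M c x) {t : Param p} (ht : IsMLE f Θ x t) (htb : t ∈ Metric.ball θ₀ δ)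
    (v : Param p) : ∑ i, dlog f 1 (x i) t v = 0 := by
  have h₀ := hd.subset hd.center_mem
  have hcont : ContinuousAt (fun s : ℝ => t + s • v) 0 := by fun_prop
  have hev : ∀ᶠ s in 𝓝 (0 : ℝ), t + s • v ∈ Metric.ball θ₀ δ :=
    hcont.eventually_mem (by simpa using Metric.isOpen_ball.mem_nhds htb)
  have hmax : IsLocalMax (fun s : ℝ => ∑ i, dlog f 0 (x i) (t + s • v) v) 0 := by
    filter_upwards [hev] with s hs
    simp only [dlog_zero, zero_smul, add_zero]
    rw [← hf.log_lik ht.1 (hx.lik_pos hf h₀ ht.1),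
      ← hf.log_lik (hd.subset hs) (hx.lik_pos hf h₀ (hd.subset hs))]
    exact Real.log_le_log (hx.lik_pos hf h₀ (hd.subset hs)) (ht.2 _ (hd.subset hs))
  have hder := HasDerivAt.fun_sum (u := Finset.univ) fun i _ =>
    hd.hasDerivAt_dlog (x := x i) (a := t) (v := v) (h := 0) (k := 0) (by simpa using htb)
      (by norm_num)
  have := hmax.hasDerivAt_eq_zero hder
  simpa using this

/-- Near `θ₀` the log-likelihood is bounded above by a strictly concave quadratic. -/
theorem IsRegular.log_lik_sub_le (hf : IsModel f Θ) (hd : DomBall f Θ θ₀ δ F M)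
    (hx : IsRegular f θ₀ M c x) {c₁ : ℝ} (hform : ∀ v, c₁ * ‖v‖ ^ 2 ≤ fisherForm f θ₀ v)
    (hn : c * √n ≤ c₁ / 4 * n) {θ : Param p} (hθ : θ ∈ Metric.ball θ₀ δ)
    (hθ2 : c * ‖θ - θ₀‖ ≤ c₁ / 8) :
    Real.log (lik f x θ) - Real.log (lik f x θ₀) ≤
      c * √n * ‖θ - θ₀‖ - c₁ / 4 * n * ‖θ - θ₀‖ ^ 2 := by
  have hT := hx.taylor hf hd (v := θ - θ₀) hd.center_mem (by rwa [add_sub_cancel])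
  rw [add_sub_cancel] at hT
  have h1 := (abs_le.1 hT).2
  have h2 := (abs_le.1 (hx.score (θ - θ₀))).2
  have h3 := (abs_le.1 (hx.hess (θ - θ₀))).2
  have h4 : n * (c₁ * ‖θ - θ₀‖ ^ 2) ≤ n * fisherForm f θ₀ (θ - θ₀) := by
    gcongr; exact hform _
  have h5 : c * n * ‖θ - θ₀‖ ^ 3 ≤ c₁ / 8 * n * ‖θ - θ₀‖ ^ 2 := by
    calc c * n * ‖θ - θ₀‖ ^ 3 = (c * ‖θ - θ₀‖) * (n * ‖θ - θ₀‖ ^ 2) := by ring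
      _ ≤ c₁ / 8 * (n * ‖θ - θ₀‖ ^ 2) := by gcongr
      _ = _ := by ring
  have h6 : c * √n * ‖θ - θ₀‖ ^ 2 ≤ c₁ / 4 * n * ‖θ - θ₀‖ ^ 2 := by gcongr
  linarith

/-- An estimate that is merely close to `θ₀` is within `O(1 / √n)` of it: by `log_lik_sub_le` the
log-likelihood is below its value at `θ₀` farther out. -/
theorem IsRegular.norm_mle_sub_le (hf : IsModel f Θ) (hd : DomBall f Θ θ₀ δ F M)
    (hx : IsRegular f θ₀ M c x) {c₁ : ℝ} (hc₁ : 0 < c₁)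
    (hform : ∀ v, c₁ * ‖v‖ ^ 2 ≤ fisherForm f θ₀ v)
    (hn0 : 0 < n) (hn : c * √n ≤ c₁ / 4 * n) {t : Param p} (ht : IsMLE f Θ x t)
    (htb : t ∈ Metric.ball θ₀ δ) (ht2 : c * ‖t - θ₀‖ ≤ c₁ / 8) :
    ‖t - θ₀‖ ≤ 4 * c / c₁ / √n := by
  have h := hx.log_lik_sub_le hf hd hform hn htb ht2
  have h₀ := hd.subset hd.center_mem
  have h1 : Real.log (lik f x θ₀) ≤ Real.log (lik f x t) := Real.log_le_log hx.pos (ht.2 _ h₀)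
  have hn' : (0 : ℝ) < √n := Real.sqrt_pos.2 (by exact_mod_cast hn0)
  have hsq : (n : ℝ) = √n * √n := (Real.mul_self_sqrt (by positivity)).symm
  have hc : 0 ≤ c := by
    by_contra hneg
    have hs := (abs_nonneg _).trans (hx.score (t - θ₀))
    have hM : (0 : ℝ) ≤ ∑ i, M (x i) := Finset.sum_nonneg fun i _ => hd.M_nonneg _
    have := hM.trans hx.sum_le
    have hn'' : (0 : ℝ) < n := by exact_mod_cast hn0
    nlinarith
  rcases (norm_nonneg (t - θ₀)).eq_or_lt with h0 | h0
  · rw [← h0]; positivity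
  · rw [le_div_iff₀ hn', le_div_iff₀ hc₁]
    generalize √(n : ℝ) = s at *
    rw [hsq] at h
    have h2 : (s * ‖t - θ₀‖) * (‖t - θ₀‖ * s * c₁) ≤ (s * ‖t - θ₀‖) * (4 * c) := by nlinarith
    exact le_of_mul_le_mul_left h2 (by positivity)

/-- The maximum over `‖θ - θ₀‖` of the quadratic bound in `log_lik_sub_le`. -/
theorem IsRegular.log_lik_sub_le_const (hf : IsModel f Θ) (hd : DomBall f Θ θ₀ δ F M)
    (hx : IsRegular f θ₀ M c x) {c₁ : ℝ} (hc₁ : 0 < c₁)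
    (hform : ∀ v, c₁ * ‖v‖ ^ 2 ≤ fisherForm f θ₀ v)
    (hn : c * √n ≤ c₁ / 4 * n) {θ : Param p} (hθ : θ ∈ Metric.ball θ₀ δ)
    (hθ2 : c * ‖θ - θ₀‖ ≤ c₁ / 8) :
    Real.log (lik f x θ) - Real.log (lik f x θ₀) ≤ c ^ 2 / c₁ := by
  refine (hx.log_lik_sub_le hf hd hform hn hθ hθ2).trans ?_
  rw [le_div_iff₀ hc₁]
  have hsq : (n : ℝ) = √n * √n := (Real.mul_self_sqrt (by positivity)).symm
  generalize √(n : ℝ) = s at *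
  rw [hsq]
  nlinarith [sq_nonneg (c - c₁ / 2 * (s * ‖θ - θ₀‖))]

/-- The local quadratic approximation of the log-likelihood around the maximum likelihood
estimate. -/
theorem IsRegular.abs_quadratic_le (hf : IsModel f Θ) (hd : DomBall f Θ θ₀ δ F M)
    (hx : IsRegular f θ₀ M c x) (hc : 0 ≤ c) {b : ℝ} (hn0 : 0 < n) {t θ : Param p}
    (ht : IsMLE f Θ x t) (htb : t ∈ Metric.ball θ₀ δ) (htn : ‖t - θ₀‖ ≤ b / √n)
    (hθ : θ ∈ Metric.ball θ₀ δ) :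
    |Real.log (lik f x t) - Real.log (lik f x θ) - (n / 2 : ℝ) * fisherForm f t (θ - t)| ≤
      c * n * ‖θ - t‖ ^ 3 + (c * b + c + 3 * envMass F M * b) * √n * ‖θ - t‖ ^ 2 := by
  have hn' : (0 : ℝ) < √n := Real.sqrt_pos.2 (by exact_mod_cast hn0)
  have hT := hx.taylor hf hd (v := θ - t) htb (by rwa [add_sub_cancel])
  rw [add_sub_cancel, ht.sum_dlog_eq_zero hf hd hx htb, sub_zero] at hT
  have hsq : (n : ℝ) = √n * √n := (Real.mul_self_sqrt (by positivity)).symm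
  have hnb : (n : ℝ) * (b / √n) = b * √n := by
    generalize √(n : ℝ) = s at *
    rw [hsq]
    field_simp
  have e1 : |∑ i, dlog f 2 (x i) t (θ - t) - ∑ i, dlog f 2 (x i) θ₀ (θ - t)| ≤
      c * b * √n * ‖θ - t‖ ^ 2 := by
    rw [← Finset.sum_sub_distrib]
    calc _ ≤ ∑ i, M (x i) * ‖t - θ₀‖ * ‖θ - t‖ ^ 2 := (Finset.abs_sum_le_sum_abs _ _).trans
          (Finset.sum_le_sum fun i _ => hd.abs_dlog_sub_le htb hd.center_mem (by norm_num) _)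
      _ = (∑ i, M (x i)) * ‖t - θ₀‖ * ‖θ - t‖ ^ 2 := by rw [Finset.sum_mul, Finset.sum_mul]
      _ ≤ c * n * (b / √n) * ‖θ - t‖ ^ 2 := by
          gcongr
          exact hx.sum_le
      _ = c * (n * (b / √n)) * ‖θ - t‖ ^ 2 := by ring
      _ = _ := by rw [hnb]; ring
  have e2 : |(n : ℝ) * fisherForm f t (θ - t) - n * fisherForm f θ₀ (θ - t)| ≤
      3 * envMass F M * b * √n * ‖θ - t‖ ^ 2 := by
    rw [← mul_sub, abs_mul, Nat.abs_cast]
    have hE := hd.envMass_nonneg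
    calc _ ≤ n * (3 * envMass F M * (b / √n) * ‖θ - t‖ ^ 2) := by
          gcongr
          refine (hd.abs_fisherForm_sub_le hf htb hd.center_mem _).trans ?_
          gcongr
      _ = 3 * envMass F M * (n * (b / √n)) * ‖θ - t‖ ^ 2 := by ring
      _ = _ := by rw [hnb]; ring
  have e3 := hx.hess (θ - t)
  rw [abs_le] at hT e1 e2 e3 ⊢
  have hpos : 0 ≤ c * √n * ‖θ - t‖ ^ 2 := by positivity
  constructor <;> nlinarith [hT.1, hT.2, e1.1, e1.2, e2.1, e2.2, e3.1, e3.2]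

theorem IsPrior.exists_bounds (hπ : IsPrior π Θ θ₀) :
    ∃ ρ > 0, ∃ a > 0, ∃ b : ℝ, ∀ θ ∈ Metric.ball θ₀ ρ, a ≤ π θ ∧ π θ ≤ b := by
  obtain ⟨U, hU, hc, hpos⟩ := hπ.regular
  have h0 := hpos θ₀ (mem_of_mem_nhds hU)
  have hca := hc.continuousAt hU
  have h1 : ∀ᶠ θ in 𝓝 θ₀, π θ₀ / 2 < π θ := hca.eventually_const_lt (by linarith)
  have h2 : ∀ᶠ θ in 𝓝 θ₀, π θ < π θ₀ + 1 := hca.eventually_lt_const (by linarith)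
  obtain ⟨ρ, hρ, hb⟩ := Metric.eventually_nhds_iff_ball.1 (h1.and h2)
  exact ⟨ρ, hρ, π θ₀ / 2, by positivity, π θ₀ + 1, fun θ hθ => ⟨(hb θ hθ).1.le, (hb θ hθ).2.le⟩⟩

theorem volume_real_ball (t : Param p) {r : ℝ} (hr : 0 < r) :
    volume.real (Metric.ball t r) = r ^ p * volume.real (Metric.ball (0 : Param p) 1) := by
  rw [measureReal_def, measureReal_def, Measure.addHaar_ball_of_pos _ _ hr, ENNReal.toReal_mul,
    ENNReal.toReal_ofReal (by positivity)]
  simp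

/-- On regular data sets the marginal probability is at least of the order `n ^ (-p / 2)` times
the likelihood of `θ₀`. -/
theorem exists_marginal_ge (hΘ : IsOpen Θ) (hf : IsModel f Θ) (hπ : IsPrior π Θ θ₀)
    (hsmooth : ∀ x, ContDiffOn ℝ 3 (fun θ => Real.log (f x θ)) Θ)
    (hd : DomBall f Θ θ₀ δ F M) {c₂ : ℝ}
    (hform : ∀ v, fisherForm f θ₀ v ≤ c₂ * ‖v‖ ^ 2) (hc : 0 ≤ c) :
    ∃ κ > 0, ∀ᶠ n : ℕ in atTop, ∀ x : Fin n → 𝒳, IsRegular f θ₀ M c x →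
      κ / √n ^ p * lik f x θ₀ ≤ marginal f Θ π x := by
  obtain ⟨ρ, hρ, a, ha, b, hab⟩ := hπ.exists_bounds
  have h₀ := hd.subset hd.center_mem
  set K := c + (|c₂| + c) / 2 + c with hK
  set vol := volume.real (Metric.ball (0 : Param p) 1) with hvol
  have hvol0 : 0 < vol := ENNReal.toReal_pos (Metric.measure_ball_pos _ _ zero_lt_one).ne'
    measure_ball_lt_top.ne
  refine ⟨Real.exp (-K) * a * vol, by positivity, ?_⟩
  have hr : ∀ᶠ n : ℕ in atTop, 1 / √(n : ℝ) < min δ ρ := by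
    have : Tendsto (fun n : ℕ => 1 / √(n : ℝ)) atTop (𝓝 0) := by
      simpa only [one_div, Function.comp_def] using tendsto_inv_atTop_zero.comp (Real.tendsto_sqrt_atTop.comp
        (tendsto_natCast_atTop_atTop (R := ℝ)))
    exact this.eventually_lt_const (lt_min hd.pos hρ)
  filter_upwards [hr, eventually_gt_atTop 0] with n hn hn0 x hx
  have hn1 : (1 : ℝ) ≤ n := by exact_mod_cast hn0
  have hs1 : (1 : ℝ) ≤ √n := Real.one_le_sqrt.2 hn1
  have hsq : (n : ℝ) = √n * √n := (Real.mul_self_sqrt (by positivity)).symm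
  set B := Metric.ball θ₀ (1 / √(n : ℝ)) with hB
  have hBδ : B ⊆ Metric.ball θ₀ δ := Metric.ball_subset_ball (hn.le.trans (min_le_left _ _))
  have hBρ : B ⊆ Metric.ball θ₀ ρ := Metric.ball_subset_ball (hn.le.trans (min_le_right _ _))
  have hlow : ∀ θ ∈ B, Real.exp (-K) * lik f x θ₀ * a ≤ lik f x θ * π θ := fun θ hθ => by
    have hθδ := hBδ hθ
    have hv : ‖θ - θ₀‖ ≤ 1 / √n := (mem_ball_iff_norm.1 hθ).le
    have hv1 : √n * ‖θ - θ₀‖ ≤ 1 := by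
      rwa [le_div_iff₀ (by positivity), mul_comm] at hv
    have hT := hx.taylor hf hd (v := θ - θ₀) hd.center_mem (by rwa [add_sub_cancel])
    rw [add_sub_cancel] at hT
    have h1 := (abs_le.1 hT).1
    have h2 := (abs_le.1 (hx.score (θ - θ₀))).1
    have h3 := (abs_le.1 (hx.hess (θ - θ₀))).1
    have hv0 := norm_nonneg (θ - θ₀)
    have hu0 : 0 ≤ √n * ‖θ - θ₀‖ := by positivity
    have g1 : c * √n * ‖θ - θ₀‖ ≤ c := by
      calc c * √n * ‖θ - θ₀‖ = c * (√n * ‖θ - θ₀‖) := by ring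
        _ ≤ c * 1 := by gcongr
        _ = c := mul_one c
    have g2 : n * ‖θ - θ₀‖ ^ 2 ≤ 1 := by
      calc (n : ℝ) * ‖θ - θ₀‖ ^ 2 = (√n * ‖θ - θ₀‖) ^ 2 := by
            rw [mul_pow, sq (√(n : ℝ)), ← hsq]
        _ ≤ 1 := pow_le_one₀ hu0 hv1
    have g2' : n * fisherForm f θ₀ (θ - θ₀) ≤ |c₂| := by
      calc n * fisherForm f θ₀ (θ - θ₀) ≤ n * (|c₂| * ‖θ - θ₀‖ ^ 2) := by
            gcongr
            exact (hform _).trans (by gcongr; exact le_abs_self _)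
        _ = |c₂| * (n * ‖θ - θ₀‖ ^ 2) := by ring
        _ ≤ |c₂| * 1 := by gcongr
        _ = _ := mul_one _
    have hvone : ‖θ - θ₀‖ ≤ 1 := by nlinarith
    have g3 : c * √n * ‖θ - θ₀‖ ^ 2 ≤ c := by
      calc c * √n * ‖θ - θ₀‖ ^ 2 = c * √n * ‖θ - θ₀‖ * ‖θ - θ₀‖ := by ring
        _ ≤ c * 1 := by gcongr
        _ = c := mul_one c
    have g4 : c * n * ‖θ - θ₀‖ ^ 3 ≤ c := by
      calc c * n * ‖θ - θ₀‖ ^ 3 = c * (n * ‖θ - θ₀‖ ^ 2) * ‖θ - θ₀‖ := by ring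
        _ ≤ c * 1 * 1 := by gcongr
        _ = c := by ring
    have hlog : -K ≤ Real.log (lik f x θ) - Real.log (lik f x θ₀) := by
      rw [hK]; linarith
    have hp0 := hx.pos
    have hpθ := hx.lik_pos hf h₀ (hd.subset hθδ)
    have : Real.exp (-K) * lik f x θ₀ ≤ lik f x θ := by
      calc Real.exp (-K) * lik f x θ₀ ≤
            Real.exp (Real.log (lik f x θ) - Real.log (lik f x θ₀)) * lik f x θ₀ := by gcongr
        _ = lik f x θ := by
            rw [Real.exp_sub, Real.exp_log hpθ, Real.exp_log hp0]; field_simp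
    exact mul_le_mul this (hab θ (hBρ hθ)).1 ha.le hpθ.le
  have hint := integrableOn_lik_mul hΘ hf hπ hsmooth x
  calc Real.exp (-K) * a * vol / √n ^ p * lik f x θ₀
      = ∫ _ in B, Real.exp (-K) * lik f x θ₀ * a := by
        rw [setIntegral_const, smul_eq_mul, hB, volume_real_ball _ (by positivity), ← hvol,
          one_div, inv_pow]
        field_simp
    _ ≤ ∫ θ in B, lik f x θ * π θ :=
        setIntegral_mono_on (integrableOn_const measure_ball_lt_top.ne)
          (hint.mono_set (hBδ.trans hd.subset)) measurableSet_ball hlow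
    _ ≤ ∫ θ in Θ, lik f x θ * π θ := by
        refine setIntegral_mono_set hint ?_ (hBδ.trans hd.subset).eventuallyLE
        filter_upwards [self_mem_ae_restrict hΘ.measurableSet] with θ hθ
        exact mul_nonneg (hf.lik_nonneg hθ x) (hπ.nonneg θ hθ)

end

/-! ### Hellinger distances -/

section

variable {f : 𝒳 → Param p → ℝ} {Θ : Set (Param p)} {θ₀ : Param p} {π : Param p → ℝ}
  {δ : ℝ} {F M : 𝒳 → ℝ}

/-- The squared Hellinger distance of `f · θ` and `f · t` (without a factor `1 / 2`). -/
def hellingerSq (f : 𝒳 → Param p → ℝ) (θ t : Param p) : ℝ := ∑' x, (√(f x θ) - √(f x t)) ^ 2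

theorem hasSum_hellingerSq (hf : IsModel f Θ) {θ t : Param p} (hθ : θ ∈ Θ) (ht : t ∈ Θ) :
    HasSum (fun x => (√(f x θ) - √(f x t)) ^ 2) (hellingerSq f θ t) := by
  refine (Summable.of_nonneg_of_le (fun x => sq_nonneg _) (fun x => ?_)
    ((hf.hasSum_one θ hθ).add (hf.hasSum_one t ht)).summable).hasSum
  have h1 := Real.sq_sqrt (hf.nonneg x θ hθ)
  have h2 := Real.sq_sqrt (hf.nonneg x t ht)
  nlinarith [mul_nonneg (Real.sqrt_nonneg (f x θ)) (Real.sqrt_nonneg (f x t))]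

theorem hasSum_affinity (hf : IsModel f Θ) {θ t : Param p} (hθ : θ ∈ Θ) (ht : t ∈ Θ) :
    HasSum (fun x => √(f x θ) * √(f x t)) (1 - hellingerSq f θ t / 2) := by
  have h := (((hf.hasSum_one θ hθ).add (hf.hasSum_one t ht)).sub
    (hasSum_hellingerSq hf hθ ht)).div_const 2
  rw [show (1 + 1 - hellingerSq f θ t) / 2 = 1 - hellingerSq f θ t / 2 by ring] at h
  refine h.congr_fun fun x => ?_
  have h1 := Real.sq_sqrt (hf.nonneg x θ hθ)
  have h2 := Real.sq_sqrt (hf.nonneg x t ht)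
  nlinarith

/-- Finitely many observations carry at least half of the information at `θ₀`, uniformly in all
directions. -/
theorem DomBall.exists_finset_form_le (hf : IsModel f Θ) (hd : DomBall f Θ θ₀ δ F M) {c₁ : ℝ}
    (hc₁ : 0 < c₁) (hform : ∀ v, c₁ * ‖v‖ ^ 2 ≤ fisherForm f θ₀ v) :
    ∃ S : Finset 𝒳, ∀ v, c₁ / 2 * ‖v‖ ^ 2 ≤ ∑ x ∈ S, f x θ₀ * dlog f 1 x θ₀ v ^ 2 := by
  have hs : Summable fun x => F x * M x ^ 2 := hd.summable_of_abs_le 1 fun x => by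
    rw [abs_of_nonneg (mul_nonneg (hd.F_nonneg x) (sq_nonneg _)), one_mul]
    exact hd.mul_pow_le x (by norm_num)
  obtain ⟨S, hS⟩ := (hs.hasSum.eventually_const_lt
    (show (∑' x, F x * M x ^ 2) - c₁ / 2 < ∑' x, F x * M x ^ 2 by linarith)).exists
  refine ⟨S, fun v => ?_⟩
  have hsum := (hs.hasSum.mul_right (‖v‖ ^ 2)).sub (hd.hasSum_fisherForm hf hd.center_mem v)
  have hle := sum_le_hasSum S (fun x _ => ?_) hsum
  · rw [Finset.sum_sub_distrib, ← Finset.sum_mul] at hle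
    have := hform v
    have h3 : ((∑' x, F x * M x ^ 2) - c₁ / 2) * ‖v‖ ^ 2 ≤ (∑ x ∈ S, F x * M x ^ 2) * ‖v‖ ^ 2 := by
      gcongr
    linarith
  · have h1 := hd.abs_dlog_le (x := x) hd.center_mem (k := 1) (by norm_num) (by norm_num) v
    have hF := hd.F_nonneg x
    have hM := hd.M_nonneg x
    rw [sub_nonneg]
    calc f x θ₀ * dlog f 1 x θ₀ v ^ 2 = f x θ₀ * |dlog f 1 x θ₀ v| ^ 2 := by rw [sq_abs]
      _ ≤ F x * (M x * ‖v‖ ^ 1) ^ 2 := by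
          gcongr
          exact hd.le x _ hd.center_mem
      _ = _ := by ring

theorem DomBall.eventually_sqrt_sub (hf : IsModel f Θ) (hd : DomBall f Θ θ₀ δ F M) (x : 𝒳) {ε : ℝ}
    (hε : 0 < ε) : ∀ᶠ z in 𝓝 (θ₀, θ₀),
      |√(f x z.1) - √(f x z.2) - √(f x θ₀) / 2 * dlog f 1 x θ₀ (z.1 - z.2)| ≤
        ε * ‖z.1 - z.2‖ := by
  have hball : ∀ᶠ z in 𝓝 (θ₀, θ₀), z.1 ∈ Metric.ball θ₀ δ ∧ z.2 ∈ Metric.ball θ₀ δ :=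
    (Metric.isOpen_ball.prod Metric.isOpen_ball).mem_nhds ⟨hd.center_mem, hd.center_mem⟩
  rcases hf.pos_or_eq_zero x with hpos | h0
  · have hst : HasStrictFDerivAt (fun η => Real.log (f x η)) _ θ₀ :=
      (hd.smooth x θ₀ hd.center_mem).hasStrictFDerivAt (by norm_num)
    have h := (hst.mul_const (1 / 2)).exp.isLittleO.def hε
    filter_upwards [h, hball] with z hz hzb
    have e : ∀ θ ∈ Metric.ball θ₀ δ, Real.exp (Real.log (f x θ) * (1 / 2)) = √(f x θ) :=
      fun θ hθ => by
        rw [Real.sqrt_eq_rpow, Real.rpow_def_of_pos (hpos θ (hd.subset hθ))]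
    rw [e _ hzb.1, e _ hzb.2, e _ hd.center_mem, Real.norm_eq_abs] at hz
    convert hz using 2
    simp [dlog_one]
    ring
  · filter_upwards [hball] with z hz
    rw [h0 _ (hd.subset hz.1), h0 _ (hd.subset hz.2), h0 _ (hd.subset hd.center_mem)]
    simp
    positivity

/-- Near `θ₀` the Hellinger distance is bounded below by the Euclidean distance: this holds already
for the finitely many observations that carry most of the information. -/
theorem DomBall.eventually_le_hellingerSq (hf : IsModel f Θ) (hd : DomBall f Θ θ₀ δ F M) {c₁ : ℝ}
    (hc₁ : 0 < c₁) (hform : ∀ v, c₁ * ‖v‖ ^ 2 ≤ fisherForm f θ₀ v) :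
    ∀ᶠ z in 𝓝 (θ₀, θ₀), c₁ / 32 * ‖z.1 - z.2‖ ^ 2 ≤ hellingerSq f z.1 z.2 := by
  obtain ⟨S, hS⟩ := hd.exists_finset_form_le hf hc₁ hform
  set ε := √(c₁ / (32 * (S.card + 1))) with hε
  have hεpos : 0 < ε := Real.sqrt_pos.2 (by positivity)
  have hεsq : ε ^ 2 = c₁ / (32 * (S.card + 1)) := Real.sq_sqrt (by positivity)
  have hball : ∀ᶠ z in 𝓝 (θ₀, θ₀), z.1 ∈ Metric.ball θ₀ δ ∧ z.2 ∈ Metric.ball θ₀ δ :=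
    (Metric.isOpen_ball.prod Metric.isOpen_ball).mem_nhds ⟨hd.center_mem, hd.center_mem⟩
  have hall : ∀ᶠ z in 𝓝 (θ₀, θ₀), ∀ x ∈ S,
      |√(f x z.1) - √(f x z.2) - √(f x θ₀) / 2 * dlog f 1 x θ₀ (z.1 - z.2)| ≤
        ε * ‖z.1 - z.2‖ :=
    (Filter.eventually_all_finset S).2 fun x _ => hd.eventually_sqrt_sub hf x hεpos
  filter_upwards [hall, hball] with z hz hzb
  set v := z.1 - z.2
  have hle := sum_le_hasSum S (fun x _ => sq_nonneg _)
    (hasSum_hellingerSq hf (hd.subset hzb.1) (hd.subset hzb.2))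
  have hterm : ∀ x ∈ S, f x θ₀ * dlog f 1 x θ₀ v ^ 2 / 8 - ε ^ 2 * ‖v‖ ^ 2 ≤
      (√(f x z.1) - √(f x z.2)) ^ 2 := fun x hx => by
    have h1 := sq_le_sq' (abs_le.1 (hz x hx)).1 (abs_le.1 (hz x hx)).2
    have h2 := Real.sq_sqrt (hf.nonneg x θ₀ (hd.subset hd.center_mem))
    set A := √(f x z.1) - √(f x z.2)
    set B := √(f x θ₀) / 2 * dlog f 1 x θ₀ v with hB
    have h3 : B ^ 2 = f x θ₀ * dlog f 1 x θ₀ v ^ 2 / 4 := by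
      rw [hB, mul_pow, div_pow, h2]; ring
    nlinarith [sq_nonneg (2 * A - B)]
  have h4 := (Finset.sum_le_sum hterm).trans hle
  rw [Finset.sum_sub_distrib, ← Finset.sum_div, Finset.sum_const, nsmul_eq_mul] at h4
  have h5 : S.card * (ε ^ 2 * ‖v‖ ^ 2) ≤ c₁ / 32 * ‖v‖ ^ 2 := by
    rw [← mul_assoc]
    gcongr
    rw [hεsq, mul_div_assoc', div_le_div_iff₀ (by positivity) (by norm_num)]
    nlinarith
  have := hS v
  linarith

theorem DomBall.hellingerSq_le (hf : IsModel f Θ) (hd : DomBall f Θ θ₀ δ F M) {θ t : Param p}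
    (hθ : θ ∈ Metric.ball θ₀ δ) (ht : t ∈ Metric.ball θ₀ δ) :
    hellingerSq f θ t ≤ envMass F M * ‖θ - t‖ ^ 2 := by
  have := hd.abs_tsum_le (g := fun x => (√(f x θ) - √(f x t)) ^ 2) (c := ‖θ - t‖ ^ 2) fun x => by
    have hF := hd.F_nonneg x
    rw [abs_pow]
    calc |√(f x θ) - √(f x t)| ^ 2 ≤ (√(F x) * M x * ‖θ - t‖) ^ 2 := by
          gcongr; exact hd.abs_sqrt_sub_le hf hθ ht
      _ = ‖θ - t‖ ^ 2 * (F x * M x ^ 2) := by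
          rw [mul_pow, mul_pow, Real.sq_sqrt hF]; ring
      _ ≤ _ := by
          gcongr ?_ * ?_
          exact hd.mul_pow_le x (by norm_num)
  rw [mul_comm]
  exact (le_abs_self _).trans this

/-- Distributions that are far in total variation are far in the Hellinger distance. -/
theorem sq_le_hellingerSq (hf : IsModel f Θ) {θ t : Param p} (hθ : θ ∈ Θ) (ht : t ∈ Θ) {ε : ℝ}
    (hε : 0 < ε) (h : ε ≤ ∑' x, |f x θ - f x t|) : ε ^ 2 / 4 ≤ hellingerSq f θ t := by
  have hb := ((hasSum_hellingerSq hf hθ ht).mul_left (2 / ε)).add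
    (((hf.hasSum_one θ hθ).add (hf.hasSum_one t ht)).mul_left (ε / 4))
  have hle : ∀ x, ‖|f x θ - f x t|‖ ≤
      2 / ε * (√(f x θ) - √(f x t)) ^ 2 + ε / 4 * (f x θ + f x t) := fun x => by
    have h1 := Real.sq_sqrt (hf.nonneg x θ hθ)
    have h2 := Real.sq_sqrt (hf.nonneg x t ht)
    set a := √(f x θ)
    set b := √(f x t)
    rw [← h1, ← h2, Real.norm_eq_abs, abs_abs, show a ^ 2 - b ^ 2 = (a - b) * (a + b) by ring,
      abs_mul, abs_of_nonneg (show 0 ≤ a + b by positivity)]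
    have h3 : 2 / ε * (a - b) ^ 2 + ε / 4 * (a ^ 2 + b ^ 2) - |a - b| * (a + b) =
        2 / ε * (|a - b| - ε / 4 * (a + b)) ^ 2 + ε / 8 * (a - b) ^ 2 := by
      rw [← sq_abs (a - b)]
      have : |a - b| ^ 2 = a ^ 2 - 2 * a * b + b ^ 2 := by rw [sq_abs]; ring
      field_simp
      nlinarith
    have : 0 ≤ 2 / ε * (|a - b| - ε / 4 * (a + b)) ^ 2 + ε / 8 * (a - b) ^ 2 := by positivity
    linarith
  have := tsum_of_norm_bounded hb hle
  rw [Real.norm_eq_abs] at this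
  have h2 := h.trans ((le_abs_self _).trans this)
  have h3 : ε / 2 ≤ 2 / ε * hellingerSq f θ t := by linarith
  rw [div_mul_eq_mul_div, le_div_iff₀ hε] at h3
  linarith

theorem hellingerSq_le_add (hf : IsModel f Θ) {θ t s : Param p} (hθ : θ ∈ Θ) (ht : t ∈ Θ)
    (hs : s ∈ Θ) : hellingerSq f θ s ≤ 2 * hellingerSq f θ t + 2 * hellingerSq f t s := by
  refine hasSum_le (fun x => ?_) (hasSum_hellingerSq hf hθ hs)
    (((hasSum_hellingerSq hf hθ ht).mul_left 2).add ((hasSum_hellingerSq hf ht hs).mul_left 2))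
  nlinarith [sq_nonneg ((√(f x θ) - √(f x t)) - (√(f x t) - √(f x s)))]

/-- Global Hellinger separation: the local bound comes from the Fisher information, the bound away
from `θ₀` from identifiability. -/
theorem DomBall.exists_le_hellingerSq (hf : IsModel f Θ) (hd : DomBall f Θ θ₀ δ F M) {c₁ : ℝ}
    (hc₁ : 0 < c₁) (hform : ∀ v, c₁ * ‖v‖ ^ 2 ≤ fisherForm f θ₀ v)
    (hident : IdentifiableAt f Θ θ₀) :
    ∃ c > 0, ∃ ρ > 0, ∀ t ∈ Metric.ball θ₀ ρ, ∀ θ ∈ Θ,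
      c * min (‖θ - t‖ ^ 2) 1 ≤ hellingerSq f θ t := by
  obtain ⟨ρ, hρ, hnear⟩ := Metric.eventually_nhds_iff_ball.1
    (hd.eventually_le_hellingerSq hf hc₁ hform)
  obtain ⟨ε, hε, hfar⟩ := hident _ (Metric.ball_mem_nhds θ₀ hρ)
  have hE := hd.envMass_nonneg
  set r := ε / (4 * (envMass F M + 1)) with hr
  have hr0 : 0 < r := by positivity
  refine ⟨min (c₁ / 32) (ε ^ 2 / 16), by positivity, min ρ (min δ r), by
    have := hd.pos; positivity, fun t ht θ hθ => ?_⟩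
  have htρ : t ∈ Metric.ball θ₀ ρ := Metric.ball_subset_ball (min_le_left _ _) ht
  have htδ : t ∈ Metric.ball θ₀ δ :=
    Metric.ball_subset_ball ((min_le_right _ _).trans (min_le_left _ _)) ht
  have htr : ‖t - θ₀‖ < r := mem_ball_iff_norm.1
    (Metric.ball_subset_ball ((min_le_right _ _).trans (min_le_right _ _)) ht)
  by_cases hin : θ ∈ Metric.ball θ₀ ρ
  · refine le_trans ?_ (hnear (θ, t) (by
      rw [← ball_prod_same]; exact ⟨hin, htρ⟩))
    gcongr
    · exact min_le_left _ _
    · exact min_le_left _ _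
  · have h0 := hd.subset hd.center_mem
    have h1 := sq_le_hellingerSq hf hθ h0 hε (hfar θ hθ hin)
    have h2 := hellingerSq_le_add hf hθ (hd.subset htδ) h0
    have h3 := hd.hellingerSq_le hf htδ hd.center_mem
    have h4 : envMass F M * ‖t - θ₀‖ ^ 2 ≤ ε ^ 2 / 16 := by
      calc envMass F M * ‖t - θ₀‖ ^ 2 ≤ (envMass F M + 1) ^ 2 * r ^ 2 := by
            gcongr; nlinarith
        _ = ε ^ 2 / 16 := by rw [hr]; field_simp; norm_num
    calc _ ≤ ε ^ 2 / 16 * 1 := by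
          gcongr
          · exact min_le_right _ _
          · exact min_le_right _ _
      _ ≤ _ := by linarith

/-! ### The marginal probability of an estimate near `θ₀` -/

theorem lik_le_prod_sqrt (hf : IsModel f Θ) {θ t : Param p} (hθ : θ ∈ Θ) (ht : t ∈ Θ)
    {x : Fin n → 𝒳} (h : lik f x θ ≤ lik f x t) :
    lik f x θ ≤ ∏ i, √(f (x i) θ) * √(f (x i) t) := by
  have e : ∀ s ∈ Θ, (∏ i, √(f (x i) s)) = √(lik f x s) := fun s hs =>
    (Real.sqrt_prod _ fun i _ => hf.nonneg _ s hs).symm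
  rw [Finset.prod_mul_distrib, e θ hθ, e t ht]
  calc lik f x θ = √(lik f x θ) * √(lik f x θ) := (Real.mul_self_sqrt (hf.lik_nonneg hθ x)).symm
    _ ≤ _ := by gcongr

/-- Data sets for which some parameter within `s` of a fixed `t'` is at least as likely as `θ` are
exponentially rare under `θ`, at a rate given by the Hellinger distance of `θ` and `t'`. -/
theorem DomBall.sum_lik_le_exp (hf : IsModel f Θ) (hd : DomBall f Θ θ₀ δ F M) {θ t' : Param p}
    (hθ : θ ∈ Θ) (ht' : t' ∈ Metric.ball θ₀ δ) {s : ℝ} (hs : 0 ≤ s) (G : Finset (Fin n → 𝒳))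
    (hG : ∀ x ∈ G, ∃ t ∈ Metric.ball θ₀ δ, ‖t - t'‖ ≤ s ∧ lik f x θ ≤ lik f x t) :
    ∑ x ∈ G, lik f x θ ≤
      Real.exp (n * (s * (1 + envMass F M) - hellingerSq f θ t' / 2)) := by
  have hE := hd.envMass_nonneg
  have hsum : Summable fun x => √(f x θ) * (√(F x) * M x) := by
    refine Summable.of_nonneg_of_le (fun x => ?_) (fun x => ?_)
      ((hf.hasSum_one θ hθ).summable.add hd.summable)
    · have := hd.M_nonneg x; positivity
    · have h1 := Real.sq_sqrt (hf.nonneg x θ hθ)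
      have h2 := Real.sq_sqrt (hd.F_nonneg x)
      have h3 := hd.mul_pow_le x (k := 2) (by norm_num)
      have := hd.M_nonneg x
      nlinarith [sq_nonneg (√(f x θ) - √(F x) * M x), sq_nonneg (√(f x θ)),
        sq_nonneg (√(F x) * M x)]
  have hsum_le : ∑' x, √(f x θ) * (√(F x) * M x) ≤ 1 + envMass F M := by
    refine hasSum_le (fun x => ?_) hsum.hasSum
      ((hf.hasSum_one θ hθ).add hd.summable.hasSum)
    have h1 := Real.sq_sqrt (hf.nonneg x θ hθ)
    have h2 := Real.sq_sqrt (hd.F_nonneg x)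
    have h3 := hd.mul_pow_le x (k := 2) (by norm_num)
    have := hd.M_nonneg x
    nlinarith [sq_nonneg (√(f x θ) - √(F x) * M x), sq_nonneg (√(f x θ)),
      sq_nonneg (√(F x) * M x)]
  set a : 𝒳 → ℝ := fun x => √(f x θ) * √(f x t') + s * (√(f x θ) * (√(F x) * M x)) with ha
  have ha0 : ∀ x, 0 ≤ a x := fun x => by
    have := hd.M_nonneg x
    simp only [ha]; positivity
  have hA := (hasSum_affinity hf hθ (hd.subset ht')).add (hsum.hasSum.mul_left s)
  set A := 1 - hellingerSq f θ t' / 2 + s * ∑' x, √(f x θ) * (√(F x) * M x) with hAdef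
  have hprod := hasSum_prod_apply ha0 hA n
  have hA0 : 0 ≤ A := hA.nonneg ha0
  calc ∑ x ∈ G, lik f x θ ≤ ∑ x ∈ G, ∏ i, a (x i) := by
        refine Finset.sum_le_sum fun x hx => ?_
        obtain ⟨t, ht, hts, hle⟩ := hG x hx
        refine (lik_le_prod_sqrt hf hθ (hd.subset ht) hle).trans ?_
        refine Finset.prod_le_prod (fun i _ => by positivity) fun i _ => ?_
        have h1 := (abs_le.1 (hd.abs_sqrt_sub_le (x := x i) hf ht ht')).2
        have h2 : √(F (x i)) * M (x i) * ‖t - t'‖ ≤ √(F (x i)) * M (x i) * s := by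
          have := hd.M_nonneg (x i)
          gcongr
        calc √(f (x i) θ) * √(f (x i) t)
            ≤ √(f (x i) θ) * (√(f (x i) t') + √(F (x i)) * M (x i) * s) := by
              gcongr; linarith
          _ = a (x i) := by simp only [ha]; ring
    _ ≤ A ^ n := sum_le_hasSum G (fun x _ => Finset.prod_nonneg fun i _ => ha0 _) hprod
    _ ≤ (Real.exp (s * (1 + envMass F M) - hellingerSq f θ t' / 2)) ^ n := by
        gcongr
        have h1 := Real.add_one_le_exp (s * (1 + envMass F M) - hellingerSq f θ t' / 2)
        have h2 : s * ∑' x, √(f x θ) * (√(F x) * M x) ≤ s * (1 + envMass F M) := by gcongr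
        rw [hAdef]
        linarith
    _ = _ := by rw [← Real.exp_nat_mul]

end

section

variable {f : 𝒳 → Param p → ℝ} {Θ : Set (Param p)} {θ₀ : Param p} {π : Param p → ℝ}
  {δ : ℝ} {F M : 𝒳 → ℝ}

/-- The index of the cube of side `s` that contains `t`, in a cubical grid centred at `θ₀`. -/
def gridIndex (θ₀ : Param p) (s : ℝ) (t : Param p) : Fin p → ℤ := fun a => ⌊(t a - θ₀ a) / s⌋

/-- Points in the same grid cube are at distance at most `√p s`, and `√p ≤ p`. -/
theorem norm_sub_le_of_gridIndex_eq {s : ℝ} (hs : 0 < s) {t t' : Param p}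
    (h : gridIndex θ₀ s t = gridIndex θ₀ s t') : ‖t - t'‖ ≤ p * s := by
  have hcoord : ∀ a, |(t - t') a| ≤ s := fun a => by
    have h1 := Int.abs_sub_lt_one_of_floor_eq_floor (congrFun h a)
    rw [← sub_div, sub_sub_sub_cancel_right, abs_div, abs_of_pos hs, div_lt_one hs] at h1
    exact h1.le
  rw [EuclideanSpace.norm_eq]
  apply Real.sqrt_le_iff.2 ⟨by positivity, ?_⟩
  calc ∑ a, ‖(t - t') a‖ ^ 2 ≤ ∑ _a : Fin p, s ^ 2 := by
        gcongr with a _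
        exact hcoord a
    _ = p * s ^ 2 := by simp
    _ ≤ (p * s) ^ 2 := by
        rw [mul_pow]
        gcongr
        have : (p : ℝ) ≤ (p : ℝ) * p := by exact_mod_cast Nat.le_mul_self p
        rwa [sq]

theorem gridIndex_mem {s b : ℝ} (hs : 0 < s) {t : Param p} (ht : ‖t - θ₀‖ ≤ b) {m : ℕ}
    (hm : b / s ≤ m) :
    gridIndex θ₀ s t ∈ Fintype.piFinset fun _ : Fin p => Finset.Icc (-(m : ℤ)) m := by
  refine Fintype.mem_piFinset.2 fun a => ?_
  have h1 : |(t - θ₀) a| ≤ b := (abs_apply_le_norm _ a).trans ht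
  have h2 : |(t a - θ₀ a) / s| ≤ m := by
    rw [abs_div, abs_of_pos hs]
    refine le_trans ?_ hm
    gcongr
    exact h1
  rw [abs_le] at h2
  rw [Finset.mem_Icc]
  constructor
  · rw [gridIndex, Int.le_floor]
    push_cast
    exact h2.1
  · have := (Int.floor_le ((t a - θ₀ a) / s)).trans h2.2
    rw [← Int.cast_le (R := ℝ), Int.cast_natCast]
    exact this

/-- Data sets with an estimate within `b` of `θ₀` are exponentially rare under every parameter `θ`
at distance at least `2 b` from `θ₀`: a union bound over a grid of mesh `1 / n`. -/
theorem DomBall.sum_lik_le_of_mle_near (hf : IsModel f Θ) (hd : DomBall f Θ θ₀ δ F M)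
    {c ρ : ℝ} (hc : 0 < c) (hρ : ρ ≤ δ)
    (hH : ∀ t ∈ Metric.ball θ₀ ρ, ∀ θ ∈ Θ, c * min (‖θ - t‖ ^ 2) 1 ≤ hellingerSq f θ t)
    (hn : 0 < n) {b : ℝ} (hb0 : 0 < b) (hb1 : b ≤ 1) (hbρ : b < ρ) {θ : Param p} (hθ : θ ∈ Θ)
    (hfar : 2 * b ≤ ‖θ - θ₀‖) (G : Finset (Fin n → 𝒳))
    (hG : ∀ x ∈ G, ∃ t, IsMLE f Θ x t ∧ ‖t - θ₀‖ ≤ b) :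
    ∑ x ∈ G, lik f x θ ≤ ((2 * p + 5) * n) ^ p *
      Real.exp (1 + envMass F M - c / 2 * (n * b ^ 2)) := by
  classical
  have hn' : (1 : ℝ) ≤ n := by exact_mod_cast hn
  choose! t ht htb using hG
  set s : ℝ := 1 / ((p + 1) * n) with hs
  have hs0 : 0 < s := by positivity
  set m := ⌈b / s⌉₊ with hm
  set I := Fintype.piFinset fun _ : Fin p => Finset.Icc (-(m : ℤ)) m with hI
  have hmem : ∀ x ∈ G, gridIndex θ₀ s (t x) ∈ I := fun x hx =>
    gridIndex_mem hs0 (htb x hx) (Nat.le_ceil _)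
  have hball : ∀ x ∈ G, t x ∈ Metric.ball θ₀ ρ := fun x hx => by
    rw [mem_ball_iff_norm]; exact (htb x hx).trans_lt hbρ
  rw [← Finset.sum_fiberwise_of_maps_to hmem]
  -- the estimate `t y` of one data set in the grid cube represents the cube
  have hcell : ∀ k ∈ I, ∑ x ∈ G with gridIndex θ₀ s (t x) = k, lik f x θ ≤
      Real.exp (1 + envMass F M - c / 2 * (n * b ^ 2)) := fun k _ => by
    rcases (G.filter fun x => gridIndex θ₀ s (t x) = k).eq_empty_or_nonempty with h0 | ⟨y, hy⟩
    · rw [h0, Finset.sum_empty]; positivity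
    · rw [Finset.mem_filter] at hy
      have hsn : p * s ≤ 1 / n := by
        rw [hs, mul_one_div, div_le_div_iff₀ (by positivity) (by positivity)]
        nlinarith
      refine (hd.sum_lik_le_exp hf hθ (t' := t y) (s := 1 / n)
        (Metric.ball_subset_ball hρ (hball y hy.1)) (by positivity) _ fun x hx => ?_).trans ?_
      · rw [Finset.mem_filter] at hx
        refine ⟨t x, Metric.ball_subset_ball hρ (hball x hx.1), ?_, (ht x hx.1).2 θ hθ⟩
        exact (norm_sub_le_of_gridIndex_eq hs0 (hx.2.trans hy.2.symm)).trans hsn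
      · have h1 := hH _ (hball y hy.1) θ hθ
        have h2 : b ≤ ‖θ - t y‖ := by
          have := norm_sub_le_norm_sub_add_norm_sub θ (t y) θ₀
          have := htb y hy.1
          linarith
        have h3 : b ^ 2 ≤ min (‖θ - t y‖ ^ 2) 1 := by
          refine le_min (by gcongr) (pow_le_one₀ hb0.le hb1)
        have h4 : c * b ^ 2 ≤ hellingerSq f θ (t y) := le_trans (by gcongr) h1
        gcongr
        have h5 : (n : ℝ) * (1 / n * (1 + envMass F M) - hellingerSq f θ (t y) / 2) =
            1 + envMass F M - n * (hellingerSq f θ (t y)) / 2 := by field_simp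
        rw [h5]
        have : (n : ℝ) * (c * b ^ 2) ≤ n * hellingerSq f θ (t y) := by gcongr
        linarith
  refine (Finset.sum_le_sum hcell).trans ?_
  rw [Finset.sum_const, nsmul_eq_mul]
  gcongr
  have hcard : I.card = (2 * m + 1) ^ p := by
    rw [hI, Fintype.card_piFinset]
    simp only [Int.card_Icc, Finset.prod_const, Finset.card_univ, Fintype.card_fin]
    congr 1
    omega
  rw [hcard]
  push_cast
  gcongr
  have hm1 : (m : ℝ) < b / s + 1 := Nat.ceil_lt_add_one (by positivity)
  have hbs : b / s = b * ((p + 1) * n) := by rw [hs]; field_simp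
  have : b * ((p + 1) * n) ≤ 1 * ((p + 1) * n) := by gcongr
  rw [hbs] at hm1
  nlinarith

/-- The radius `A log n / √n` of the neighbourhoods of `θ₀` in which cells compete. -/
def locRadius (A : ℝ) (n : ℕ) : ℝ := A * Real.log n / √n

theorem tendsto_log_div_sqrt_pow (k : ℕ) :
    Tendsto (fun n : ℕ => Real.log n ^ k / √(n : ℝ)) atTop (𝓝 0) := by
  have h := (isLittleO_log_rpow_rpow_atTop (k : ℝ) (show (0 : ℝ) < 1 / 2 by norm_num)).tendsto_div_nhds_zero
  have := h.comp (tendsto_natCast_atTop_atTop (R := ℝ))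
  simpa [Function.comp_def, Real.sqrt_eq_rpow] using this

theorem tendsto_locRadius (A : ℝ) : Tendsto (locRadius A) atTop (𝓝 0) := by
  have h := (tendsto_log_div_sqrt_pow 1).const_mul A
  have e : locRadius A = fun n : ℕ => A * (Real.log n ^ 1 / √(n : ℝ)) := by
    funext n
    rw [locRadius, pow_one, mul_div_assoc]
  rw [e]
  simpa only [mul_zero] using h

theorem tendsto_log_natCast : Tendsto (fun n : ℕ => Real.log n) atTop atTop :=
  Real.tendsto_log_atTop.comp tendsto_natCast_atTop_atTop

/-- Polynomial factors are negligible against `exp (-c (log n)²)`. -/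
theorem eventually_mul_exp_log_sq_le (k : ℕ) (K : ℝ) {c : ℝ} (hc : 0 < c) :
    ∀ᶠ n : ℕ in atTop, K * (n : ℝ) ^ k * Real.exp (-(c * Real.log n ^ 2)) ≤ 1 := by
  have h1 : ∀ᶠ n : ℕ in atTop, (k + 1 : ℝ) / c ≤ Real.log n :=
    tendsto_log_natCast.eventually_ge_atTop _
  have h2 : ∀ᶠ n : ℕ in atTop, |K| ≤ (n : ℝ) :=
    (tendsto_natCast_atTop_atTop (R := ℝ)).eventually_ge_atTop _
  filter_upwards [h1, h2, eventually_gt_atTop 0] with n hn1 hn2 hn0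
  have hn' : (0 : ℝ) < n := by exact_mod_cast hn0
  have hl : 0 ≤ Real.log n := Real.log_nonneg (by exact_mod_cast hn0)
  rw [div_le_iff₀ hc] at hn1
  have h3 : Real.exp (-(c * Real.log n ^ 2)) ≤ ((n : ℝ) ^ (k + 1))⁻¹ := by
    rw [← Real.exp_log (show (0 : ℝ) < ((n : ℝ) ^ (k + 1))⁻¹ by positivity), Real.log_inv,
      Real.log_pow]
    apply Real.exp_le_exp.2
    push_cast
    nlinarith
  calc K * (n : ℝ) ^ k * Real.exp (-(c * Real.log n ^ 2))
      ≤ n * (n : ℝ) ^ k * ((n : ℝ) ^ (k + 1))⁻¹ := by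
        gcongr
        exact (le_abs_self K).trans hn2
    _ = 1 := by rw [pow_succ]; field_simp

/-- The marginal probability of an estimate within `A log n / √n` of `θ₀` is at most of the order
`(log n / √n) ^ p`. -/
theorem exists_sum_marginal_le (hΘ : IsOpen Θ) (hf : IsModel f Θ) (hπ : IsPrior π Θ θ₀)
    (hsmooth : ∀ x, ContDiffOn ℝ 3 (fun θ => Real.log (f x θ)) Θ)
    (hd : DomBall f Θ θ₀ δ F M) {c₁ : ℝ} (hc₁ : 0 < c₁)
    (hform : ∀ v, c₁ * ‖v‖ ^ 2 ≤ fisherForm f θ₀ v) (hident : IdentifiableAt f Θ θ₀)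
    {A : ℝ} (hA : 0 < A) :
    ∃ K > 0, ∀ᶠ n : ℕ in atTop, ∀ G : Finset (Fin n → 𝒳),
      (∀ x ∈ G, ∃ t, IsMLE f Θ x t ∧ ‖t - θ₀‖ ≤ locRadius A n) →
      ∑ x ∈ G, marginal f Θ π x ≤ K * Real.log n ^ p / √n ^ p := by
  obtain ⟨c, hc, ρ, hρ, hH⟩ := hd.exists_le_hellingerSq hf hc₁ hform hident
  obtain ⟨ρ', hρ', a, ha, B, hab⟩ := hπ.exists_bounds
  have hB : 0 < B := by
    have := hab θ₀ (Metric.mem_ball_self hρ'); linarith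
  set vol := volume.real (Metric.ball (0 : Param p) 1) with hvol
  have hvol0 : 0 ≤ vol := measureReal_nonneg
  have hE := hd.envMass_nonneg
  have hr0 : 0 < min (min 1 (min ρ δ)) (min (ρ' / 2) (δ / 2)) := by
    have := hd.pos; positivity
  refine ⟨B * vol * (2 * A) ^ p + 1, by positivity, ?_⟩
  filter_upwards [(tendsto_locRadius A).eventually_lt_const hr0, eventually_gt_atTop 0,
    tendsto_log_natCast.eventually_ge_atTop 1,
    eventually_mul_exp_log_sq_le (2 * p) ((2 * p + 5) ^ p * Real.exp (1 + envMass F M))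
      (show 0 < c / 2 * A ^ 2 by positivity)] with n hrad hn0 hlog hexp G hG
  have hn1 : (1 : ℝ) ≤ n := by exact_mod_cast hn0
  have hs0 : 0 < √(n : ℝ) := Real.sqrt_pos.2 (by positivity)
  set b := locRadius A n with hb
  have hb0 : 0 < b := by rw [hb, locRadius]; positivity
  simp only [lt_min_iff] at hrad
  obtain ⟨⟨hb1, hbρ, hbδ⟩, hbρ', hbδ'⟩ := hrad
  set E := Real.exp (1 + envMass F M - c / 2 * (n * b ^ 2)) with hEdef
  -- parameters within `2 b` of `θ₀` contribute through the prior mass of the ball only; under the others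
  -- an estimate within `b` of `θ₀` is exponentially rare
  have hpt : ∀ θ ∈ Θ, (∑ x ∈ G, lik f x θ) * π θ ≤
      (Metric.ball θ₀ (2 * b)).indicator (fun _ => B) θ +
        ((2 * p + 5) * n) ^ p * E * π θ := fun θ hθ => by
    have hπ0 := hπ.nonneg θ hθ
    by_cases hin : θ ∈ Metric.ball θ₀ (2 * b)
    · rw [indicator_of_mem hin]
      have h1 := (hab θ (Metric.ball_subset_ball (by linarith) hin)).2
      have h2 : (∑ x ∈ G, lik f x θ) * π θ ≤ 1 * π θ := by
        gcongr; exact hf.sum_lik_le_one hθ G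
      have h3 : 0 ≤ ((2 * p + 5) * n) ^ p * E * π θ := by positivity
      linarith
    · rw [indicator_of_notMem hin, zero_add]
      gcongr
      refine hd.sum_lik_le_of_mle_near hf (ρ := min ρ δ) hc (min_le_right _ _)
        (fun t ht => hH t (Metric.ball_subset_ball (min_le_left _ _) ht)) hn0 hb0 hb1.le
        (lt_min hbρ hbδ) hθ ?_ G hG
      simpa [Metric.mem_ball, dist_eq_norm] using hin
  have hball : Metric.ball θ₀ (2 * b) ⊆ Θ :=
    (Metric.ball_subset_ball (by linarith)).trans hd.subset
  rw [sum_marginal hΘ hf hπ hsmooth]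
  have hi1 : IntegrableOn ((Metric.ball θ₀ (2 * b)).indicator fun _ => B) Θ :=
    ((integrableOn_const (measure_ball_lt_top.ne)).integrable_indicator
      measurableSet_ball).integrableOn
  have hi2 : IntegrableOn (fun θ => ((2 * p + 5) * n) ^ p * E * π θ) Θ :=
    hπ.integrable.const_mul _
  calc ∫ θ in Θ, (∑ x ∈ G, lik f x θ) * π θ
      ≤ ∫ θ in Θ, ((Metric.ball θ₀ (2 * b)).indicator (fun _ => B) θ +
        ((2 * p + 5) * n) ^ p * E * π θ) :=
        setIntegral_mono_on (integrableOn_sum_lik_mul hΘ hf hπ hsmooth G) (hi1.add hi2)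
          hΘ.measurableSet hpt
    _ = (2 * b) ^ p * vol * B + ((2 * p + 5) * n) ^ p * E := by
        rw [integral_add hi1 hi2, integral_const_mul, hπ.integral_one, mul_one,
          setIntegral_indicator measurableSet_ball, inter_eq_self_of_subset_right hball,
          setIntegral_const, volume_real_ball _ (by positivity), smul_eq_mul]
    _ ≤ (B * vol * (2 * A) ^ p) * Real.log n ^ p / √n ^ p + Real.log n ^ p / √n ^ p := by
        gcongr ?_ + ?_
        · rw [hb, locRadius, mul_pow, div_pow, mul_pow A, mul_pow 2 A]
          exact le_of_eq (by ring)
        · rw [le_div_iff₀ (by positivity)]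
          have hnb : (n : ℝ) * b ^ 2 = A ^ 2 * Real.log n ^ 2 := by
            rw [hb, locRadius, div_pow, Real.sq_sqrt (by positivity)]
            field_simp
          have h1 : E = Real.exp (1 + envMass F M) *
              Real.exp (-(c / 2 * A ^ 2 * Real.log n ^ 2)) := by
            rw [hEdef, hnb, ← Real.exp_add]; congr 1; ring
          have h2 : √(n : ℝ) ^ p ≤ (n : ℝ) ^ p := by
            gcongr
            rw [Real.sqrt_le_left (by positivity)]
            nlinarith
          calc ((2 * p + 5) * n) ^ p * E * √n ^ p ≤ ((2 * p + 5) * n) ^ p * E * n ^ p := by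
                gcongr
            _ = (2 * p + 5) ^ p * Real.exp (1 + envMass F M) * (n : ℝ) ^ (2 * p) *
                  Real.exp (-(c / 2 * A ^ 2 * Real.log n ^ 2)) := by
                rw [h1, mul_pow, two_mul p, pow_add]; ring
            _ ≤ 1 := hexp
            _ ≤ _ := one_le_pow₀ hlog
    _ = _ := by ring

end

/-! ### Consistency of the codepoints -/

section

variable {f : 𝒳 → Param p → ℝ} {Θ : Set (Param p)} {θ₀ : Param p} {π : Param p → ℝ}
  {δ : ℝ} {F M : 𝒳 → ℝ}

/-- Finitely many observations suffice to distinguish `θ₀` from all parameters whose distribution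
is far in total variation: one of their finitely many subsets is noticeably less likely. -/
theorem exists_finset_sum_le (hf : IsModel f Θ) (h₀ : θ₀ ∈ Θ) {ε : ℝ} (hε : 0 < ε) :
    ∃ S : Finset 𝒳, ∀ θ ∈ Θ, ε ≤ ∑' x, |f x θ - f x θ₀| →
      ∃ A ⊆ S, ∑ x ∈ A, f x θ ≤ ∑ x ∈ A, f x θ₀ - ε / 4 := by
  classical
  obtain ⟨S, hS⟩ := ((hf.hasSum_one θ₀ h₀).eventually_const_lt
    (show 1 - ε / 8 < 1 by linarith)).exists
  refine ⟨S, fun θ hθ hTV => ⟨S.filter fun x => f x θ ≤ f x θ₀, Finset.filter_subset _ _, ?_⟩⟩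
  have h1 := hf.hasSum_one θ hθ
  have h0 := hf.hasSum_one θ₀ h₀
  -- the positive part of `f x θ₀ - f x θ` carries half of the total variation
  have habs : Summable fun x => |f x θ - f x θ₀| := (h1.sub h0).summable.abs
  have hpos : HasSum (fun x => max (f x θ₀ - f x θ) 0) ((∑' x, |f x θ - f x θ₀|) / 2) := by
    have := (habs.hasSum.add (h0.sub h1)).div_const 2
    rw [sub_self, add_zero] at this
    refine this.congr_fun fun x => ?_
    rcases le_total (f x θ) (f x θ₀) with h | h
    · rw [max_eq_left (by linarith), abs_of_nonpos (by linarith)]; ring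
    · rw [max_eq_right (by linarith), abs_of_nonneg (by linarith)]; ring
  have hle := sum_le_hasSum S (fun x _ => ?_) (h0.sub hpos)
  · rw [Finset.sum_sub_distrib] at hle
    have h3 : ∑ x ∈ S, max (f x θ₀ - f x θ) 0 =
        ∑ x ∈ S with f x θ ≤ f x θ₀, (f x θ₀ - f x θ) := by
      rw [Finset.sum_filter]
      refine Finset.sum_congr rfl fun x _ => ?_
      split_ifs with h
      · exact max_eq_left (by linarith)
      · exact max_eq_right (by linarith)
    rw [h3, Finset.sum_sub_distrib] at hle
    linarith
  · have := hf.nonneg x θ hθ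
    have := hf.nonneg x θ₀ h₀
    rw [sub_nonneg]
    exact max_le (by linarith) (by linarith)

/-- Chernoff bound for the empirical frequency of a finite set of observations. -/
theorem sum_lik_le_exp_of_freq [DecidableEq 𝒳] (hf : IsModel f Θ) {θ : Param p} (hθ : θ ∈ Θ)
    (A : Finset 𝒳) {t : ℝ} (ht0 : 0 ≤ t) (ht1 : t ≤ 1) (G : Finset (Fin n → 𝒳))
    (hG : ∀ x ∈ G, n * (∑ y ∈ A, f y θ + t) ≤ ∑ i, if x i ∈ A then (1 : ℝ) else 0) :
    ∑ x ∈ G, lik f x θ ≤ Real.exp (-(t ^ 2 / 4) * n) := by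
  set a := ∑ y ∈ A, f y θ with ha
  have ha0 : 0 ≤ a := Finset.sum_nonneg fun y _ => hf.nonneg y θ hθ
  have ha1 : a ≤ 1 := sum_le_hasSum A (fun y _ => hf.nonneg y θ hθ) (hf.hasSum_one θ hθ)
  set l := t / 2 with hl
  have hfin := hasSum_sum_of_ne_finset_zero (s := A) (L := .unconditional _)
    (f := fun y => if y ∈ A then f y θ * (Real.exp l - 1) else 0) fun y hy => if_neg hy
  have hsum := (hf.hasSum_one θ hθ).add hfin
  have e : ∑ y ∈ A, (if y ∈ A then f y θ * (Real.exp l - 1) else 0) = a * (Real.exp l - 1) := by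
    rw [ha, Finset.sum_mul]
    exact Finset.sum_congr rfl fun y hy => if_pos hy
  rw [e] at hsum
  set w : 𝒳 → ℝ := fun y => f y θ * Real.exp (l * if y ∈ A then 1 else 0) with hw
  have hw0 : ∀ y, 0 ≤ w y := fun y => mul_nonneg (hf.nonneg y θ hθ) (Real.exp_pos _).le
  have hwsum : HasSum w (1 + a * (Real.exp l - 1)) := hsum.congr_fun fun y => by
    simp only [hw]
    split_ifs
    · ring_nf
    · simp
  have hprod := hasSum_prod_apply hw0 hwsum n
  have hexp : Real.exp l - 1 ≤ l + l ^ 2 := by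
    have := Real.abs_exp_sub_one_sub_id_le (x := l) (by
      rw [abs_le]; constructor <;> rw [hl] <;> linarith)
    linarith [(abs_le.1 this).2]
  have hbase : 0 ≤ 1 + a * (Real.exp l - 1) := hwsum.nonneg hw0
  calc ∑ x ∈ G, lik f x θ ≤ ∑ x ∈ G, Real.exp (-(l * (n * (a + t)))) * ∏ i, w (x i) := by
        refine Finset.sum_le_sum fun x hx => ?_
        have h1 : ∏ i, w (x i) =
            lik f x θ * Real.exp (l * ∑ i, if x i ∈ A then (1 : ℝ) else 0) := by
          simp only [hw, lik]
          rw [Finset.prod_mul_distrib, ← Real.exp_sum, Finset.mul_sum]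
        rw [h1, mul_left_comm, ← Real.exp_add]
        refine le_mul_of_one_le_right (hf.lik_nonneg hθ x) (Real.one_le_exp ?_)
        have h2 := hG x hx
        have hl0 : 0 ≤ l := by positivity
        have := mul_le_mul_of_nonneg_left h2 hl0
        linarith
    _ ≤ Real.exp (-(l * (n * (a + t)))) * (1 + a * (Real.exp l - 1)) ^ n := by
        rw [← Finset.mul_sum]
        gcongr
        exact sum_le_hasSum G (fun x _ => Finset.prod_nonneg fun i _ => hw0 _) hprod
    _ ≤ Real.exp (-(l * (n * (a + t)))) * Real.exp (a * (l + l ^ 2)) ^ n := by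
        gcongr
        have h1 := Real.add_one_le_exp (a * (l + l ^ 2))
        have h2 : a * (Real.exp l - 1) ≤ a * (l + l ^ 2) := by gcongr
        linarith
    _ = Real.exp (n * (a * l ^ 2 - l * t)) := by
        rw [← Real.exp_nat_mul, ← Real.exp_add]; congr 1; ring
    _ ≤ _ := by
        apply Real.exp_le_exp.2
        have h1 : a * l ^ 2 ≤ 1 * l ^ 2 := by gcongr
        have h2 : a * l ^ 2 - l * t ≤ -(t ^ 2 / 4) := by rw [hl] at *; nlinarith
        have h3 : (0 : ℝ) ≤ n := by positivity
        nlinarith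

/-- There are sets of typical data that have probability tending to one under `θ₀` and
exponentially small probability, uniformly, under all parameters outside a neighbourhood of
`θ₀`. -/
theorem exists_typical (hf : IsModel f Θ) (h₀ : θ₀ ∈ Θ) (hident : IdentifiableAt f Θ θ₀)
    {U : Set (Param p)} (hU : U ∈ 𝓝 θ₀) :
    ∃ κ > 0, ∃ T : ∀ n, Set (Fin n → 𝒳),
      (∀ n, ∀ θ ∈ Θ, θ ∉ U → ∀ G : Finset (Fin n → 𝒳), (∀ x ∈ G, x ∈ T n) →
        ∑ x ∈ G, lik f x θ ≤ Real.exp (-κ * n)) ∧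
      ∀ η > 0, ∀ᶠ n in atTop, prob f θ₀ (T n)ᶜ ≤ η := by
  classical
  obtain ⟨ε', hε', hfar'⟩ := hident U hU
  set ε := min ε' 1 with hε
  have hε0 : 0 < ε := by positivity
  obtain ⟨S, hS⟩ := exists_finset_sum_le hf h₀ hε0
  refine ⟨(ε / 8) ^ 2 / 4, by positivity, fun n => {x | ∀ A ⊆ S,
    n * (∑ y ∈ A, f y θ₀ - ε / 8) ≤ ∑ i, if x i ∈ A then (1 : ℝ) else 0}, ?_, ?_⟩
  · intro n θ hθ hθU G hG
    obtain ⟨A, hAS, hA⟩ := hS θ hθ ((min_le_left _ _).trans (hfar' θ hθ hθU))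
    refine sum_lik_le_exp_of_freq hf hθ A (by positivity)
      (by have := min_le_right ε' 1; linarith) G fun x hx => ?_
    refine le_trans ?_ (hG x hx A hAS)
    gcongr
    linarith
  · intro η hη
    have hmean : ∀ A : Finset 𝒳,
        HasSum (fun x => f x θ₀ * (if x ∈ A then (1 : ℝ) else 0)) (∑ y ∈ A, f y θ₀) := fun A => by
      have := hasSum_sum_of_ne_finset_zero (s := A) (L := .unconditional _)
        (f := fun x => f x θ₀ * (if x ∈ A then (1 : ℝ) else 0)) fun y hy => by simp [hy]
      convert this using 1
      exact Finset.sum_congr rfl fun y hy => by simp [hy]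
    have hle1 : ∀ A : Finset 𝒳, 0 ≤ ∑ y ∈ A, f y θ₀ ∧ ∑ y ∈ A, f y θ₀ ≤ 1 := fun A =>
      ⟨Finset.sum_nonneg fun y _ => hf.nonneg y θ₀ h₀,
        sum_le_hasSum A (fun y _ => hf.nonneg y θ₀ h₀) (hf.hasSum_one θ₀ h₀)⟩
    obtain ⟨c, hc, hprob⟩ := exists_prob_abs_sum_ge_le hf h₀ (ι := S.powerset)
      (Y := fun A x => (if x ∈ A.1 then (1 : ℝ) else 0) - ∑ y ∈ A.1, f y θ₀)
      (fun A => by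
        have := (hmean A.1).sub ((hf.hasSum_one θ₀ h₀).mul_right (∑ y ∈ A.1, f y θ₀))
        rw [one_mul, sub_self] at this
        exact this.congr_fun fun x => by ring)
      (fun A => by
        refine Summable.of_nonneg_of_le (fun x => mul_nonneg (hf.nonneg x θ₀ h₀) (sq_nonneg _))
          (fun x => ?_) (hf.hasSum_one θ₀ h₀).summable
        refine mul_le_of_le_one_right (hf.nonneg x θ₀ h₀) ?_
        have := hle1 A.1
        rw [sq_le_one_iff_abs_le_one, abs_le]
        split_ifs <;> constructor <;> linarith) hη
    have hev : ∀ᶠ n : ℕ in atTop, 8 * c / ε ≤ √(n : ℝ) :=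
      (Real.tendsto_sqrt_atTop.comp (tendsto_natCast_atTop_atTop (R := ℝ))).eventually_ge_atTop _
    filter_upwards [hev, eventually_gt_atTop 0] with n hn hn0
    refine (prob_mono hf h₀ fun x hx => ?_).trans (hprob n hn0)
    simp only [mem_compl_iff, mem_ofPred_eq, not_forall, not_le] at hx
    obtain ⟨A, hAS, hA⟩ := hx
    refine ⟨⟨A, Finset.mem_powerset.2 hAS⟩, ?_⟩
    have hsq : (n : ℝ) = √n * √n := (Real.mul_self_sqrt (by positivity)).symm
    rw [div_le_iff₀ hε0] at hn
    have h1 : c * √n ≤ n * (ε / 8) := by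
      have : (8 * c) * √n ≤ (√n * ε) * √n := by gcongr
      nlinarith
    have h2 : ∑ i : Fin n, ((if x i ∈ A then (1 : ℝ) else 0) - ∑ y ∈ A, f y θ₀) ≤
        -(n * (ε / 8)) := by
      rw [Finset.sum_sub_distrib]
      simp only [Finset.sum_const, Finset.card_univ, Fintype.card_fin, nsmul_eq_mul]
      linarith
    rw [le_abs]
    right
    simp only
    linarith

/-- On regular data the law under `θ₀` is dominated by the marginal law up to a factor of the order
`n ^ (p / 2)`. -/
theorem sum_lik_le_of_marginal {κ : ℝ} (hκ : 0 < κ) (hn : 0 < n) {c : ℝ}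
    (h : ∀ x : Fin n → 𝒳, IsRegular f θ₀ M c x → κ / √n ^ p * lik f x θ₀ ≤ marginal f Θ π x)
    (G : Finset (Fin n → 𝒳)) (hG : ∀ x ∈ G, IsRegular f θ₀ M c x) {b : ℝ}
    (hb : ∑ x ∈ G, marginal f Θ π x ≤ b) : ∑ x ∈ G, lik f x θ₀ ≤ √n ^ p / κ * b := by
  have hs : 0 < √(n : ℝ) := Real.sqrt_pos.2 (by exact_mod_cast hn)
  have h1 : κ / √n ^ p * ∑ x ∈ G, lik f x θ₀ ≤ b := by
    rw [Finset.mul_sum]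
    exact (Finset.sum_le_sum fun x hx => h x (hG x hx)).trans hb
  calc ∑ x ∈ G, lik f x θ₀ = √n ^ p / κ * (κ / √n ^ p * ∑ x ∈ G, lik f x θ₀) := by
        field_simp
    _ ≤ _ := by gcongr

theorem sqrt_pow_le (n p : ℕ) (hn : 0 < n) : √(n : ℝ) ^ p ≤ (n : ℝ) ^ p := by
  gcongr
  rw [Real.sqrt_le_left (by positivity)]
  have : (1 : ℝ) ≤ n := by exact_mod_cast hn
  nlinarith

/-- Constants and events that are common to the probabilistic estimates: regular data sets of
constant `c`, and the lower bound for the marginal probability on them. -/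
structure Setting (f : 𝒳 → Param p → ℝ) (Θ : Set (Param p)) (θ₀ : Param p) (π : Param p → ℝ)
    (M : 𝒳 → ℝ) (c κ : ℝ) (n : ℕ) : Prop where
  pos : 0 < n
  marg : IsMarginal f Θ π n
  kpos : 0 < κ
  le : ∀ x : Fin n → 𝒳, IsRegular f θ₀ M c x → κ / √n ^ p * lik f x θ₀ ≤ marginal f Θ π x

/-- Transfer of a bound on marginal probabilities to the law under `θ₀`. -/
theorem Setting.prob_le (hf : IsModel f Θ) (h₀ : θ₀ ∈ Θ) {c κ : ℝ}
    (h : Setting f Θ θ₀ π M c κ n) {A : Set (Fin n → 𝒳)} (hA : ∀ x ∈ A, IsRegular f θ₀ M c x)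
    {b : ℝ} (hb : ∀ G : Finset (Fin n → 𝒳), (∀ x ∈ G, x ∈ A) → ∑ x ∈ G, marginal f Θ π x ≤ b) :
    prob f θ₀ A ≤ √n ^ p / κ * b :=
  prob_le_of_sum_le hf h₀ fun G hG => sum_lik_le_of_marginal h.kpos h.pos h.le G
    (fun x hx => hA x (hG x hx).1) (hb G fun x hx => (hG x hx).1)

/-- The codepoint of the observed data set is consistent. If it is far from `θ₀`, then either the
code is much worse than the likelihood code of `θ₀`, which is excluded by optimality, or the
codepoints give typical data sets more probability than the exponential bounds permit. -/
theorem eventually_prob_code_notMem_le (hf : IsModel f Θ) (h₀ : θ₀ ∈ Θ)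
    (hident : IdentifiableAt f Θ θ₀) {c κ : ℝ} {C : ∀ n : ℕ, TwoPartCode p 𝒳 n}
    (hset : ∀ᶠ n in atTop, Setting f Θ θ₀ π M c κ n)
    (hopt : ∀ᶠ n in atTop, (C n).IsOptimal f Θ π) {U : Set (Param p)} (hU : U ∈ 𝓝 θ₀) {η : ℝ}
    (hη : 0 < η) :
    ∀ᶠ n in atTop, prob f θ₀ {x : Fin n → 𝒳 | IsRegular f θ₀ M c x ∧
      (C n).code ((C n).cell x) ∉ U} ≤ η := by
  classical
  obtain ⟨k, hk, T, hT, hT0⟩ := exists_typical hf h₀ hident hU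
  set β := k / 2 with hβ
  have hβ0 : 0 < β := by positivity
  have hr : |Real.exp (-β)| < 1 := by
    rw [abs_of_pos (Real.exp_pos _), Real.exp_lt_one_iff]
    linarith
  have ht1 : Tendsto (fun n : ℕ => Real.exp 1 / κ * ((n : ℝ) ^ p * Real.exp (-β) ^ n)) atTop
      (𝓝 0) := by
    simpa using (tendsto_pow_const_mul_const_pow_of_abs_lt_one p hr).const_mul (Real.exp 1 / κ)
  have ht2 : Tendsto (fun n : ℕ => Real.exp (-β) ^ n) atTop (𝓝 0) :=
    tendsto_pow_atTop_nhds_zero_of_abs_lt_one hr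
  filter_upwards [hset, hopt, hT0 (η / 3) (by positivity),
    ht1.eventually_lt_const (show 0 < η / 3 by positivity),
    ht2.eventually_lt_const (show 0 < η / 3 by positivity)] with n hs hC hTn h1 h2
  set q := fun x => (C n).assertion f Θ π ((C n).cell x)
  set t := fun x => (C n).code ((C n).cell x)
  set A := {x : Fin n → 𝒳 | IsRegular f θ₀ M c x ∧ t x ∉ U}
  -- `A1` is rare by optimality; on `A2` the likelihood of `θ₀` is at most `exp (β n)` times that of
  -- the mixture of the laws of the codepoints outside `U`, under which typical data have probability
  -- at most `exp (-k n)`, and `β < k`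
  set A1 := {x : Fin n → 𝒳 | IsRegular f θ₀ M c x ∧
    β * n ≤ (C n).messageLength f Θ π ((C n).cell x) x + Real.log (lik f x θ₀)} with hA1
  set A2 := {x : Fin n → 𝒳 | x ∈ T n ∧ x ∈ A ∧
    (C n).messageLength f Θ π ((C n).cell x) x + Real.log (lik f x θ₀) < β * n} with hA2
  have hsub : A ⊆ (T n)ᶜ ∪ (A1 ∪ A2) := fun x hx => by
    by_cases hxT : x ∈ T n
    · right
      rcases le_or_gt (β * n) ((C n).messageLength f Θ π ((C n).cell x) x +
        Real.log (lik f x θ₀)) with h | h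
      · exact Or.inl ⟨hx.1, h⟩
      · exact Or.inr ⟨hxT, hx, h⟩
    · exact Or.inl hxT
  have hp1 : prob f θ₀ A1 ≤ η / 3 := by
    have := hs.prob_le hf h₀ (A := A1) (fun x hx => hx.1)
      (fun G hG => hC.sum_marginal_le_exp hs.marg h₀ G fun x hx => (hG x hx).2)
    refine this.trans (le_trans ?_ h1.le)
    have hk := hs.kpos
    have e : Real.exp (1 - β * n) = Real.exp 1 * Real.exp (-β) ^ n := by
      rw [← Real.exp_nat_mul, ← Real.exp_add]; congr 1; ring
    rw [e]
    calc √(n : ℝ) ^ p / κ * (Real.exp 1 * Real.exp (-β) ^ n)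
        ≤ (n : ℝ) ^ p / κ * (Real.exp 1 * Real.exp (-β) ^ n) := by
          gcongr ?_ / _ * _
          exact sqrt_pow_le n p hs.pos
      _ = _ := by ring
  have hp2 : prob f θ₀ A2 ≤ η / 3 := by
    refine (prob_le_of_sum_le hf h₀ fun G hG => ?_).trans h2.le
    have hq : ∀ x ∈ G, lik f x θ₀ ≤ Real.exp (β * n) * (q x * lik f x (t x)) := fun x hx => by
      have hxA := (hG x hx).1
      have hq0 : 0 < q x := hC.assertion_pos _
      have hl0 : 0 < lik f x (t x) := hxA.2.1.1.lik_pos hf h₀ (hC.code_mem _)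
      have hlog := hxA.2.2
      rw [TwoPartCode.messageLength] at hlog
      rw [← Real.log_le_log_iff (hG x hx).2 (by positivity),
        Real.log_mul (Real.exp_pos _).ne' (by positivity), Real.log_mul hq0.ne' hl0.ne',
        Real.log_exp]
      linarith
    calc ∑ x ∈ G, lik f x θ₀ ≤ ∑ x ∈ G, Real.exp (β * n) * (q x * lik f x (t x)) :=
          Finset.sum_le_sum hq
      _ = Real.exp (β * n) * ∑ j, ∑ x ∈ G with (C n).cell x = j, q x * lik f x (t x) := by
          rw [← Finset.mul_sum, Finset.sum_fiberwise]
      _ ≤ Real.exp (β * n) * ∑ j, (C n).assertion f Θ π j * Real.exp (-k * n) := by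
          gcongr with j _
          have hrw : ∑ x ∈ G with (C n).cell x = j, q x * lik f x (t x) =
              (C n).assertion f Θ π j *
                ∑ x ∈ G with (C n).cell x = j, lik f x ((C n).code j) := by
            rw [Finset.mul_sum]
            refine Finset.sum_congr rfl fun x hx => ?_
            rw [Finset.mem_filter] at hx
            simp only [q, t, hx.2]
          rw [hrw]
          refine mul_le_mul_of_nonneg_left ?_ (hC.assertion_pos j).le
          rcases (G.filter fun x => (C n).cell x = j).eq_empty_or_nonempty with he | ⟨y, hy⟩
          · rw [he, Finset.sum_empty]; positivity
          · rw [Finset.mem_filter] at hy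
            refine hT n _ (hC.code_mem j) ?_ _ fun x hx => ?_
            · have := (hG y hy.1).1.2.1.2
              simpa only [t, hy.2] using this
            · exact (hG x (Finset.mem_filter.1 hx).1).1.1
      _ = Real.exp (-β) ^ n := by
          rw [← Finset.sum_mul, TwoPartCode.sum_assertion hs.marg, one_mul, ← Real.exp_add,
            ← Real.exp_nat_mul]
          congr 1
          rw [hβ]; ring
  have u1 := prob_mono hf h₀ hsub
  have u2 := prob_union_le hf h₀ (T n)ᶜ (A1 ∪ A2)
  have u3 := prob_union_le hf h₀ A1 A2
  linarith

/-- The assertion probability of the cell of the observed data set is at least polynomially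
small. -/
theorem eventually_prob_assertion_lt_le (hf : IsModel f Θ) (h₀ : θ₀ ∈ Θ) {c κ : ℝ}
    {C : ∀ n : ℕ, TwoPartCode p 𝒳 n} (hset : ∀ᶠ n in atTop, Setting f Θ θ₀ π M c κ n)
    (hopt : ∀ᶠ n in atTop, (C n).IsOptimal f Θ π) (B : ℝ) {η : ℝ} (hη : 0 < η) :
    ∀ᶠ n in atTop, prob f θ₀ {x : Fin n → 𝒳 | IsRegular f θ₀ M c x ∧
      Real.log (lik f x ((C n).code ((C n).cell x))) - Real.log (lik f x θ₀) ≤ B ∧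
      Real.log ((C n).assertion f Θ π ((C n).cell x)) < -((p + 1) * Real.log n)} ≤ η := by
  have ht : Tendsto (fun n : ℕ => Real.exp (1 + B) / κ * (n : ℝ)⁻¹) atTop (𝓝 0) := by
    simpa using (tendsto_inv_atTop_nhds_zero_nat (𝕜 := ℝ)).const_mul (Real.exp (1 + B) / κ)
  filter_upwards [hset, hopt, ht.eventually_lt_const hη] with n hs hC hn
  have hn0 : (0 : ℝ) < n := by exact_mod_cast hs.pos
  have hk := hs.kpos
  refine (hs.prob_le hf h₀ (fun x hx => hx.1) (fun G hG =>
    hC.sum_marginal_le_exp hs.marg h₀ (B := (p + 1) * Real.log n - B) G fun x hx => ?_)).trans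
    (le_trans ?_ hn.le)
  · have h1 := (hG x hx).2.1
    have h2 := (hG x hx).2.2
    rw [TwoPartCode.messageLength]
    linarith
  · have e : Real.exp (1 - ((p + 1) * Real.log n - B)) = Real.exp (1 + B) / (n : ℝ) ^ (p + 1) := by
      rw [show 1 - ((p + 1) * Real.log n - B) = 1 + B - Real.log ((n : ℝ) ^ (p + 1)) by
        rw [Real.log_pow]; push_cast; ring, Real.exp_sub, Real.exp_log (by positivity)]
    rw [e]
    calc √(n : ℝ) ^ p / κ * (Real.exp (1 + B) / (n : ℝ) ^ (p + 1))
        ≤ (n : ℝ) ^ p / κ * (Real.exp (1 + B) / (n : ℝ) ^ (p + 1)) := by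
          gcongr ?_ / _ * _
          exact sqrt_pow_le n p hs.pos
      _ = _ := by rw [pow_succ]; field_simp

/-- Near-ties with cells whose codepoint is within `r` of `θ₀`: the bounds `4 ε q_l` for the single
cells add up to `4 ε` times the total marginal probability of these cells. -/
theorem Setting.prob_nearTie_le (hf : IsModel f Θ) (h₀ : θ₀ ∈ Θ) {c κ : ℝ}
    {C : TwoPartCode p 𝒳 n} (hs : Setting f Θ θ₀ π M c κ n) (hC : C.IsOptimal f Θ π) {r ε b : ℝ}
    (hε : 0 ≤ ε) (hε2 : ε ≤ 1 / 2)
    (hb : ∀ G : Finset (Fin n → 𝒳), (∀ x ∈ G, 0 < marginal f Θ π x ∧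
      ‖C.code (C.cell x) - θ₀‖ ≤ r) → ∑ x ∈ G, marginal f Θ π x ≤ b) :
    prob f θ₀ {x : Fin n → 𝒳 | IsRegular f θ₀ M c x ∧ ∃ l, l ≠ C.cell x ∧
      ‖C.code l - θ₀‖ ≤ r ∧ C.messageLength f Θ π l x ≤
        C.messageLength f Θ π (C.cell x) x + ε} ≤ √n ^ p / κ * (4 * ε * b) := by
  classical
  refine hs.prob_le hf h₀ (fun x hx => hx.1) fun G hG => ?_
  set J := Finset.univ.filter fun l : Fin C.k => ‖C.code l - θ₀‖ ≤ r with hJ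
  have hmass : ∑ l ∈ J, C.assertion f Θ π l ≤ b := by
    have hsum := hasSum_sum (s := J) fun l _ => TwoPartCode.hasSum_assertion (C := C) hs.marg l
    refine hasSum_le_of_sum_le hsum fun G' => ?_
    refine le_trans (le_of_eq ?_) (hb (G'.filter fun x => 0 < marginal f Θ π x ∧ C.cell x ∈ J)
      fun x hx => ?_)
    · rw [Finset.sum_filter]
      refine Finset.sum_congr rfl fun x _ => ?_
      by_cases hx : C.cell x ∈ J
      · rw [Finset.sum_eq_single_of_mem _ hx fun l _ hl => indicator_of_notMem
          (fun h : x ∈ C.part l => hl (Eq.symm h)) _,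
          indicator_of_mem (show x ∈ C.part (C.cell x) from rfl)]
        by_cases h0 : 0 < marginal f Θ π x
        · simp [hx, h0]
        · simp [le_antisymm (not_lt.1 h0) (hs.marg.nonneg x)]
      · rw [if_neg fun h => hx h.2]
        refine Finset.sum_eq_zero fun l hl => indicator_of_notMem (fun h : x ∈ C.part l => hx ?_) _
        have : C.cell x = l := h
        rwa [this]
    · rw [Finset.mem_filter] at hx
      exact ⟨hx.2.1, (Finset.mem_filter.1 hx.2.2).2⟩
  have hG' : ∀ x ∈ G, ∃ l, l ≠ C.cell x ∧ ‖C.code l - θ₀‖ ≤ r ∧ C.messageLength f Θ π l x ≤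
      C.messageLength f Θ π (C.cell x) x + ε := fun x hx => (hG x hx).2
  obtain ⟨l, hl'⟩ : ∃ l : (Fin n → 𝒳) → Fin C.k, ∀ x ∈ G, l x ≠ C.cell x ∧
      ‖C.code (l x) - θ₀‖ ≤ r ∧ C.messageLength f Θ π (l x) x ≤
        C.messageLength f Θ π (C.cell x) x + ε := by
    choose l hl using hG'
    refine ⟨fun x => if hx : x ∈ G then l x hx else C.cell x, fun x hx => ?_⟩
    simpa only [dif_pos hx] using hl x hx
  have hl := fun x hx => (hl' x hx).1
  have hlr := fun x hx => (hl' x hx).2.1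
  have hlt := fun x hx => (hl' x hx).2.2
  have hmem : ∀ x ∈ G, l x ∈ J := fun x hx => Finset.mem_filter.2 ⟨Finset.mem_univ _, hlr x hx⟩
  rw [← Finset.sum_fiberwise_of_maps_to hmem]
  calc ∑ j ∈ J, ∑ x ∈ G with l x = j, marginal f Θ π x
      ≤ ∑ j ∈ J, 4 * ε * C.assertion f Θ π j := by
        refine Finset.sum_le_sum fun j _ =>
          hC.sum_marginal_le_of_nearTie hs.marg j hε hε2 _ (fun x hx => ?_) fun x hx => ?_
        · rw [Finset.mem_filter] at hx
          rw [← hx.2]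
          exact (hl x hx.1).symm
        · rw [Finset.mem_filter] at hx
          rw [← hx.2]
          exact hlt x hx.1
    _ ≤ 4 * ε * b := by
        rw [← Finset.mul_sum]; gcongr

end

/-! ### The boundary equation -/

section

variable {f : 𝒳 → Param p → ℝ} {Θ : Set (Param p)} {θ₁ t θ : Param p} {π : Param p → ℝ}
  {ρ L η : ℝ}

/-- Near `θ₁` the Fisher–Rao distance is comparable with the Euclidean distance, with constants
`ρ`, `L`, `η`, and its square agrees up to third order with the Fisher information form. -/
structure FisherComparison (f : 𝒳 → Param p → ℝ) (Θ : Set (Param p)) (θ₁ : Param p)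
    (ρ L η : ℝ) : Prop where
  rho_pos : 0 < ρ
  L_pos : 0 < L
  eta_pos : 0 < η
  le : ∀ t ∈ Metric.ball θ₁ ρ, ∀ θ ∈ Metric.ball θ₁ ρ,
    fisherRao f Θ t θ ≤ ENNReal.ofReal (L * ‖θ - t‖)
  norm_le : ∀ t ∈ Metric.ball θ₁ ρ, ∀ θ, fisherRao f Θ t θ ≤ ENNReal.ofReal η →
    ‖θ - t‖ ≤ L * (fisherRao f Θ t θ).toReal
  abs_sq : ∀ t ∈ Metric.ball θ₁ ρ, ∀ θ, fisherRao f Θ t θ ≤ ENNReal.ofReal η →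
    |(fisherRao f Θ t θ).toReal ^ 2 - fisherForm f t (θ - t)| ≤ L * ‖θ - t‖ ^ 3

/-- `exists_local_comparison` in bundled form. -/
theorem exists_fisherComparison (hΘ : IsOpen Θ) (hf : IsModel f Θ)
    (hsmooth : ∀ x, ContDiffOn ℝ 3 (fun θ => Real.log (f x θ)) Θ)
    (hdom : LocallyDominated f Θ) (hfisher : FisherRegular f Θ) (h₁ : θ₁ ∈ Θ) :
    ∃ ρ L η, FisherComparison f Θ θ₁ ρ L η := by
  obtain ⟨ρ, L, η, hρ, hL, hη, h⟩ := exists_local_comparison hΘ hf hsmooth hdom hfisher h₁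
  exact ⟨ρ, L, η, hρ, hL, hη, fun t ht => (h t ht).1, fun t ht θ hθ => ((h t ht).2 θ hθ).1,
    fun t ht θ hθ => ((h t ht).2 θ hθ).2⟩

namespace FisherComparison

theorem norm_sub_le (h : FisherComparison f Θ θ₁ ρ L η) (ht : t ∈ Metric.ball θ₁ ρ) {s : ℝ}
    (hs0 : 0 ≤ s) (hs : s ≤ η) (hθ : fisherRao f Θ t θ ≤ ENNReal.ofReal s) :
    ‖θ - t‖ ≤ L * s := by
  have hL := h.L_pos
  refine (h.norm_le t ht θ (hθ.trans (ENNReal.ofReal_le_ofReal hs))).trans ?_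
  gcongr
  exact ENNReal.toReal_le_of_le_ofReal hs0 hθ

theorem abs_half_sq_sub_le (h : FisherComparison f Θ θ₁ ρ L η) (ht : t ∈ Metric.ball θ₁ ρ)
    {s : ℝ} (hs0 : 0 ≤ s) (hs : s ≤ η) (hθ : fisherRao f Θ t θ ≤ ENNReal.ofReal s) :
    |(n / 2 : ℝ) * (fisherRao f Θ t θ).toReal ^ 2 - (n / 2 : ℝ) * fisherForm f t (θ - t)| ≤
      L ^ 4 / 2 * (n * s ^ 3) := by
  have hL := h.L_pos
  rw [← mul_sub, abs_mul, abs_of_nonneg (by positivity)]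
  calc (n / 2 : ℝ) * |(fisherRao f Θ t θ).toReal ^ 2 - fisherForm f t (θ - t)|
      ≤ (n / 2 : ℝ) * (L * (L * s) ^ 3) := by
        gcongr
        refine (h.abs_sq t ht θ (hθ.trans (ENNReal.ofReal_le_ofReal hs))).trans ?_
        gcongr
        exact h.norm_sub_le ht hs0 hs hθ
    _ = _ := by ring

end FisherComparison

/-- The boundary defect exceeds the difference of the message lengths by a difference of two
quantities that vanish under the quadratic approximation of the log-likelihood. -/
theorem TwoPartCode.IsOptimal.boundaryDefect_sub_eq {C : TwoPartCode p 𝒳 n}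
    (hC : C.IsOptimal f Θ π) (x : Fin n → 𝒳) (t : Param p) (j l : Fin C.k) :
    C.boundaryDefect f Θ π t j l - (C.messageLength f Θ π j x - C.messageLength f Θ π l x) =
      ((n / 2 : ℝ) * (fisherRao f Θ t (C.code j)).toReal ^ 2 + Real.log (lik f x (C.code j)) -
        Real.log (lik f x t)) -
      ((n / 2 : ℝ) * (fisherRao f Θ t (C.code l)).toReal ^ 2 + Real.log (lik f x (C.code l)) -
        Real.log (lik f x t)) := by
  rw [boundaryDefect, messageLength, messageLength,
    Real.log_div (hC.assertion_pos j).ne' (hC.assertion_pos l).ne']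
  ring

/-- The boundary equation at a single data set, with an explicit error. -/
theorem TwoPartCode.IsOptimal.abs_boundaryDefect_sub_le {C : TwoPartCode p 𝒳 n}
    (hC : C.IsOptimal f Θ π) (h : FisherComparison f Θ θ₁ ρ L η) (ht : t ∈ Metric.ball θ₁ ρ)
    {R ε : ℝ} (hR : 0 ≤ R) (hn : 0 < n) (hRn : R / √n ≤ η) {x : Fin n → 𝒳}
    (hq : LocallyQuadratic f Θ x t R ε) {j l : Fin C.k} (hjl : C.Compete f Θ R t j l) :
    |C.boundaryDefect f Θ π t j l - (C.messageLength f Θ π j x - C.messageLength f Θ π l x)| ≤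
      L ^ 4 * R ^ 3 / √n + 2 * ε := by
  have hs : 0 < √(n : ℝ) := Real.sqrt_pos.2 (by exact_mod_cast hn)
  have hnR : (n : ℝ) * (R / √n) ^ 3 = R ^ 3 / √n := by
    have hsq : (n : ℝ) = √n * √n := (Real.mul_self_sqrt (by positivity)).symm
    generalize √(n : ℝ) = s at *
    rw [hsq]
    field_simp
  rw [hC.boundaryDefect_sub_eq]
  have key : ∀ i, fisherRao f Θ t (C.code i) ≤ ENNReal.ofReal (R / √n) →
      |(n / 2 : ℝ) * (fisherRao f Θ t (C.code i)).toReal ^ 2 + Real.log (lik f x (C.code i)) -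
        Real.log (lik f x t)| ≤ L ^ 4 / 2 * (R ^ 3 / √n) + ε := fun i hi => by
    have h1 := abs_le.1 (h.abs_half_sq_sub_le (n := n) ht (by positivity) hRn hi)
    have h2 := abs_le.1 (hq _ (hC.code_mem i) hi)
    rw [hnR] at h1
    rw [abs_le]
    constructor <;> linarith [h1.1, h1.2, h2.1, h2.2]
  have h1 := abs_le.1 (key j hjl.1)
  have h2 := abs_le.1 (key l hjl.2)
  rw [mul_div_assoc, abs_le]
  constructor <;> linarith [h1.1, h1.2, h2.1, h2.2]

theorem tendsto_const_div_sqrt (a : ℝ) : Tendsto (fun n : ℕ => a / √(n : ℝ)) atTop (𝓝 0) :=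
  tendsto_const_nhds.div_atTop
    (Real.tendsto_sqrt_atTop.comp (tendsto_natCast_atTop_atTop (R := ℝ)))

/-- The boundary equation, uniformly on a compact set of estimates on which the quadratic
approximation is valid. -/
theorem eventually_abs_boundaryDefect_sub_le (hΘ : IsOpen Θ) (hf : IsModel f Θ)
    (hsmooth : ∀ x, ContDiffOn ℝ 3 (fun θ => Real.log (f x θ)) Θ)
    (hdom : LocallyDominated f Θ) (hfisher : FisherRegular f Θ)
    {mle : ∀ n : ℕ, (Fin n → 𝒳) → Param p} {C : ∀ n : ℕ, TwoPartCode p 𝒳 n}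
    (hopt : ∀ᶠ n in atTop, (C n).IsOptimal f Θ π) {K : Set (Param p)} (hK : K ⊆ Θ)
    (hKc : IsCompact K) {D : ∀ n : ℕ, Set (Fin n → 𝒳)}
    (hD : ∀ R > 0, ∀ ε > 0, ∀ᶠ n in atTop, ∀ x ∈ D n, mle n x ∈ K →
      LocallyQuadratic f Θ x (mle n x) R ε) {R ε : ℝ} (hR : 0 < R) (hε : 0 < ε) :
    ∀ᶠ n in atTop, ∀ x ∈ D n, mle n x ∈ K →
      ∀ j l, (C n).Compete f Θ R (mle n x) j l →
        |(C n).boundaryDefect f Θ π (mle n x) j l -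
          ((C n).messageLength f Θ π j x - (C n).messageLength f Θ π l x)| ≤ ε := by
  suffices H : ∀ᶠ n in atTop, ∀ x ∈ D n, mle n x ∈ K → mle n x ∈ K →
      ∀ j l, (C n).Compete f Θ R (mle n x) j l →
        |(C n).boundaryDefect f Θ π (mle n x) j l -
          ((C n).messageLength f Θ π j x - (C n).messageLength f Θ π l x)| ≤ ε by
    filter_upwards [H] with n hn x hx hK using hn x hx hK hK
  refine hKc.induction_on (p := fun s => ∀ᶠ n in atTop, ∀ x ∈ D n, mle n x ∈ K → mle n x ∈ s →
      ∀ j l, (C n).Compete f Θ R (mle n x) j l →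
        |(C n).boundaryDefect f Θ π (mle n x) j l -
          ((C n).messageLength f Θ π j x - (C n).messageLength f Θ π l x)| ≤ ε)
    (Eventually.of_forall fun n x _ _ h => absurd h (notMem_empty _)) ?_ ?_ ?_
  · intro s s' hss h
    filter_upwards [h] with n hn x hx hxK hxs using hn x hx hxK (hss hxs)
  · intro s s' h h'
    filter_upwards [h, h'] with n hn hn' x hx hxK hxs
    exact hxs.elim (hn x hx hxK) (hn' x hx hxK)
  · intro θ₁ h₁
    obtain ⟨ρ, L, η, h⟩ := exists_fisherComparison hΘ hf hsmooth hdom hfisher (hK h₁)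
    refine ⟨Metric.ball θ₁ ρ, mem_nhdsWithin_of_mem_nhds (Metric.ball_mem_nhds _ h.rho_pos), ?_⟩
    filter_upwards [hopt, hD R hR (ε / 4) (by positivity), eventually_gt_atTop 0,
      (tendsto_const_div_sqrt R).eventually_lt_const h.eta_pos,
      (tendsto_const_div_sqrt (L ^ 4 * R ^ 3)).eventually_lt_const (show 0 < ε / 2 by positivity)]
      with n hC hq hn0 hRn herr x hx hxK hxs j l hjl
    refine (hC.abs_boundaryDefect_sub_le h hxs hR.le hn0 hRn.le (hq x hx hxK) hjl).trans ?_
    linarith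

end

/-! ### The observed data set -/

section

variable {f : 𝒳 → Param p → ℝ} {Θ : Set (Param p)} {θ₀ : Param p} {π : Param p → ℝ}
  {δ : ℝ} {F M : 𝒳 → ℝ} {c b ρ L η : ℝ} {mle : ∀ n : ℕ, (Fin n → 𝒳) → Param p}
  {C : ∀ n : ℕ, TwoPartCode p 𝒳 n}

/-- The mesh condition in Euclidean terms: the data sets whose codepoint is near `θ₀` have a maximum
likelihood estimate, at distance `O(n ^ (-1/2))` from the codepoint. -/
theorem eventually_norm_mle_sub_code_le (h : FisherComparison f Θ θ₀ ρ L η)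
    (hmle : ∀ K ⊆ Θ, IsCompact K → ∀ᶠ n in atTop, ∀ j, (C n).code j ∈ K →
      ∀ x ∈ (C n).part j, 0 < marginal f Θ π x → IsMLE f Θ x (mle n x))
    (hmesh : ∀ K ⊆ Θ, IsCompact K → ∃ c : ℝ, ∀ᶠ n : ℕ in atTop, ∀ θ ∈ K,
      (C n).meshSize f Θ π (mle n) θ ≤ ENNReal.ofReal (c / √n)) {r : ℝ} (hr : r < ρ)
    (hrΘ : Metric.closedBall θ₀ r ⊆ Θ) :
    ∃ b > 0, ∀ᶠ n in atTop, ∀ x : Fin n → 𝒳, 0 < marginal f Θ π x →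
      ‖(C n).code ((C n).cell x) - θ₀‖ ≤ r → IsMLE f Θ x (mle n x) ∧
        ‖mle n x - (C n).code ((C n).cell x)‖ ≤ b / √n := by
  have hKc := isCompact_closedBall θ₀ r
  have hL := h.L_pos
  obtain ⟨a, ha⟩ := hmesh _ hrΘ hKc
  refine ⟨L * (|a| + 1), by positivity, ?_⟩
  filter_upwards [hmle _ hrΘ hKc, ha,
    (tendsto_const_div_sqrt (|a| + 1)).eventually_lt_const h.eta_pos] with n hm ham hη x hx hxr
  have hxK : (C n).code ((C n).cell x) ∈ Metric.closedBall θ₀ r := mem_closedBall_iff_norm.2 hxr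
  have hM := hm _ hxK x rfl hx
  refine ⟨hM, ?_⟩
  have h1 : fisherRao f Θ ((C n).code ((C n).cell x)) (mle n x) ≤
      (C n).meshSize f Θ π (mle n) ((C n).code ((C n).cell x)) := by
    have m1 : (C n).code ((C n).cell x) ∈ (C n).region f Θ π (mle n) ((C n).cell x) :=
      Or.inl rfl
    have m2 : mle n x ∈ (C n).region f Θ π (mle n) ((C n).cell x) :=
      Or.inr ⟨x, rfl, hx, hM, rfl⟩
    exact le_iSup_of_le ((C n).cell x) (le_iSup_of_le m1 (le_iSup_of_le _ (le_iSup_of_le m1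
      (le_iSup_of_le _ (le_iSup_of_le m2 le_rfl)))))
  have h2 : fisherRao f Θ ((C n).code ((C n).cell x)) (mle n x) ≤
      ENNReal.ofReal ((|a| + 1) / √n) := by
    refine (h1.trans (ham _ hxK)).trans (ENNReal.ofReal_le_ofReal ?_)
    gcongr
    linarith [le_abs_self a]
  rw [mul_div_assoc]
  exact h.norm_sub_le (Metric.closedBall_subset_ball hr hxK) (by positivity) hη.le h2

/-- The properties of the observed data set that hold with high probability: it is regular, and
its maximum likelihood estimate `t` and its codepoint are within `O(n ^ (-1/2))` of `θ₀`. -/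
structure GoodData (f : 𝒳 → Param p → ℝ) (Θ : Set (Param p)) (θ₀ : Param p) (M : 𝒳 → ℝ)
    (c b : ℝ) (C : TwoPartCode p 𝒳 n) (t : Param p) (x : Fin n → 𝒳) : Prop where
  regular : IsRegular f θ₀ M c x
  isMLE : IsMLE f Θ x t
  norm_mle_le : ‖t - θ₀‖ ≤ b / √n
  norm_code_le : ‖C.code (C.cell x) - θ₀‖ ≤ b / √n

/-- Regularity and consistency of the codepoint bring the estimate near `θ₀` by the mesh condition,
and then within `O(1 / √n)` of `θ₀` by `IsRegular.norm_mle_sub_le`. -/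
theorem exists_prob_not_goodData_le [Countable 𝒳] (hΘ : IsOpen Θ) (h₀ : θ₀ ∈ Θ)
    (hf : IsModel f Θ) (hπ : IsPrior π Θ θ₀)
    (hsmooth : ∀ x, ContDiffOn ℝ 3 (fun θ => Real.log (f x θ)) Θ)
    (hident : IdentifiableAt f Θ θ₀) (hopt : ∀ᶠ n in atTop, (C n).IsOptimal f Θ π)
    (hmle : ∀ K ⊆ Θ, IsCompact K → ∀ᶠ n in atTop, ∀ j, (C n).code j ∈ K →
      ∀ x ∈ (C n).part j, 0 < marginal f Θ π x → IsMLE f Θ x (mle n x))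
    (hmesh : ∀ K ⊆ Θ, IsCompact K → ∃ c : ℝ, ∀ᶠ n : ℕ in atTop, ∀ θ ∈ K,
      (C n).meshSize f Θ π (mle n) θ ≤ ENNReal.ofReal (c / √n))
    (hd : DomBall f Θ θ₀ δ F M) (h : FisherComparison f Θ θ₀ ρ L η) {c₁ c₂ : ℝ} (hc₁ : 0 < c₁)
    (hform : ∀ v, c₁ * ‖v‖ ^ 2 ≤ fisherForm f θ₀ v ∧ fisherForm f θ₀ v ≤ c₂ * ‖v‖ ^ 2)
    {ε : ℝ} (hε : 0 < ε) :
    ∃ c > 0, ∃ b > 0, ∃ κ, (∀ᶠ n in atTop, Setting f Θ θ₀ π M c κ n) ∧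
      ∀ᶠ n in atTop,
        prob f θ₀ {x : Fin n → 𝒳 | ¬ GoodData f Θ θ₀ M c b (C n) (mle n x) x} ≤ ε := by
  obtain ⟨c, hc, hreg⟩ := hd.exists_prob_not_isRegular_le hf (show 0 < ε / 2 by positivity)
  obtain ⟨κ, hκ, hmarg⟩ := exists_marginal_ge hΘ hf hπ hsmooth hd (fun v => (hform v).2) hc.le
  have hset : ∀ᶠ n in atTop, Setting f Θ θ₀ π M c κ n := by
    filter_upwards [hmarg, eventually_gt_atTop 0] with n hn hn0
    exact ⟨hn0, isMarginal hΘ hf hπ hsmooth n, hκ, hn⟩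
  have hδ := hd.pos
  have hρ := h.rho_pos
  obtain ⟨r, hr0, hrδ, hrρ, hrc⟩ : ∃ r > 0, 2 * r < δ ∧ 2 * r < ρ ∧ c * (2 * r) ≤ c₁ / 8 := by
    refine ⟨min (min δ ρ / 4) (c₁ / (16 * c)), by positivity, ?_, ?_, ?_⟩
    · linarith [min_le_left (min δ ρ / 4) (c₁ / (16 * c)), min_le_left δ ρ]
    · linarith [min_le_left (min δ ρ / 4) (c₁ / (16 * c)), min_le_right δ ρ]
    · have := min_le_right (min δ ρ / 4) (c₁ / (16 * c))
      rw [le_div_iff₀ (by positivity)] at this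
      linarith
  obtain ⟨b, hb, hbn⟩ := eventually_norm_mle_sub_code_le h hmle hmesh (r := r) (by linarith)
    ((Metric.closedBall_subset_ball (by linarith)).trans hd.subset)
  refine ⟨c, hc, 4 * c / c₁ + b, by positivity, κ, hset, ?_⟩
  filter_upwards [hset, hbn, eventually_prob_code_notMem_le hf h₀ hident hset hopt
    (Metric.closedBall_mem_nhds θ₀ hr0) (show 0 < ε / 2 by positivity),
    (tendsto_const_div_sqrt b).eventually_lt_const hr0,
    (tendsto_const_div_sqrt (4 * c / c₁)).eventually_lt_const zero_lt_one]
    with n hs hbn hcode hbr hcn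
  have hs0 : 0 < √(n : ℝ) := Real.sqrt_pos.2 (by exact_mod_cast hs.pos)
  have hn4 : c * √n ≤ c₁ / 4 * n := by
    have hsq : (n : ℝ) = √n * √n := (Real.mul_self_sqrt (by positivity)).symm
    generalize √(n : ℝ) = s at *
    rw [div_lt_one hs0, div_lt_iff₀ hc₁] at hcn
    rw [hsq, ← mul_assoc]
    gcongr
    linarith
  refine (prob_mono hf h₀ (B := {x | ¬ IsRegular f θ₀ M c x} ∪ {x | IsRegular f θ₀ M c x ∧
    (C n).code ((C n).cell x) ∉ Metric.closedBall θ₀ r}) fun x hx => ?_).trans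
    ((prob_union_le hf h₀ _ _).trans (by linarith [hreg n hs.pos]))
  by_contra hno
  simp only [mem_union, mem_ofPred_eq, not_or, not_and, not_not] at hno
  obtain ⟨hxr, hxc⟩ := hno
  have hcode := mem_closedBall_iff_norm.1 (hxc hxr)
  have hm0 : 0 < marginal f Θ π x := by
    refine lt_of_lt_of_le ?_ (hs.le x hxr)
    have := hxr.pos
    positivity
  obtain ⟨hM, hMn⟩ := hbn x hm0 hcode
  have ht2 : ‖mle n x - θ₀‖ < 2 * r := by
    calc _ ≤ ‖mle n x - (C n).code ((C n).cell x)‖ + ‖(C n).code ((C n).cell x) - θ₀‖ :=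
          norm_sub_le_norm_sub_add_norm_sub _ _ _
      _ < 2 * r := by linarith
  have hMn' := hxr.norm_mle_sub_le hf hd hc₁ (fun v => (hform v).1) hs.pos hn4 hM
    (mem_ball_iff_norm.2 (by linarith)) (le_trans (by gcongr) hrc)
  refine hx ⟨hxr, hM, hMn'.trans ?_, ?_⟩
  · gcongr
    linarith
  · calc _ ≤ ‖(C n).code ((C n).cell x) - mle n x‖ + ‖mle n x - θ₀‖ :=
          norm_sub_le_norm_sub_add_norm_sub _ _ _
      _ ≤ _ := by
          rw [norm_sub_rev, add_div]
          linarith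

/-- The quadratic approximation at scale `s` of the log-likelihood of a good data set. -/
theorem GoodData.abs_quadratic_le (hf : IsModel f Θ) (hd : DomBall f Θ θ₀ δ F M)
    (h : FisherComparison f Θ θ₀ ρ L η) (hc : 0 ≤ c) (hb : 0 ≤ b) (hn : 0 < n)
    {C : TwoPartCode p 𝒳 n} {t : Param p} {x : Fin n → 𝒳} (hx : GoodData f Θ θ₀ M c b C t x)
    {s : ℝ} (hs0 : 0 ≤ s) (hs : s ≤ η) (hsn : b / √n + L * s < min δ ρ) {θ : Param p}
    (hθ : fisherRao f Θ t θ ≤ ENNReal.ofReal s) :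
    |Real.log (lik f x t) - Real.log (lik f x θ) - (n / 2 : ℝ) * fisherForm f t (θ - t)| ≤
      (c * L ^ 3 + (c * b + c + 3 * envMass F M * b) * L ^ 2) * (n * s ^ 3 + √n * s ^ 2) := by
  have hL := h.L_pos
  have hLs : 0 ≤ L * s := by positivity
  have hE := hd.envMass_nonneg
  have htn := hx.norm_mle_le
  obtain ⟨hδ, hρ⟩ := lt_min_iff.1 hsn
  have hθt := h.norm_sub_le (mem_ball_iff_norm.2 (by linarith)) hs0 hs hθ
  have hθ₀ : ‖θ - θ₀‖ ≤ ‖θ - t‖ + ‖t - θ₀‖ := norm_sub_le_norm_sub_add_norm_sub _ _ _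
  refine (hx.regular.abs_quadratic_le hf hd hc hn hx.isMLE (mem_ball_iff_norm.2 (by linarith)) htn
    (mem_ball_iff_norm.2 (by linarith))).trans ?_
  set Q := c * b + c + 3 * envMass F M * b with hQ
  have hQ0 : 0 ≤ Q := by positivity
  calc c * n * ‖θ - t‖ ^ 3 + Q * √n * ‖θ - t‖ ^ 2
      ≤ c * n * (L * s) ^ 3 + Q * √n * (L * s) ^ 2 := by gcongr
    _ = c * L ^ 3 * (n * s ^ 3) + Q * L ^ 2 * (√n * s ^ 2) := by ring
    _ ≤ c * L ^ 3 * (n * s ^ 3 + √n * s ^ 2) + Q * L ^ 2 * (n * s ^ 3 + √n * s ^ 2) := by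
        gcongr
        · linarith [show 0 ≤ √n * s ^ 2 by positivity]
        · linarith [show 0 ≤ (n : ℝ) * s ^ 3 by positivity]
    _ = _ := by ring

end

/-! ### The Voronoi cell of the observed data set -/

section

variable {f : 𝒳 → Param p → ℝ} {Θ : Set (Param p)} {θ₀ t : Param p} {π : Param p → ℝ}
  {δ : ℝ} {F M : 𝒳 → ℝ} {c b ρ L η : ℝ}

/-- If a cell `l` is not a near-tie for `x`, then the estimate of `x` has smaller weighted squared
distance to its own cell than to `l`. Here `e` bounds the errors of the quadratic approximation,
and cells beyond the distance `s` are out of the competition anyway. -/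
theorem TwoPartCode.IsOptimal.dist_add_weight_lt {C : TwoPartCode p 𝒳 n} (hC : C.IsOptimal f Θ π)
    (hπ : IsMarginal f Θ π n) (hn : 0 < n) {x : Fin n → 𝒳} {s e : ℝ} (hs0 : 0 ≤ s)
    (hq : ∀ l, fisherRao f Θ t (C.code l) ≤ ENNReal.ofReal s →
      |(n / 2 : ℝ) * (fisherRao f Θ t (C.code l)).toReal ^ 2 + Real.log (lik f x (C.code l)) -
        Real.log (lik f x t)| ≤ e)
    {s₁ a : ℝ} (hs₁ : 0 ≤ s₁) (hs₁s : s₁ ≤ s)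
    (hj : fisherRao f Θ t (C.code (C.cell x)) ≤ ENNReal.ofReal s₁)
    (ha : -a ≤ Real.log (C.assertion f Θ π (C.cell x))) (hsa : s₁ ^ 2 + 2 / n * a ≤ s ^ 2)
    {l : Fin C.k} (hl : fisherRao f Θ t (C.code l) ≤ ENNReal.ofReal s →
      C.messageLength f Θ π (C.cell x) x + 2 * e < C.messageLength f Θ π l x) :
    fisherRao f Θ t (C.code (C.cell x)) ^ 2 + C.weight f Θ π (C.cell x) <
      fisherRao f Θ t (C.code l) ^ 2 + C.weight f Θ π l := by
  have hn' : (0 : ℝ) < n := by exact_mod_cast hn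
  have ha0 : 0 ≤ a := by
    have := Real.log_nonpos (hC.assertion_pos (C.cell x)).le
      (TwoPartCode.assertion_le_one hπ (C.cell x))
    linarith
  have hw : ∀ i, 0 ≤ -(2 / n : ℝ) * Real.log (C.assertion f Θ π i) := fun i => by
    have := Real.log_nonpos (hC.assertion_pos i).le (TwoPartCode.assertion_le_one hπ i)
    rw [neg_mul, ← mul_neg]
    have : 0 ≤ -Real.log (C.assertion f Θ π i) := by linarith
    positivity
  rcases le_or_gt (fisherRao f Θ t (C.code l)) (ENNReal.ofReal s) with hls | hls
  · have hjs := hj.trans (ENNReal.ofReal_le_ofReal hs₁s)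
    have conv : ∀ i, fisherRao f Θ t (C.code i) ≤ ENNReal.ofReal s →
        fisherRao f Θ t (C.code i) ^ 2 + C.weight f Θ π i =
          ENNReal.ofReal ((fisherRao f Θ t (C.code i)).toReal ^ 2 +
            -(2 / n : ℝ) * Real.log (C.assertion f Θ π i)) := fun i hi => by
      rw [weight, ENNReal.ofReal_add (by positivity) (hw i), ENNReal.ofReal_pow (by positivity),
        ENNReal.ofReal_toReal (ne_top_of_le_ne_top ENNReal.ofReal_ne_top hi)]
    rw [conv _ hjs, conv _ hls]
    have key : (fisherRao f Θ t (C.code (C.cell x))).toReal ^ 2 +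
          -(2 / n : ℝ) * Real.log (C.assertion f Θ π (C.cell x)) <
        (fisherRao f Θ t (C.code l)).toReal ^ 2 +
          -(2 / n : ℝ) * Real.log (C.assertion f Θ π l) := by
      have h1 := abs_le.1 (hq _ hjs)
      have h2 := abs_le.1 (hq _ hls)
      have h3 := hl hls
      rw [messageLength, messageLength] at h3
      refine lt_of_mul_lt_mul_left ?_ (show (0 : ℝ) ≤ n / 2 by positivity)
      have e1 : ∀ u v : ℝ, (n / 2 : ℝ) * (u + -(2 / n : ℝ) * v) = n / 2 * u - v := fun u v => by
        field_simp
        ring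
      rw [e1, e1]
      linarith [h1.1, h1.2, h2.1, h2.2]
    refine (ENNReal.ofReal_lt_ofReal_iff (lt_of_le_of_lt ?_ key)).2 key
    exact add_nonneg (sq_nonneg _) (hw _)
  · calc fisherRao f Θ t (C.code (C.cell x)) ^ 2 + C.weight f Θ π (C.cell x)
        ≤ ENNReal.ofReal s₁ ^ 2 + ENNReal.ofReal (2 / n * a) := by
          rw [weight, neg_mul, ← mul_neg]
          gcongr
          linarith
      _ = ENNReal.ofReal (s₁ ^ 2 + 2 / n * a) := by
          rw [ENNReal.ofReal_add (by positivity) (by positivity), ENNReal.ofReal_pow hs₁]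
      _ ≤ ENNReal.ofReal s ^ 2 := by
          rw [← ENNReal.ofReal_pow hs0]
          exact ENNReal.ofReal_le_ofReal hsa
      _ < fisherRao f Θ t (C.code l) ^ 2 := ENNReal.pow_lt_pow_left two_ne_zero hls
      _ ≤ _ := le_self_add

/-- The quadratic approximation at the scale `A log n / √n`: its error is `O(log³ n / √n)`. -/
theorem GoodData.abs_dist_sq_add_log_le (hf : IsModel f Θ) (hd : DomBall f Θ θ₀ δ F M)
    (h : FisherComparison f Θ θ₀ ρ L η) (hc : 0 ≤ c) (hb : 0 ≤ b) (hn : 0 < n)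
    (hlog : 1 ≤ Real.log n) {C : TwoPartCode p 𝒳 n} {x : Fin n → 𝒳}
    (hx : GoodData f Θ θ₀ M c b C t x) {A : ℝ} (hA : 0 ≤ A) (hs : locRadius A n ≤ η)
    (hsn : b / √n + L * locRadius A n < min δ ρ) {θ : Param p}
    (hθ : fisherRao f Θ t θ ≤ ENNReal.ofReal (locRadius A n)) :
    |(n / 2 : ℝ) * (fisherRao f Θ t θ).toReal ^ 2 + Real.log (lik f x θ) -
        Real.log (lik f x t)| ≤
      (L ^ 4 / 2 * A ^ 3 + (c * L ^ 3 + (c * b + c + 3 * envMass F M * b) * L ^ 2) *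
        (A ^ 3 + A ^ 2)) * (Real.log n ^ 3 / √n) := by
  have hL := h.L_pos
  have hE := hd.envMass_nonneg
  have hsq : (n : ℝ) = √n * √n := (Real.mul_self_sqrt (by positivity)).symm
  have hr0 : 0 < √(n : ℝ) := Real.sqrt_pos.2 (by exact_mod_cast hn)
  have hs0 : 0 ≤ locRadius A n := by rw [locRadius]; positivity
  have e3 : (n : ℝ) * locRadius A n ^ 3 = A ^ 3 * (Real.log n ^ 3 / √n) := by
    rw [locRadius]
    generalize Real.log (n : ℝ) = l
    generalize √(n : ℝ) = r at *
    rw [hsq]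
    field_simp
  have e2 : √n * locRadius A n ^ 2 ≤ A ^ 2 * (Real.log n ^ 3 / √n) := by
    calc √n * locRadius A n ^ 2 = A ^ 2 * (Real.log n ^ 2 / √n) := by
          rw [locRadius]; field_simp
      _ ≤ _ := by gcongr; norm_num
  have hρ : b / √n + L * locRadius A n < ρ := hsn.trans_le (min_le_right _ _)
  have hLs : 0 ≤ L * locRadius A n := by positivity
  have h1 := abs_le.1 (h.abs_half_sq_sub_le (n := n)
    (mem_ball_iff_norm.2 (by linarith [hx.norm_mle_le])) hs0 hs hθ)
  have h2 := abs_le.1 (hx.abs_quadratic_le hf hd h hc hb hn hs0 hs hsn hθ)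
  set Q := c * L ^ 3 + (c * b + c + 3 * envMass F M * b) * L ^ 2 with hQ
  have hQ0 : 0 ≤ Q := by positivity
  have h3 : Q * (n * locRadius A n ^ 3 + √n * locRadius A n ^ 2) ≤
      Q * ((A ^ 3 + A ^ 2) * (Real.log n ^ 3 / √n)) := by
    gcongr
    rw [add_mul]
    linarith
  rw [e3] at h1
  rw [add_mul, mul_assoc, mul_assoc, abs_le]
  constructor <;> linarith [h1.1, h1.2, h2.1, h2.2]

end

/-! ### Probabilities tending to one -/

section

variable {f : 𝒳 → Param p → ℝ} {Θ : Set (Param p)} {θ₀ : Param p} {π : Param p → ℝ}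
  {mle : ∀ n : ℕ, (Fin n → 𝒳) → Param p} {C : ∀ n : ℕ, TwoPartCode p 𝒳 n}

/-- With `d = 2 (p + 1)` and `l = log n`, the weighted squared distance of the observed cell is below the
squared radius beyond which cells are out of the competition. -/
theorem sq_add_mul_le (a : ℝ) {d l : ℝ} (hd : 0 ≤ d) (hl : 1 ≤ l) :
    a ^ 2 + d * l ≤ ((a ^ 2 + d + 1) * l) ^ 2 := by
  have hll : l ≤ l ^ 2 := by nlinarith
  have h1 : a ^ 2 ≤ a ^ 2 * l ^ 2 := le_mul_of_one_le_right (sq_nonneg a) (by linarith)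
  have h2 : d * l ≤ d * l ^ 2 := by gcongr
  calc a ^ 2 + d * l ≤ (a ^ 2 + d + 1) * l ^ 2 := by nlinarith
    _ ≤ ((a ^ 2 + d + 1) * l) ^ 2 := by
        rw [mul_pow]
        gcongr
        nlinarith [sq_nonneg a]

/-- With probability tending to one the observed data set is good, and for good data sets the errors
of the quadratic approximation and of the boundary equation are `O(1 / √n)`. -/
theorem tendsto_prob_boundary [Countable 𝒳] (hΘ : IsOpen Θ) (h₀ : θ₀ ∈ Θ)
    (hf : IsModel f Θ) (hπ : IsPrior π Θ θ₀)
    (hsmooth : ∀ x, ContDiffOn ℝ 3 (fun θ => Real.log (f x θ)) Θ)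
    (hfisher : FisherRegular f Θ) (hdom : LocallyDominated f Θ)
    (hident : IdentifiableAt f Θ θ₀) (hopt : ∀ᶠ n in atTop, (C n).IsOptimal f Θ π)
    (hmle : ∀ K ⊆ Θ, IsCompact K → ∀ᶠ n in atTop, ∀ j, (C n).code j ∈ K →
      ∀ x ∈ (C n).part j, 0 < marginal f Θ π x → IsMLE f Θ x (mle n x))
    (hmesh : ∀ K ⊆ Θ, IsCompact K → ∃ c : ℝ, ∀ᶠ n : ℕ in atTop, ∀ θ ∈ K,
      (C n).meshSize f Θ π (mle n) θ ≤ ENNReal.ofReal (c / √n)) {R ε : ℝ} (hR : 0 < R)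
    (hε : 0 < ε) :
    Tendsto (fun n => prob f θ₀ {x : Fin n → 𝒳 |
      IsMLE f Θ x (mle n x) ∧ LocallyQuadratic f Θ x (mle n x) R ε ∧
      ∀ j l, (C n).Compete f Θ R (mle n x) j l →
        |(C n).boundaryDefect f Θ π (mle n x) j l -
          ((C n).messageLength f Θ π j x - (C n).messageLength f Θ π l x)| ≤ ε})
      atTop (𝓝 1) := by
  obtain ⟨δ, F, M, hd⟩ := exists_domBall hΘ hf hsmooth hdom h₀
  obtain ⟨ρ, L, η, h⟩ := exists_fisherComparison hΘ hf hsmooth hdom hfisher h₀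
  obtain ⟨c₁, c₂, hc₁, -, hform⟩ :=
    hfisher.form_bounds (singleton_subset_iff.2 h₀) isCompact_singleton
  refine tendsto_prob_of_compl hf h₀ fun η' hη' => ?_
  obtain ⟨c, hc, b, hb, κ, hset, hgood⟩ := exists_prob_not_goodData_le hΘ h₀ hf hπ hsmooth hident
    hopt hmle hmesh hd h hc₁ (hform θ₀ rfl) hη'
  set Q := c * L ^ 3 + (c * b + c + 3 * envMass F M * b) * L ^ 2 with hQ
  filter_upwards [hset, hgood, hopt, (tendsto_const_div_sqrt R).eventually_lt_const h.eta_pos,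
    (tendsto_const_div_sqrt (b + L * R)).eventually_lt_const (lt_min hd.pos h.rho_pos),
    (tendsto_const_div_sqrt (Q * (R ^ 3 + R ^ 2))).eventually_lt_const
      (show 0 < ε / 4 by positivity),
    (tendsto_const_div_sqrt (L ^ 4 * R ^ 3)).eventually_lt_const (show 0 < ε / 2 by positivity)]
    with n hs hg hC hRn hbn hq hL4
  refine (prob_mono hf h₀ fun x hx => ?_).trans hg
  refine fun hgx => hx ?_
  have hr0 : 0 < √(n : ℝ) := Real.sqrt_pos.2 (by exact_mod_cast hs.pos)
  have hsq : (n : ℝ) = √n * √n := (Real.mul_self_sqrt (by positivity)).symm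
  have hbn' : b / √n + L * (R / √n) < min δ ρ := by
    rwa [← mul_div_assoc, ← add_div]
  have hlq : LocallyQuadratic f Θ x (mle n x) R (ε / 4) := fun θ _ hθ => by
    refine (hgx.abs_quadratic_le hf hd h hc.le hb.le hs.pos (by positivity) hRn.le hbn' hθ).trans
      (le_trans (le_of_eq ?_) hq.le)
    rw [← hQ, mul_div_assoc]
    congr 1
    generalize √(n : ℝ) = r at *
    rw [hsq]
    field_simp
  have hLR : 0 ≤ L * (R / √n) := by have := h.L_pos; positivity
  refine ⟨hgx.isMLE, fun θ h1 h2 => (hlq θ h1 h2).trans (by linarith), fun j l hjl => ?_⟩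
  refine (hC.abs_boundaryDefect_sub_le h (mem_ball_iff_norm.2 ?_) hR.le hs.pos hRn.le hlq
    hjl).trans (by linarith)
  linarith [hgx.norm_mle_le, min_le_right δ ρ]

/-- The cell of the observed data set is, with probability tending to one, the unique minimiser
of the weighted squared distance to the codepoints. Distant cells are excluded since the observed
cell has at least polynomially small assertion probability, and nearby cells are excluded by the
absence of near-ties. -/
theorem tendsto_prob_voronoi [Countable 𝒳] (hΘ : IsOpen Θ) (h₀ : θ₀ ∈ Θ)
    (hf : IsModel f Θ) (hπ : IsPrior π Θ θ₀)
    (hsmooth : ∀ x, ContDiffOn ℝ 3 (fun θ => Real.log (f x θ)) Θ)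
    (hfisher : FisherRegular f Θ) (hdom : LocallyDominated f Θ)
    (hident : IdentifiableAt f Θ θ₀) (hopt : ∀ᶠ n in atTop, (C n).IsOptimal f Θ π)
    (hmle : ∀ K ⊆ Θ, IsCompact K → ∀ᶠ n in atTop, ∀ j, (C n).code j ∈ K →
      ∀ x ∈ (C n).part j, 0 < marginal f Θ π x → IsMLE f Θ x (mle n x))
    (hmesh : ∀ K ⊆ Θ, IsCompact K → ∃ c : ℝ, ∀ᶠ n : ℕ in atTop, ∀ θ ∈ K,
      (C n).meshSize f Θ π (mle n) θ ≤ ENNReal.ofReal (c / √n)) :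
    Tendsto (fun n => prob f θ₀ {x : Fin n → 𝒳 | IsMLE f Θ x (mle n x) ∧
      ∀ j, x ∈ (C n).part j ↔ mle n x ∈ (C n).voronoi f Θ π j}) atTop (𝓝 1) := by
  obtain ⟨δ, F, M, hd⟩ := exists_domBall hΘ hf hsmooth hdom h₀
  obtain ⟨ρ, L, η, h⟩ := exists_fisherComparison hΘ hf hsmooth hdom hfisher h₀
  obtain ⟨c₁, c₂, hc₁, -, hform⟩ :=
    hfisher.form_bounds (singleton_subset_iff.2 h₀) isCompact_singleton
  have hδ := hd.pos
  have hρ := h.rho_pos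
  have hL := h.L_pos
  obtain ⟨r, hr0, hrδ, hrρ⟩ : ∃ r > 0, r < δ ∧ r < ρ :=
    ⟨min δ ρ / 2, by positivity, by linarith [min_le_left δ ρ, lt_min hδ hρ],
      by linarith [min_le_right δ ρ, lt_min hδ hρ]⟩
  obtain ⟨b₂, hb₂, hnear⟩ := eventually_norm_mle_sub_code_le h hmle hmesh hrρ
    ((Metric.closedBall_subset_ball hrδ).trans hd.subset)
  refine tendsto_prob_of_compl hf h₀ fun η' hη' => ?_
  obtain ⟨c, hc, b, hb, κ, hset, hgood⟩ := exists_prob_not_goodData_le hΘ h₀ hf hπ hsmooth hident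
    hopt hmle hmesh hd h hc₁ (hform θ₀ rfl) (show 0 < η' / 3 by positivity)
  -- cells beyond the distance `A log n / √n` do not compete
  -- (`2 L b / √n` bounds the distance to the own codepoint, `2 (p + 1) log n / n` its weight)
  set A := (2 * L * b) ^ 2 + 2 * (p + 1) + 1 with hA
  have hbA' : 2 * L * b ≤ A := by
    have : 0 ≤ 2 * ((p : ℝ) + 1) := by positivity
    linarith [sq_nonneg (2 * L * b - 1), sq_nonneg (2 * L * b),
      show (2 * L * b - 1) ^ 2 = (2 * L * b) ^ 2 - 2 * (2 * L * b) + 1 by ring]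
  set A₂ := L * A + b with hA₂
  obtain ⟨K, hK, hsum⟩ := exists_sum_marginal_le hΘ hf hπ hsmooth hd hc₁
    (fun v => (hform θ₀ rfl v).1) hident (A := A₂ + b₂) (by positivity)
  set Q := L ^ 4 / 2 * A ^ 3 + (c * L ^ 3 + (c * b + c + 3 * envMass F M * b) * L ^ 2) *
    (A ^ 3 + A ^ 2) with hQ
  have hlim : Tendsto (fun n : ℕ => 4 * K / κ * (Real.log n ^ (p + 4) / √(n : ℝ))) atTop (𝓝 0) := by
    simpa using (tendsto_log_div_sqrt_pow (p + 4)).const_mul (4 * K / κ)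
  have hrad : Tendsto (fun n : ℕ => b / √(n : ℝ) + L * locRadius A n) atTop (𝓝 0) := by
    simpa using (tendsto_const_div_sqrt b).add ((tendsto_locRadius A).const_mul L)
  filter_upwards [hset, hgood, hopt, hnear, hsum, tendsto_log_natCast.eventually_ge_atTop 1,
    tendsto_log_natCast.eventually_gt_atTop (2 * Q),
    (tendsto_log_div_sqrt_pow 4).eventually_lt_const (show (0 : ℝ) < 1 / 2 by norm_num),
    hlim.eventually_lt_const (show 0 < η' / 3 by positivity),
    (tendsto_locRadius A).eventually_lt_const h.eta_pos,
    hrad.eventually_lt_const (lt_min hδ hρ),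
    (tendsto_locRadius A₂).eventually_lt_const hr0,
    (tendsto_const_div_sqrt b).eventually_lt_const hδ,
    (tendsto_const_div_sqrt b).eventually_lt_const hρ,
    (tendsto_const_div_sqrt (c * b)).eventually_lt_const (show 0 < c₁ / 8 by positivity),
    (tendsto_const_div_sqrt (4 * c / c₁)).eventually_lt_const zero_lt_one,
    eventually_prob_assertion_lt_le hf h₀ hset hopt (c ^ 2 / c₁)
      (show 0 < η' / 3 by positivity)]
    with n hs hg hC hnear hsum hlog hlogQ hε2 hlim hAη hAr hA₂r hbδ hbρ hcb hcn hass
  have hr0' : 0 < √(n : ℝ) := Real.sqrt_pos.2 (by exact_mod_cast hs.pos)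
  have hn0 : (0 : ℝ) < n := by exact_mod_cast hs.pos
  have hk := hs.kpos
  have hsq : (n : ℝ) = √n * √n := (Real.mul_self_sqrt (by positivity)).symm
  have hn4 : c * √n ≤ c₁ / 4 * n := by
    generalize √(n : ℝ) = s at *
    rw [div_lt_one hr0', div_lt_iff₀ hc₁] at hcn
    rw [hsq, ← mul_assoc]
    gcongr
    linarith
  have hdiv : ∀ a : ℝ, 0 ≤ a → a / √n ≤ a * Real.log n / √n := fun a ha => by
    gcongr
    exact le_mul_of_one_le_right ha hlog
  -- the tolerance for near-ties exceeds the error `O(log ^ 3 n / √n)` of the approximation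
  set ε := Real.log n ^ 4 / √(n : ℝ) with hε
  have hε0 : 0 ≤ ε := by positivity
  have htie := hs.prob_nearTie_le hf h₀ hC hε0 hε2.le (r := locRadius A₂ n)
    (b := K * Real.log n ^ p / √n ^ p) fun G hG => hsum G fun x hx => by
      obtain ⟨hx0, hxr⟩ := hG x hx
      obtain ⟨hM, hMn⟩ := hnear x hx0 (hxr.trans hA₂r.le)
      refine ⟨_, hM, ?_⟩
      have e : locRadius (A₂ + b₂) n = b₂ * Real.log n / √n + locRadius A₂ n := by
        rw [locRadius, locRadius]; ring
      rw [e]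
      exact (norm_sub_le_norm_sub_add_norm_sub _ _ _).trans
        (add_le_add (hMn.trans (hdiv b₂ hb₂.le)) hxr)
  have htie' : √(n : ℝ) ^ p / κ * (4 * ε * (K * Real.log n ^ p / √n ^ p)) ≤ η' / 3 := by
    refine le_trans (le_of_eq ?_) hlim.le
    rw [hε, pow_add]
    field_simp
  -- exceptional events: bad data, a small assertion probability, a near-tie
  refine (prob_mono hf h₀ (B := {x | ¬ GoodData f Θ θ₀ M c b (C n) (mle n x) x} ∪
    ({x | IsRegular f θ₀ M c x ∧
      Real.log (lik f x ((C n).code ((C n).cell x))) - Real.log (lik f x θ₀) ≤ c ^ 2 / c₁ ∧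
      Real.log ((C n).assertion f Θ π ((C n).cell x)) < -((p + 1) * Real.log n)} ∪
     {x | IsRegular f θ₀ M c x ∧ ∃ l, l ≠ (C n).cell x ∧
      ‖(C n).code l - θ₀‖ ≤ locRadius A₂ n ∧ (C n).messageLength f Θ π l x ≤
        (C n).messageLength f Θ π ((C n).cell x) x + ε})) fun x hx => ?_).trans
    ((prob_union_le hf h₀ _ _).trans ((add_le_add hg ((prob_union_le hf h₀ _ _).trans
      (add_le_add hass (htie.trans htie')))).trans (le_of_eq (by ring))))
  by_contra hno
  simp only [mem_union, mem_ofPred_eq, not_or, not_not, not_and, not_exists, not_le, not_lt] at hno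
  obtain ⟨hgx, hax, htx⟩ := hno
  have hcode := hgx.norm_code_le
  have hmlen := hgx.norm_mle_le
  have hassx := hax hgx.regular (hgx.regular.log_lik_sub_le_const hf hd hc₁
    (fun v => (hform θ₀ rfl v).1) hn4 (mem_ball_iff_norm.2 (by linarith))
    ((mul_le_mul_of_nonneg_left hcode hc.le).trans (by rw [← mul_div_assoc]; exact hcb.le)))
  have htball : mle n x ∈ Metric.ball θ₀ ρ := mem_ball_iff_norm.2 (by linarith)
  -- the distance from the estimate to its own codepoint
  have hj : fisherRao f Θ (mle n x) ((C n).code ((C n).cell x)) ≤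
      ENNReal.ofReal (2 * L * b / √n) := by
    refine (h.le _ htball _ (mem_ball_iff_norm.2 (by linarith))).trans
      (ENNReal.ofReal_le_ofReal ?_)
    rw [show 2 * L * b / √n = L * (b / √n + b / √n) by ring]
    gcongr
    refine (norm_sub_le_norm_sub_add_norm_sub _ θ₀ _).trans (add_le_add hcode ?_)
    rwa [norm_sub_rev]
  have hloc : ∀ a, locRadius a n = a * Real.log n / √n := fun a => rfl
  have hs0 : 0 ≤ locRadius A n := by rw [hloc]; positivity
  have hbA : 2 * L * b / √n ≤ locRadius A n := by
    refine (hdiv _ (by positivity)).trans ?_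
    rw [hloc]
    gcongr
  have hsa : (2 * L * b / √n) ^ 2 + 2 / n * ((p + 1) * Real.log n) ≤ locRadius A n ^ 2 := by
    rw [hloc, div_pow, div_pow, Real.sq_sqrt hn0.le, div_mul_eq_mul_div, ← add_div]
    gcongr
    rw [hA, ← mul_assoc]
    exact sq_add_mul_le _ (by positivity) hlog
  have hlt : ∀ l, l ≠ (C n).cell x →
      fisherRao f Θ (mle n x) ((C n).code ((C n).cell x)) ^ 2 +
          (C n).weight f Θ π ((C n).cell x) <
        fisherRao f Θ (mle n x) ((C n).code l) ^ 2 + (C n).weight f Θ π l := fun l hl => by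
    refine hC.dist_add_weight_lt hs.marg hs.pos hs0 (e := Q * (Real.log n ^ 3 / √n))
      (fun i hi => hgx.abs_dist_sq_add_log_le hf hd h hc.le hb.le hs.pos hlog (by positivity)
        hAη.le hAr hi) (by positivity) hbA hj hassx hsa fun hls => ?_
    have hcl : ‖(C n).code l - θ₀‖ ≤ locRadius A₂ n := by
      have h1 := h.norm_sub_le htball hs0 hAη.le hls
      have e : locRadius A₂ n = L * locRadius A n + b * Real.log n / √n := by
        rw [hloc, hloc, hA₂]; ring
      rw [e]
      exact (norm_sub_le_norm_sub_add_norm_sub _ _ _).trans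
        (add_le_add h1 (hmlen.trans (hdiv b hb.le)))
    refine lt_of_le_of_lt ?_ (htx hgx.regular l hl hcl)
    rw [hε, ← mul_assoc, ← mul_div_assoc, pow_succ _ 3, mul_comm (Real.log (n : ℝ) ^ 3)]
    gcongr
  refine hx ⟨hgx.isMLE, fun i => ⟨?_, fun hi => ?_⟩⟩
  · rintro rfl
    refine ⟨hgx.isMLE.1, fun l => ?_⟩
    rcases eq_or_ne l ((C n).cell x) with rfl | hl
    · exact le_rfl
    · exact (hlt l hl).le
  · by_contra hne
    exact absurd (hi.2 ((C n).cell x)) (not_le.2 (hlt i fun hi' => hne hi'.symm))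

end
end SMML
end

theorem mainTheorem1 {p : ℕ} {𝒳 : Type*} [Countable 𝒳]
    (f : 𝒳 → SMML.Param p → ℝ) (Θ : Set (SMML.Param p)) (θ₀ : SMML.Param p)
    (π : SMML.Param p → ℝ)
    -- a selection of maximum likelihood estimates (arbitrary where none exists)
    (mle : ∀ n : ℕ, (Fin n → 𝒳) → SMML.Param p)
    -- the sequence of optimal SMML partitions with their codepoints
    (C : ∀ n : ℕ, SMML.TwoPartCode p 𝒳 n)
    (hΘ : IsOpen Θ) (hθ₀ : θ₀ ∈ interior Θ)
    (hf : SMML.IsModel f Θ) (hπ : SMML.IsPrior π Θ θ₀)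
    (hsmooth : ∀ x, ContDiffOn ℝ 3 (fun θ => Real.log (f x θ)) Θ)
    (hfisher : SMML.FisherRegular f Θ)
    (hdom : SMML.LocallyDominated f Θ)
    (hident : SMML.IdentifiableAt f Θ θ₀)
    (hentropy : Summable fun x => f x θ₀ * Real.log (f x θ₀))
    (hopt : ∀ᶠ n in atTop, (C n).IsOptimal f Θ π)
    -- the MLE exists for the data sets in the cells under consideration
    (hmle : ∀ K ⊆ Θ, IsCompact K → ∀ᶠ n in atTop, ∀ j, (C n).code j ∈ K →
      ∀ x ∈ (C n).part j, 0 < SMML.marginal f Θ π x → SMML.IsMLE f Θ x (mle n x))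
    -- the mesh condition
    (hmesh : ∀ K ⊆ Θ, IsCompact K → ∃ c : ℝ, ∀ᶠ n : ℕ in atTop, ∀ θ ∈ K,
      (C n).meshSize f Θ π (mle n) θ ≤ ENNReal.ofReal (c / √n)) :
    -- SMML cells are the preimages of the weighted Fisher–Voronoi cells under the MLE map,
    -- for all cells simultaneously, with probability tending to one
    Tendsto (fun n => SMML.prob f θ₀ {x : Fin n → 𝒳 | SMML.IsMLE f Θ x (mle n x) ∧
      ∀ j, x ∈ (C n).part j ↔ mle n x ∈ (C n).voronoi f Θ π j}) atTop (𝓝 1) ∧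
    -- boundary equation, uniformly on compact sets where the local quadratic approximation is
    -- valid: up to `o(1)` the defect is the difference of the two message lengths, which vanishes
    -- on the boundary between the two cells
    (∀ K ⊆ Θ, IsCompact K → ∀ D : ∀ n : ℕ, Set (Fin n → 𝒳),
      (∀ R > 0, ∀ ε > 0, ∀ᶠ n in atTop, ∀ x ∈ D n, mle n x ∈ K →
        SMML.LocallyQuadratic f Θ x (mle n x) R ε) →
      ∀ R > 0, ∀ ε > 0, ∀ᶠ n in atTop, ∀ x ∈ D n, mle n x ∈ K →
        ∀ j l, (C n).Compete f Θ R (mle n x) j l →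
          |(C n).boundaryDefect f Θ π (mle n x) j l -
            ((C n).messageLength f Θ π j x - (C n).messageLength f Θ π l x)| ≤ ε) ∧
    -- the local quadratic approximation, and with it the boundary equation, is valid at the
    -- observed data set with probability tending to one
    (∀ R > 0, ∀ ε > 0, Tendsto (fun n => SMML.prob f θ₀ {x : Fin n → 𝒳 |
      SMML.IsMLE f Θ x (mle n x) ∧ SMML.LocallyQuadratic f Θ x (mle n x) R ε ∧
      ∀ j l, (C n).Compete f Θ R (mle n x) j l →
        |(C n).boundaryDefect f Θ π (mle n x) j l -
          ((C n).messageLength f Θ π j x - (C n).messageLength f Θ π l x)| ≤ ε})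
      atTop (𝓝 1)) := by
  have h₀ := interior_subset hθ₀
  exact ⟨SMML.tendsto_prob_voronoi hΘ h₀ hf hπ hsmooth hfisher hdom hident hopt hmle hmesh,
    fun K hK hKc D hD R hR ε hε => SMML.eventually_abs_boundaryDefect_sub_le hΘ hf hsmooth hdom
      hfisher hopt hK hKc hD hR hε,
    fun R hR ε hε => SMML.tendsto_prob_boundary hΘ h₀ hf hπ hsmooth hfisher hdom hident hopt hmle
      hmesh hR hε⟩
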